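/- **Setting.** Let $\mathbb M^3_s$ be the space of symmetric real $3\times3$ matrices with inner product $\sigma\cdot\tau=\sum_{ij}\sigma_{ij}\tau_{ij}$, and $a\odot b=\frac12(a\otimes b+b\otimes a)$. Let $\mathsf A_0$ be a symmetric positive definite linear map on $\mathbb M^3_s$; let $\mathbb K_0\subset\mathbb M^3_s$ be closed and convex with $0$ in its interior, with support function $\mathrm H_{\mathbb K_0}(p)=\sup_{\sigma\in\mathbb K_0}\sigma\cdot p\in[0,\infty]$; let $\mathsf G_c,\ell,L>0$. Let $\mathsf k,\mathsf w\in C^2([0,1])$ satisfy $\mathsf k(0)=1$, $\mathsf k(1)=0$, $\mathsf w(0)=0$, $\mathsf w(1)=1$ and, on $(0,1)$, $\mathsf w'>0$, $\mathsf k'<0$, $\mathsf k''\ge0$, $\mathsf w''\ge0$. Put $c_{\mathsf w}=\int_0^1\sqrt{\mathsf w}$ and assume $c^*_{\mathsf w}=\int_0^1\mathsf w^{-1/2}<\infty$. Let $\mathbf s\in\mathbb M^3_s$ with $\mathbf s\cdot\mathbf s=1$ and $\sigma_c>0$ with $\sigma_c\mathbf s\in\partial\mathbb K_0$. Let $\mathbf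 n,\mathbf d_0$ be unit vectors with $\mathbf d_0\cdot\mathbf n\ge0$ such that $\mathbf n\odot\mathbf d_0$ belongs to the normal cone of $\mathbb K_0$ at $\sigma_c\mathbf s$. Let $\Omega_L$ be an open cube of side $L$ centred at the origin with a face normal to $\mathbf n$, and $\Gamma=\{x\in\Omega_L:x\cdot\mathbf n=0\}$. Put $$A^{\mathbf s}=\frac1{\mathsf A_0^{-1}\mathbf s\cdot\mathbf s},\quad \varepsilon_e=\frac{\sigma_c}{A^{\mathbf s}},\quad \ell_{\rm ch}=\frac{\mathsf G_cA^{\mathbf s}}{\sigma_c^2},\quad \rho_c=\inf_{\alpha\in(0,1)}\frac1{c_{\mathsf w}|\mathsf k'(\alpha)|}\frac{d}{d\alpha}\frac{\sqrt{\mathsf w(\alpha)}}{|\mathsf k'(\alpha)|}.$$ A *state* is a triple $(v,q,\beta)$ with $v\in BD(\Omega_L;\mathbb R^3)$, $q$ a finite $\mathbb M^3_s$-valued measure on $\Omega_L$ with $\varepsilon(v)-q\in L^2$ (where $\varepsilon(v)$ is the distributional symmetric gradient), and $\beta\in H^1(\Omega_L)$. Its energy is $$\mathcal E_\ell(v,q,\beta)=\int_{\Omega_L}\tfrac12\mathsf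 A_0(\varepsilon(v)-q)\cdot(\varepsilon(v)-q)\,dx+\int_{\Omega_L}\mathsf k(\beta)\,d\mathrm H_{\mathbb K_0}(q)+\frac{\mathsf G_c}{4c_{\mathsf w}}\int_{\Omega_L}\Big(\frac{\mathsf w(\beta)}\ell+\ell|\nabla\beta|^2\Big)dx\in[0,\infty],$$ where $\mathrm H_{\mathbb K_0}(q)=\mathrm H_{\mathbb K_0}(dq/d\mu)\,\mu$ for any positive $\mu$ dominating $q$, and $\beta$ is taken in its precise representative in the second integral. The state is *admissible at load $t$* if $L^{-3}\int_{\Omega_L}\mathbf s\cdot d\varepsilon(v)=t$ and there is $\bar\alpha\in[0,1]$ with $0\le\beta\le\bar\alpha$ a.e. in $\Omega_L$ and $\beta=\bar\alpha$ a.e. on $\Gamma$ (for the area measure, in the sense of precise representatives). A *localized response* at load $t$ is a state $(u_t,p_t,\alpha_t)$ of the following form, for some $\bar\alpha_t$ such that either $0<\bar\alpha_t<1$ and $$t=\mathsf k(\bar\alpha_t)\,\varepsilon_e+\frac{\mathsf G_c}{c_{\mathsf w}\sigma_cL}\frac{\sqrt{\mathsf w(\bar\alpha_t)}}{|\mathsf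 k'(\bar\alpha_t)|},$$ or $\bar\alpha_t=1$, $\mathsf k'(1)\ne0$ and $t\ge\dfrac{\mathsf G_c}{\sigma_cL}\dfrac1{c_{\mathsf w}|\mathsf k'(1)|}$. With $d_t$ defined by $t=\mathsf k(\bar\alpha_t)\varepsilon_e+\frac{d_t}{L}\,\mathbf s\mathbf n\cdot\mathbf d_0$, $$u_t(x)=\mathsf k(\bar\alpha_t)\sigma_c\,(\mathsf A_0^{-1}\mathbf s)\,x+d_t\mathbf 1_{\{x\cdot\mathbf n>0\}}\mathbf d_0,\qquad p_t=d_t\,(\mathbf n\odot\mathbf d_0)\,\mathcal H^2\llcorner\Gamma,$$ and $\alpha_t(x)=a(x\cdot\mathbf n)$, where $a(r)\in[0,\bar\alpha_t]$ is given by $|r|=\ell\int_{a(r)}^{\bar\alpha_t}\mathsf w^{-1/2}$ if $|r|\le\ell\int_0^{\bar\alpha_t}\mathsf w^{-1/2}$, and $a(r)=0$ otherwise. **Proposition (Optimality of the localized deformation response).** One has $\rho_c>0$. If $2\ell c^*_{\mathsf w}\le L$ and $L/\ell_{\rm ch}\le\rho_c$, then for every $t>\varepsilon_e$ a localized response at load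 $t$ exists, and every localized response at load $t$ is admissible at load $t$, has finite energy, and satisfies $$\mathcal E_\ell(u_t,p_t,\alpha_t)\le\mathcal E_\ell(v,q,\beta)$$ for all states $(v,q,\beta)$ admissible at load $t$. -/

import Mathlib

open MeasureTheory Set Filter Topology
open scoped ENNReal ContDiff

noncomputable section

namespace CohesivePF

/-- Three-dimensional Euclidean space. -/
abbrev V3 := EuclideanSpace ℝ (Fin 3)

/-! ### Symmetric second-order tensors -/

/-- The space of symmetric `3 × 3` real matrices, with its usual (entrywise) topology. -/
def symTensors : Submodule ℝ (Matrix (Fin 3) (Fin 3) ℝ) where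
  carrier := {M | M.IsSymm}
  add_mem' := fun ha hb => ha.add hb
  zero_mem' := Matrix.isSymm_zero
  smul_mem' := fun c _ ha => ha.smul c

/-- The type of symmetric second-order tensors. -/
abbrev M3s := ↥symTensors

/-- The inner product of symmetric tensors. -/
def ddot (σ τ : M3s) : ℝ := ∑ i, ∑ j, σ.1 i j * τ.1 i j

/-- The symmetrized tensor product of two vectors. -/
def symProd (a b : V3) : M3s :=
  ⟨Matrix.of fun i j => (a i * b j + b i * a j) / 2, by
    ext i j; simp only [Matrix.transpose_apply, Matrix.of_apply]; ring⟩

/-- `σ n · d`, the component along `d` of the vector `σ n`. -/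
def traction (σ : M3s) (n d : V3) : ℝ := ∑ i, ∑ j, σ.1 i j * n j * d i

/-- The normal cone to `K` at `σ`. -/
def normalCone (K : Set M3s) (σ : M3s) : Set M3s := {ν | ∀ τ ∈ K, 0 ≤ ddot (σ - τ) ν}

/-- The support function `sup_{σ ∈ K} σ · p`, which may take the value `∞`. It is only used for sets
`K` that contain `0`, for which the supremum is non-negative, so that truncating the negative values
of `σ · p` changes nothing. -/
def supportFun (K : Set M3s) (p : M3s) : ℝ≥0∞ := ⨆ σ ∈ K, ENNReal.ofReal (ddot σ p)

/-! ### Tensor-valued measures -/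

/-- Finite Borel measures on space with values in the symmetric tensors. -/
@[ext]
structure TensorMeasure where
  comp : Fin 3 → Fin 3 → SignedMeasure V3
  symm : ∀ i j, comp i j = comp j i

/-- The sum of the total variations of the components. It is equivalent to the total variation
measure, and every component is absolutely continuous with respect to it. -/
def TensorMeasure.dom (q : TensorMeasure) : Measure V3 := ∑ i, ∑ j, (q.comp i j).totalVariation

/-- The density of a tensor-valued measure `q` with respect to the measure `q.dom`. -/
def TensorMeasure.density (q : TensorMeasure) (x : V3) : M3s :=
  ⟨Matrix.of fun i j => (q.comp i j).rnDeriv q.dom x, by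
    ext i j; simp only [Matrix.transpose_apply, Matrix.of_apply]; rw [q.symm]⟩

/-! ### Weak derivatives -/

/-- Smooth scalar functions with compact support in `Ω`. -/
def IsTest (Ω : Set V3) (φ : V3 → ℝ) : Prop :=
  ContDiff ℝ ∞ φ ∧ HasCompactSupport φ ∧ tsupport φ ⊆ Ω

/-- The partial derivative in the `i`-th coordinate. -/
def partialD (i : Fin 3) (φ : V3 → ℝ) (x : V3) : ℝ := fderiv ℝ φ x (EuclideanSpace.single i 1)

/-- `g` is the weak gradient of `β` in `Ω`. -/
def IsWeakGradient (Ω : Set V3) (β : V3 → ℝ) (g : V3 → V3) : Prop :=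
  ∀ φ, IsTest Ω φ → ∀ i,
    ∫ x in Ω, β x * partialD i φ x = - ∫ x in Ω, g x i * φ x

/-- The measure `E` is the linearized strain `(∇u + ∇ᵀu)/2` of `u` in `Ω`, in the sense of
distributions. -/
def IsStrain (Ω : Set V3) (u : V3 → V3) (E : TensorMeasure) : Prop :=
  ∀ φ, IsTest Ω φ → ∀ i j,
    (E.comp i j).integral φ (ContinuousLinearMap.lsmul ℝ ℝ) =
      - ∫ x in Ω, (u x i * partialD j φ x + u x j * partialD i φ x) / 2

open Classical in
/-- The precise representative of a locally integrable function: the limit of its averages over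
small balls where this limit exists, and `0` elsewhere. -/
def preciseRep (β : V3 → ℝ) (x : V3) : ℝ :=
  if ∃ a, Tendsto (fun r => ⨍ y in Metric.ball x r, β y) (𝓝[>] (0 : ℝ)) (𝓝 a) then
    limUnder (𝓝[>] (0 : ℝ)) (fun r => ⨍ y in Metric.ball x r, β y)
  else 0

/-! ### The cube, the mid-plane and the constitutive functions -/

/-- The open cube of side `L` centred at the origin, with edges along the orthonormal basis `b`. -/
def cube (b : OrthonormalBasis (Fin 3) ℝ V3) (L : ℝ) : Set V3 := {x | ∀ i, |inner ℝ (b i) x| < L / 2}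

/-- The area measure of the mid-plane `Γ = {x ∈ cube b L | x · b 0 = 0}`, the image of the
two-dimensional Lebesgue measure of a square of side `L`. -/
def midPlaneArea (b : OrthonormalBasis (Fin 3) ℝ V3) (L : ℝ) : Measure V3 :=
  Measure.map (fun y : ℝ × ℝ => y.1 • b 1 + y.2 • b 2)
    ((volume : Measure (ℝ × ℝ)).restrict (Ioo (-(L / 2)) (L / 2) ×ˢ Ioo (-(L / 2)) (L / 2)))

/-- The derivative of a function on `[0, 1]` (one-sided at the end points). -/
def D01 (f : ℝ → ℝ) : ℝ → ℝ := derivWithin f (Icc 0 1)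

/-- The assumptions on the strength degradation function `k` and the dissipation potential `w`. -/
structure IsConstitutive (k w : ℝ → ℝ) : Prop where
  k_smooth : ContDiffOn ℝ 2 k (Icc 0 1)
  w_smooth : ContDiffOn ℝ 2 w (Icc 0 1)
  k_zero : k 0 = 1
  k_one : k 1 = 0
  w_zero : w 0 = 0
  w_one : w 1 = 1
  w_deriv : ∀ a ∈ Ioo (0 : ℝ) 1, 0 < D01 w a
  k_deriv : ∀ a ∈ Ioo (0 : ℝ) 1, D01 k a < 0
  k_convex : ∀ a ∈ Ioo (0 : ℝ) 1, 0 ≤ D01 (D01 k) a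
  w_convex : ∀ a ∈ Ioo (0 : ℝ) 1, 0 ≤ D01 (D01 w) a

/-- The normalization constant `c_w`. -/
def cW (w : ℝ → ℝ) : ℝ := ∫ a in (0 : ℝ)..1, √(w a)

/-- The normalization constant `c*_w`. -/
def cStar (w : ℝ → ℝ) : ℝ := ∫ a in (0 : ℝ)..1, 1 / √(w a)

/-- The critical ratio of the cube size to the elasto-cohesive length. -/
def rhoC (k w : ℝ → ℝ) : ℝ :=
  sInf ((fun a => 1 / (cW w * |D01 k a|) * D01 (fun x => √(w x) / |D01 k x|) a) '' Ioo (0 : ℝ) 1)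

/-- The data of the multiaxial model problem: stiffness, strength domain, constitutive functions,
toughness, regularization length, cube size, cube frame (its first vector is the normal `n` to the
mid-plane), loading direction, strength in that direction, and direction of the jump. -/
structure Problem where
  A : M3s ≃ₗ[ℝ] M3s
  K : Set M3s
  k : ℝ → ℝ
  w : ℝ → ℝ
  Gc : ℝ
  ℓ : ℝ
  L : ℝ
  b : OrthonormalBasis (Fin 3) ℝ V3
  s : M3s
  σc : ℝ
  d₀ : V3

namespace Problem

variable (P : Problem)

/-- The unit normal to the mid-plane. -/
def n : V3 := P.b 0

/-- The cube `Ω_L`. -/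
def Ω : Set V3 := cube P.b P.L

/-- The standing assumptions. The last two say that the loading direction `s` is compatible with a
displacement jump of direction `d₀` across a surface with normal `n`. -/
structure Standing : Prop where
  A_symm : ∀ σ τ, ddot (P.A σ) τ = ddot σ (P.A τ)
  A_pos : ∀ σ, σ ≠ 0 → 0 < ddot (P.A σ) σ
  K_closed : IsClosed P.K
  K_convex : Convex ℝ P.K
  K_zero : 0 ∈ interior P.K
  constitutive : IsConstitutive P.k P.w
  Gc_pos : 0 < P.Gc
  ℓ_pos : 0 < P.ℓ
  L_pos : 0 < P.L
  s_unit : ddot P.s P.s = 1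
  σc_pos : 0 < P.σc
  σc_mem : P.σc • P.s ∈ frontier P.K
  d₀_unit : ‖P.d₀‖ = 1
  d₀_open : 0 ≤ inner ℝ P.d₀ P.n
  normal : symProd P.n P.d₀ ∈ normalCone P.K (P.σc • P.s)

/-- The stiffness in the direction `s`: a uniform stress `σ s` produces, through the elastic law,
the strain `σ / stiffness` in the direction `s`. -/
def stiffness : ℝ := 1 / ddot (P.A.symm P.s) P.s

/-- The elasto-cohesive length in the direction `s`. -/
def cohesiveLength : ℝ := P.Gc * P.stiffness / P.σc ^ 2

/-- The elastic limit deformation in the direction `s`. -/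
def epsE : ℝ := P.σc / P.stiffness

/-! ### States and energy -/

/-- States `(u, p, α)` with `u` of bounded deformation, `p` a tensor-valued measure and `α` in `H¹`.
The remaining data are determined by these: the strain measure `E` of `u`, the square-integrable
elastic strain `e = E - p`, and the weak gradient `g` of `α`. -/
structure State where
  u : V3 → V3
  p : TensorMeasure
  α : V3 → ℝ
  E : TensorMeasure
  e : V3 → M3s
  g : V3 → V3
  u_integrable : IntegrableOn u P.Ω
  strain : IsStrain P.Ω u E
  p_carried : ∀ i j, (p.comp i j).restrict P.Ω = p.comp i j
  e_memLp : ∀ i j, MemLp (fun x => (e x).1 i j) 2 (volume.restrict P.Ω)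
  decomposition : ∀ i j, E.comp i j =
    (volume.restrict P.Ω).withDensityᵥ (fun x => (e x).1 i j) + p.comp i j
  α_memLp : MemLp α 2 (volume.restrict P.Ω)
  g_memLp : MemLp g 2 (volume.restrict P.Ω)
  gradient : IsWeakGradient P.Ω α g

/-- The phase-field energy. The integral of `k(α) H_K(p)` over the measure `p` is
`∫ k(α) H_K(dp/dμ) dμ`, which does not depend on the dominating measure `μ` since `H_K` is positively
homogeneous; `α` enters there through its precise representative, since `p` may charge sets of zero
volume. -/
def energy (z : P.State) : ℝ≥0∞ :=
  (∫⁻ x in P.Ω, ENNReal.ofReal (ddot (P.A (z.e x)) (z.e x) / 2)) +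
  (∫⁻ x in P.Ω, ENNReal.ofReal (P.k (preciseRep z.α x)) * supportFun P.K (z.p.density x) ∂z.p.dom) +
  (∫⁻ x in P.Ω, ENNReal.ofReal
    (P.Gc / (4 * cW P.w) * (P.w (z.α x) / P.ℓ + P.ℓ * ‖z.g x‖ ^ 2)))

/-- The constraint of average deformation `t` in the direction `s`. -/
def HasAverageStrain (t : ℝ) (z : P.State) : Prop :=
  1 / P.L ^ 3 * ∑ i, ∑ j, P.s.1 i j * z.E.comp i j P.Ω = t

/-- The phase field attains its maximum, a constant in `[0, 1]`, uniformly on the mid-plane. -/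
def MaxOnMidPlane (z : P.State) : Prop :=
  ∃ ā ∈ Icc (0 : ℝ) 1, (∀ᵐ x ∂volume.restrict P.Ω, 0 ≤ z.α x ∧ z.α x ≤ ā) ∧
    ∀ᵐ x ∂midPlaneArea P.b P.L, preciseRep z.α x = ā

/-! ### The localized response -/

/-- The load at which the maximal damage is `ā`, for `ā < 1`. -/
def loadOf (ā : ℝ) : ℝ :=
  P.k ā * P.epsE + P.Gc / (cW P.w * P.σc * P.L) * (√(P.w ā) / |D01 P.k ā|)

/-- `ā` is the maximal damage of the localized response at the load `t`: before complete failure it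
is related to `t` by `t = loadOf ā`, and it is `1` from the failure load
`Gc / (σc L) / (c_w |k'(1)|)` on; this load is finite only if `k'(1) ≠ 0`. -/
def IsMaxDamage (t ā : ℝ) : Prop :=
  (ā ∈ Ioo (0 : ℝ) 1 ∧ t = P.loadOf ā) ∨
  (ā = 1 ∧ D01 P.k 1 ≠ 0 ∧ P.Gc / (P.σc * P.L) * (1 / (cW P.w * |D01 P.k 1|)) ≤ t)

/-- The amplitude of the displacement jump, fixed by
`t = k(ā) epsE + (jump / L) (s n · d₀)`. -/
def jump (t ā : ℝ) : ℝ := P.L * (t - P.k ā * P.epsE) / traction P.s P.n P.d₀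

/-- The displacement: uniform strain `k(ā) σc A⁻¹ s` off the mid-plane, uniform jump along `d₀` on
it (and no superposed rigid displacement). -/
def locDisp (t ā : ℝ) (x : V3) : V3 :=
  WithLp.toLp 2 ((P.k ā * P.σc) • (P.A.symm P.s).1.mulVec (WithLp.ofLp x)) +
    (if 0 < inner ℝ P.n x then P.jump t ā else 0) • P.d₀

/-- The nonlinear strain: the measure `jump • (n ⊙ d₀)` on the mid-plane. -/
def locPlastic (t ā : ℝ) : TensorMeasure where
  comp i j := (midPlaneArea P.b P.L).withDensityᵥ
    (fun _ => P.jump t ā * (symProd P.n P.d₀).1 i j)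
  symm i j := by rw [← (symProd P.n P.d₀).2.apply i j]

/-- The profile `a` of the phase field, as a function of the coordinate along the normal. -/
def IsProfile (ā : ℝ) (a : ℝ → ℝ) : Prop :=
  ∀ x,
    (|x| ≤ P.ℓ * ∫ β in (0 : ℝ)..ā, 1 / √(P.w β) →
      a x ∈ Icc 0 ā ∧ |x| = P.ℓ * ∫ β in (a x)..ā, 1 / √(P.w β)) ∧
    (P.ℓ * ∫ β in (0 : ℝ)..ā, 1 / √(P.w β) ≤ |x| → a x = 0)

/-- `z` is the localized, crack-like response at the load `t`. -/
def IsLocalizedResponse (t : ℝ) (z : P.State) : Prop :=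
  ∃ ā a, P.IsMaxDamage t ā ∧ P.IsProfile ā a ∧
    z.u =ᵐ[volume.restrict P.Ω] P.locDisp t ā ∧
    z.p = P.locPlastic t ā ∧
    z.α =ᵐ[volume.restrict P.Ω] fun x => a (inner ℝ P.n x)

end Problem

end CohesivePF

end

/-!
The lower bound is a calibration. Let `b` be the maximal damage of an admissible state. Fenchel's
inequality with the stress `k(b) σc s` bounds the elastic energy from below, and since `σc s` lies
in `K` and `k` is decreasing, the plastic energy is at least the work of the same stress on the
plastic strain; the two bounds together involve only the average strain `t`. Let `a` be the
optimal profile with maximum `b`, which satisfies the equipartition `w(a) = ℓ² a'²`. By convexity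
of `w`, the phase-field energy exceeds that of `a` by at least its first variation at `a` in the
direction `β - a`; integrating by parts along the normal on each side of the mid-plane, where both
fields equal `b`, shows that this first variation is nonnegative. Because `0 ≤ β ≤ b`, convergence
of the ball averages of `β` to `b` is convergence in mean of `β` to `b`, so mollification
preserves the mid-plane values in the limit and justifies this for weakly differentiable `β`.

Hence the energy is at least a function of `(t, b)` whose `b`-derivative is a positive multiple of
`|k'(b)| (T(b) - t)`, where `T(b)` is the load at which `b` is the maximal damage of a localized
response. The bound `L / ℓ_ch ≤ ρ_c` says exactly that `T` is monotone, so the maximal damage of a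
localized response at load `t` minimizes this function, and there all the inequalities above are
equalities.
-/

namespace CohesivePF

/-! ### Damage functions -/

section UnitInterval

lemma convexOn_of_derivWithin2_nonneg {s : Set ℝ} (hs : Convex ℝ s) (hu : UniqueDiffOn ℝ s)
    {f : ℝ → ℝ} (hf : ContDiffOn ℝ 2 f s)
    (h : ∀ x ∈ interior s, 0 ≤ derivWithin (derivWithin f s) s x) : ConvexOn ℝ s f := by
  have hf' : ContDiffOn ℝ 1 (derivWithin f s) s := hf.derivWithin hu (by norm_num)
  have hasDeriv {g : ℝ → ℝ} (hg : DifferentiableOn ℝ g s) (x) (hx : x ∈ interior s) :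
      HasDerivWithinAt g (derivWithin g s x) (interior s) x :=
    (hg x (interior_subset hx)).hasDerivWithinAt.mono interior_subset
  exact convexOn_of_hasDerivWithinAt2_nonneg hs hf.continuousOn
    (hasDeriv (hf.differentiableOn two_ne_zero)) (hasDeriv (hf'.differentiableOn one_ne_zero)) h

lemma tangent_le_of_convexOn {s : Set ℝ} {f : ℝ → ℝ} (hf : ConvexOn ℝ s f) {a b : ℝ} (ha : a ∈ s)
    (hb : b ∈ s) (hfa : DifferentiableWithinAt ℝ f s a) :
    f a + derivWithin f s a * (b - a) ≤ f b := by
  rcases lt_trichotomy a b with hab | rfl | hab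
  · have := hf.derivWithin_le_slope ha hb hab hfa
    rw [slope_def_field, le_div_iff₀ (sub_pos.2 hab)] at this
    linarith
  · simp
  · have := hf.slope_le_derivWithin hb ha hab hfa
    rw [slope_def_field, div_le_iff₀ (sub_pos.2 hab)] at this
    linarith

/-- `√f` is at most linear, and `1 / x` is not integrable near `0`. -/
lemma not_intervalIntegrable_one_div_sqrt {f : ℝ → ℝ} {C : ℝ} (hf : ∀ x ∈ Ioc (0 : ℝ) 1, 0 < f x)
    (hC : ∀ x ∈ Ioc (0 : ℝ) 1, f x ≤ C * x ^ 2) :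
    ¬ IntervalIntegrable (fun x => 1 / √(f x)) volume 0 1 := by
  intro hint
  have hC0 : 0 < C := by simpa using (hf 1 ⟨one_pos, le_rfl⟩).trans_le (hC 1 ⟨one_pos, le_rfl⟩)
  have sqrt_le {x : ℝ} (hx : x ∈ Ioc (0 : ℝ) 1) : √(f x) ≤ √C * x := by
    rw [Real.sqrt_le_left (mul_nonneg (Real.sqrt_nonneg C) hx.1.le), mul_pow, Real.sq_sqrt hC0.le]
    exact hC x hx
  have hinv : IntervalIntegrable (fun x : ℝ => x⁻¹) volume 0 1 := by
    refine (hint.const_mul √C).mono_fun' (by fun_prop) ?_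
    filter_upwards [ae_restrict_mem measurableSet_uIoc] with x hx
    rw [uIoc_of_le zero_le_one] at hx
    rw [Real.norm_eq_abs, abs_of_pos (inv_pos.2 hx.1), mul_one_div,
      le_div_iff₀ (Real.sqrt_pos.2 (hf x hx)), inv_mul_le_iff₀ hx.1, mul_comm x]
    exact sqrt_le hx
  simp [intervalIntegrable_inv_iff] at hinv

lemma exists_le_mul_sq_of_derivWithin_eq_zero {f : ℝ → ℝ} (hf : ContDiffOn ℝ 2 f (Icc 0 1))
    (h0 : f 0 = 0) (h0' : derivWithin f (Icc 0 1) 0 = 0) :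
    ∃ C, ∀ x ∈ Icc (0 : ℝ) 1, f x ≤ C * x ^ 2 := by
  obtain ⟨C, hC⟩ := exists_taylor_mean_remainder_bound (n := 1) zero_le_one
    (hf.of_le (by norm_num))
  refine ⟨C, fun x hx => (le_abs_self _).trans ?_⟩
  simpa [taylorWithinEval_succ, iteratedDerivWithin_one, h0, h0'] using hC x hx

lemma hasDerivWithinAt_D01 {f : ℝ → ℝ} (hf : DifferentiableOn ℝ f (Icc 0 1)) {a : ℝ}
    (ha : a ∈ Icc (0 : ℝ) 1) : HasDerivWithinAt f (D01 f a) (Icc 0 1) a :=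
  (hf a ha).hasDerivWithinAt

lemma hasDerivAt_D01 {f : ℝ → ℝ} (hf : DifferentiableOn ℝ f (Icc 0 1)) {a : ℝ}
    (ha : a ∈ Ioo (0 : ℝ) 1) : HasDerivAt f (D01 f a) a :=
  (hasDerivWithinAt_D01 hf (Ioo_subset_Icc_self ha)).hasDerivAt (Icc_mem_nhds ha.1 ha.2)

lemma contDiffOn_D01 {f : ℝ → ℝ} (hf : ContDiffOn ℝ 2 f (Icc 0 1)) :
    ContDiffOn ℝ 1 (D01 f) (Icc 0 1) :=
  hf.derivWithin (uniqueDiffOn_Icc zero_lt_one) (by norm_num)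

lemma convexOn_of_D01_D01_nonneg {f : ℝ → ℝ} (hf : ContDiffOn ℝ 2 f (Icc 0 1))
    (h : ∀ a ∈ Ioo (0 : ℝ) 1, 0 ≤ D01 (D01 f) a) : ConvexOn ℝ (Icc 0 1) f :=
  convexOn_of_derivWithin2_nonneg (convex_Icc 0 1) (uniqueDiffOn_Icc zero_lt_one) hf
    (by rwa [interior_Icc])

end UnitInterval

/-- The assumptions on the dissipation potential `w` alone, up to the normalization `w 1 = 1`. They
are all that matters for the optimal profile of the phase field. -/
structure IsDissipation (w : ℝ → ℝ) : Prop where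
  smooth : ContDiffOn ℝ 2 w (Icc 0 1)
  zero : w 0 = 0
  deriv_pos : ∀ a ∈ Ioo (0 : ℝ) 1, 0 < D01 w a
  convex : ∀ a ∈ Ioo (0 : ℝ) 1, 0 ≤ D01 (D01 w) a

namespace IsDissipation

variable {w : ℝ → ℝ} (h : IsDissipation w)
include h

lemma differentiableOn : DifferentiableOn ℝ w (Icc 0 1) := h.smooth.differentiableOn two_ne_zero

lemma continuousOn : ContinuousOn w (Icc 0 1) := h.smooth.continuousOn

lemma convexOn : ConvexOn ℝ (Icc 0 1) w := convexOn_of_D01_D01_nonneg h.smooth h.convex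

lemma tangent_le {a b : ℝ} (ha : a ∈ Icc (0 : ℝ) 1) (hb : b ∈ Icc (0 : ℝ) 1) :
    w a + D01 w a * (b - a) ≤ w b :=
  tangent_le_of_convexOn h.convexOn ha hb (h.differentiableOn a ha)

lemma monotoneOn_D01 : MonotoneOn (D01 w) (Icc 0 1) :=
  h.convexOn.monotoneOn_derivWithin h.differentiableOn

lemma strictMonoOn : StrictMonoOn w (Icc 0 1) :=
  strictMonoOn_of_deriv_pos (convex_Icc 0 1) h.continuousOn fun a ha => by
    rw [interior_Icc] at ha
    rw [(hasDerivAt_D01 h.differentiableOn ha).deriv]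
    exact h.deriv_pos a ha

lemma D01_nonneg (a : ℝ) : 0 ≤ D01 w a := h.strictMonoOn.monotoneOn.derivWithin_nonneg

lemma pos {a : ℝ} (ha : a ∈ Ioc (0 : ℝ) 1) : 0 < w a :=
  h.zero ▸ h.strictMonoOn (left_mem_Icc.2 zero_le_one) (Ioc_subset_Icc_self ha) ha.1

lemma sqrt_pos {a : ℝ} (ha : a ∈ Ioc (0 : ℝ) 1) : 0 < √(w a) := Real.sqrt_pos.2 (h.pos ha)

lemma nonneg {a : ℝ} (ha : a ∈ Icc (0 : ℝ) 1) : 0 ≤ w a :=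
  h.zero ▸ h.strictMonoOn.monotoneOn (left_mem_Icc.2 zero_le_one) ha ha.1

lemma le_apply_one {a : ℝ} (ha : a ∈ Icc (0 : ℝ) 1) : w a ≤ w 1 :=
  h.strictMonoOn.monotoneOn ha (right_mem_Icc.2 zero_le_one) ha.2

lemma continuousOn_sqrt : ContinuousOn (fun a => √(w a)) (Icc 0 1) := h.continuousOn.sqrt

lemma hasDerivAt_sqrt {a : ℝ} (ha : a ∈ Ioo (0 : ℝ) 1) :
    HasDerivAt (fun x => √(w x)) (D01 w a / (2 * √(w a))) a :=
  (hasDerivAt_D01 h.differentiableOn ha).sqrt (h.pos (Ioo_subset_Ioc_self ha)).ne'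

lemma D01_zero_pos (hw : IntervalIntegrable (fun a => 1 / √(w a)) volume 0 1) : 0 < D01 w 0 := by
  refine (h.D01_nonneg 0).lt_of_ne fun h0 => ?_
  obtain ⟨C, hC⟩ := exists_le_mul_sq_of_derivWithin_eq_zero h.smooth h.zero h0.symm
  exact not_intervalIntegrable_one_div_sqrt (fun _ => h.pos)
    (fun a ha => hC a (Ioc_subset_Icc_self ha)) hw

lemma continuousOn_integral_sqrt : ContinuousOn (fun b => ∫ a in (0 : ℝ)..b, √(w a)) (Icc 0 1) := by
  have h01 := uIcc_of_le (zero_le_one (α := ℝ))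
  have := intervalIntegral.continuousOn_primitive_interval (μ := volume) (a := 0) (b := 1)
    (h01 ▸ h.continuousOn_sqrt.integrableOn_Icc)
  rwa [h01] at this

lemma hasDerivAt_integral_sqrt {b : ℝ} (hb : b ∈ Ioo (0 : ℝ) 1) :
    HasDerivAt (fun b => ∫ a in (0 : ℝ)..b, √(w a)) (√(w b)) b := by
  have hcont := h.continuousOn_sqrt.mono Ioo_subset_Icc_self
  refine intervalIntegral.integral_hasDerivAt_right ?_
    (hcont.stronglyMeasurableAtFilter isOpen_Ioo b hb)
    (hcont.continuousAt (isOpen_Ioo.mem_nhds hb))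
  exact (h.continuousOn_sqrt.mono (Icc_subset_Icc_right hb.2.le)).intervalIntegrable_of_Icc hb.1.le

lemma cW_pos : 0 < cW w := by
  refine intervalIntegral.intervalIntegral_pos_of_pos_on ?_
    (fun a ha => h.sqrt_pos (Ioo_subset_Ioc_self ha)) zero_lt_one
  exact ContinuousOn.intervalIntegrable_of_Icc zero_le_one h.continuousOn_sqrt

end IsDissipation

/-- The function of the damage whose infimum over `(0, 1)` is the critical ratio `rhoC k w`. -/
noncomputable def softening (k w : ℝ → ℝ) (a : ℝ) : ℝ :=
  1 / (cW w * |D01 k a|) * D01 (fun x => √(w x) / |D01 k x|) a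

namespace IsConstitutive

variable {k w : ℝ → ℝ} (h : IsConstitutive k w)
include h

lemma isDissipation : IsDissipation w := ⟨h.w_smooth, h.w_zero, h.w_deriv, h.w_convex⟩

lemma differentiableOn_k : DifferentiableOn ℝ k (Icc 0 1) :=
  h.k_smooth.differentiableOn two_ne_zero

lemma continuousOn_D01_k : ContinuousOn (D01 k) (Icc 0 1) :=
  (contDiffOn_D01 h.k_smooth).continuousOn

lemma monotoneOn_D01_k : MonotoneOn (D01 k) (Icc 0 1) :=
  (convexOn_of_D01_D01_nonneg h.k_smooth h.k_convex).monotoneOn_derivWithin h.differentiableOn_k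

lemma antitoneOn_k : AntitoneOn k (Icc 0 1) := by
  refine antitoneOn_of_deriv_nonpos (convex_Icc 0 1) h.k_smooth.continuousOn
    (h.differentiableOn_k.mono interior_subset) fun a ha => ?_
  rw [interior_Icc] at ha
  rw [(hasDerivAt_D01 h.differentiableOn_k ha).deriv]
  exact (h.k_deriv a ha).le

lemma k_nonneg {a : ℝ} (ha : a ∈ Icc (0 : ℝ) 1) : 0 ≤ k a :=
  h.k_one ▸ h.antitoneOn_k ha (right_mem_Icc.2 zero_le_one) ha.2

lemma k_le_one {a : ℝ} (ha : a ∈ Icc (0 : ℝ) 1) : k a ≤ 1 :=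
  h.k_zero ▸ h.antitoneOn_k (left_mem_Icc.2 zero_le_one) ha ha.1

lemma abs_D01_k (a : ℝ) : |D01 k a| = -D01 k a := abs_of_nonpos h.antitoneOn_k.derivWithin_nonpos

lemma D01_k_zero_neg : D01 k 0 < 0 :=
  (h.monotoneOn_D01_k (left_mem_Icc.2 zero_le_one) (by norm_num) (by norm_num)).trans_lt
    (h.k_deriv (1 / 2) (by norm_num))

lemma hasDerivAt_sqrt_w_div {a : ℝ} (ha : a ∈ Ioo (0 : ℝ) 1) :
    HasDerivAt (fun x => √(w x) / |D01 k x|)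
      (D01 w a / (2 * √(w a)) / |D01 k a| + √(w a) * D01 (D01 k) a / D01 k a ^ 2) a := by
  have hk := (h.k_deriv a ha).ne
  have hD := ((contDiffOn_D01 h.k_smooth).differentiableOn one_ne_zero)
  simp only [h.abs_D01_k]
  refine ((h.isDissipation.hasDerivAt_sqrt ha).div (hasDerivAt_D01 hD ha).neg
    (neg_ne_zero.2 hk)).congr_deriv ?_
  simp only [Pi.neg_apply]
  field_simp
  ring

lemma D01_sqrt_w_div {a : ℝ} (ha : a ∈ Ioo (0 : ℝ) 1) :
    D01 (fun x => √(w x) / |D01 k x|) a =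
      D01 w a / (2 * √(w a)) / |D01 k a| + √(w a) * D01 (D01 k) a / D01 k a ^ 2 :=
  (h.hasDerivAt_sqrt_w_div ha).hasDerivWithinAt.derivWithin
    (uniqueDiffOn_Icc zero_lt_one a (Ioo_subset_Icc_self ha))

lemma softening_eq {a : ℝ} (ha : a ∈ Ioo (0 : ℝ) 1) :
    softening k w a = D01 w a / (2 * cW w * D01 k a ^ 2 * √(w a)) +
      √(w a) * D01 (D01 k) a / (cW w * |D01 k a| ^ 3) := by
  have hk := abs_pos.2 (h.k_deriv a ha).ne
  have hs := h.isDissipation.sqrt_pos (Ioo_subset_Ioc_self ha)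
  have hc := h.isDissipation.cW_pos
  rw [softening, h.D01_sqrt_w_div ha, ← sq_abs (D01 k a)]
  field_simp

lemma le_softening {a : ℝ} (ha : a ∈ Ioo (0 : ℝ) 1) :
    D01 w 0 / (2 * cW w * D01 k 0 ^ 2) ≤ softening k w a := by
  have h0 := left_mem_Icc.2 (zero_le_one (α := ℝ))
  have ha' := Ioo_subset_Icc_self ha
  have hk := h.k_deriv a ha
  have hs := h.isDissipation.sqrt_pos (Ioo_subset_Ioc_self ha)
  have hs1 : √(w a) ≤ 1 := Real.sqrt_le_one.2 (h.w_one ▸ h.isDissipation.le_apply_one ha')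
  have hc := h.isDissipation.cW_pos
  have hkm : D01 k a ^ 2 ≤ D01 k 0 ^ 2 := by
    nlinarith [h.monotoneOn_D01_k h0 ha' ha.1.le]
  have hden : 2 * cW w * D01 k a ^ 2 * √(w a) ≤ 2 * cW w * D01 k 0 ^ 2 :=
    (mul_le_of_le_one_right (by positivity) hs1).trans (by gcongr)
  have hpos : 0 < D01 k a ^ 2 := sq_pos_iff.2 hk.ne
  calc D01 w 0 / (2 * cW w * D01 k 0 ^ 2)
      ≤ D01 w a / (2 * cW w * D01 k a ^ 2 * √(w a)) :=
        div_le_div₀ (h.isDissipation.D01_nonneg a) (h.isDissipation.monotoneOn_D01 h0 ha' ha.1.le)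
          (by positivity) hden
    _ ≤ softening k w a := by
        rw [h.softening_eq ha, le_add_iff_nonneg_right]
        have := h.k_convex a ha
        positivity

lemma rhoC_pos (hw : IntervalIntegrable (fun a => 1 / √(w a)) volume 0 1) : 0 < rhoC k w := by
  have hpos : 0 < D01 w 0 / (2 * cW w * D01 k 0 ^ 2) := by
    have := h.isDissipation.D01_zero_pos hw
    have := h.isDissipation.cW_pos
    have := h.D01_k_zero_neg.ne
    positivity
  refine hpos.trans_le (le_csInf ((nonempty_Ioo.2 zero_lt_one).image _) ?_)
  rintro _ ⟨a, ha, rfl⟩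
  exact h.le_softening ha

lemma rhoC_le_softening {a : ℝ} (ha : a ∈ Ioo (0 : ℝ) 1) : rhoC k w ≤ softening k w a :=
  csInf_le ⟨_, forall_mem_image.2 fun _ => h.le_softening⟩ (mem_image_of_mem _ ha)

end IsConstitutive

/-! ### Tensors and the limit stress -/

section Tensors

lemma ddot_comm (σ τ : M3s) : ddot σ τ = ddot τ σ := by
  simp only [ddot, mul_comm]

lemma ddot_sub_left (σ σ' τ : M3s) : ddot (σ - σ') τ = ddot σ τ - ddot σ' τ := by
  simp [ddot, sub_mul, Finset.sum_sub_distrib]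

lemma ddot_smul_left (c : ℝ) (σ τ : M3s) : ddot (c • σ) τ = c * ddot σ τ := by
  simp [ddot, Finset.mul_sum, mul_assoc]

lemma ddot_sub_right (σ τ τ' : M3s) : ddot σ (τ - τ') = ddot σ τ - ddot σ τ' := by
  rw [ddot_comm, ddot_sub_left, ddot_comm τ, ddot_comm τ']

lemma ddot_smul_right (c : ℝ) (σ τ : M3s) : ddot σ (c • τ) = c * ddot σ τ := by
  rw [ddot_comm, ddot_smul_left, ddot_comm]

lemma ddot_zero_left (τ : M3s) : ddot 0 τ = 0 := by simp [ddot]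

lemma continuous_ddot_left (τ : M3s) : Continuous fun σ => ddot σ τ := by
  unfold ddot
  exact continuous_finsetSum _ fun i _ => continuous_finsetSum _ fun j _ =>
    (continuous_subtype_val.matrix_elem i j).mul continuous_const

lemma ddot_self_nonneg (σ : M3s) : 0 ≤ ddot σ σ :=
  Finset.sum_nonneg fun _ _ => Finset.sum_nonneg fun _ _ => mul_self_nonneg _

lemma ddot_self_pos {σ : M3s} (h : σ ≠ 0) : 0 < ddot σ σ := by
  refine (ddot_self_nonneg σ).lt_of_ne' fun h0 => h ?_
  ext i j
  have hi := (Finset.sum_eq_zero_iff_of_nonneg fun i _ =>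
    Finset.sum_nonneg fun j _ => mul_self_nonneg (σ.1 i j)).1 h0 i (Finset.mem_univ i)
  exact mul_self_eq_zero.1 ((Finset.sum_eq_zero_iff_of_nonneg fun j _ =>
    mul_self_nonneg (σ.1 i j)).1 hi j (Finset.mem_univ j))

lemma ddot_symProd (σ : M3s) (n d : V3) : ddot σ (symProd n d) = traction σ n d := by
  have h01 := σ.2.apply 0 1
  have h02 := σ.2.apply 0 2
  have h12 := σ.2.apply 1 2
  simp only [ddot, traction, symProd, Matrix.of_apply, Fin.sum_univ_three, h01, h02, h12]
  ring

lemma ddot_symProd_self (n d : V3) :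
    ddot (symProd n d) (symProd n d) = (‖n‖ ^ 2 * ‖d‖ ^ 2 + (inner ℝ n d) ^ 2) / 2 := by
  rw [ddot_symProd]
  simp only [traction, symProd, Matrix.of_apply, EuclideanSpace.real_norm_sq_eq,
    PiLp.inner_apply, Real.inner_apply, Fin.sum_univ_three]
  ring

lemma symProd_ne_zero {n d : V3} (hn : n ≠ 0) (hd : d ≠ 0) : symProd n d ≠ 0 := by
  intro h
  have hself := ddot_symProd_self n d
  rw [h, ddot_zero_left] at hself
  have := norm_pos_iff.2 hn
  have := norm_pos_iff.2 hd
  have : 0 < (‖n‖ ^ 2 * ‖d‖ ^ 2 + (inner ℝ n d) ^ 2) / 2 := by positivity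
  exact this.ne hself

lemma ddot_pos_of_mem_normalCone {K : Set M3s} {σ ν : M3s} (hK : 0 ∈ interior K)
    (hν : ν ∈ normalCone K σ) (hν0 : ν ≠ 0) : 0 < ddot σ ν := by
  have hcont : Tendsto (fun δ : ℝ => δ • ν) (𝓝[>] 0) (𝓝 0) := by
    simpa using ((continuous_id.smul continuous_const).tendsto (0 : ℝ)).mono_left
      (f := fun δ : ℝ => δ • ν) nhdsWithin_le_nhds
  obtain ⟨δ, hδK, hδ⟩ := ((hcont.eventually (mem_interior_iff_mem_nhds.1 hK)).and
    self_mem_nhdsWithin).exists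
  have hsub := hν _ hδK
  rw [ddot_sub_left, ddot_smul_left] at hsub
  have := mul_pos (show 0 < δ from hδ) (ddot_self_pos hν0)
  linarith

lemma le_supportFun {K : Set M3s} {σ : M3s} (hσ : σ ∈ closure K) (p : M3s) :
    ENNReal.ofReal (ddot σ p) ≤ supportFun K p := by
  have hclosed : IsClosed {σ | ENNReal.ofReal (ddot σ p) ≤ supportFun K p} :=
    isClosed_le (ENNReal.continuous_ofReal.comp (continuous_ddot_left p)) continuous_const
  exact closure_minimal
    (fun τ hτ => le_iSup₂ (f := fun σ (_ : σ ∈ K) => ENNReal.ofReal (ddot σ p)) τ hτ) hclosed hσ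

lemma supportFun_smul (K : Set M3s) {c : ℝ} (hc : 0 ≤ c) (p : M3s) :
    supportFun K (c • p) = ENNReal.ofReal c * supportFun K p := by
  simp only [supportFun, ddot_smul_right, ENNReal.ofReal_mul hc, ENNReal.mul_iSup]

lemma supportFun_of_mem_normalCone {K : Set M3s} {σ ν : M3s} (hσ : σ ∈ closure K)
    (hν : ν ∈ normalCone K σ) : supportFun K ν = ENNReal.ofReal (ddot σ ν) := by
  refine le_antisymm (iSup₂_le fun τ hτ => ENNReal.ofReal_le_ofReal ?_) (le_supportFun hσ _)
  have := hν τ hτ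
  rwa [ddot_sub_left, sub_nonneg] at this

/-- Fenchel's inequality for the quadratic energy: complete the square around `A⁻¹ σ`. -/
lemma ddot_sub_le_of_nonneg {A : M3s ≃ₗ[ℝ] M3s} (hA : ∀ σ τ, ddot (A σ) τ = ddot σ (A τ))
    (hA0 : ∀ ε, 0 ≤ ddot (A ε) ε) (σ ε : M3s) :
    ddot σ ε - ddot (A.symm σ) σ / 2 ≤ ddot (A ε) ε / 2 := by
  have h := hA0 (ε - A.symm σ)
  rw [map_sub, LinearEquiv.apply_symm_apply, ddot_sub_left, ddot_sub_right, ddot_sub_right,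
    hA ε (A.symm σ), LinearEquiv.apply_symm_apply, ddot_comm ε σ, ddot_comm σ (A.symm σ)] at h
  linarith

end Tensors

namespace Problem

variable {P : Problem}

/-- The analogue of `Standing` for an arbitrary neighbourhood `K` of `0` whose closure contains
`σc • s`, and for a loading direction `s` and a jump direction `d₀` of arbitrary length. -/
structure WeakStanding (P : Problem) : Prop where
  A_symm : ∀ σ τ, ddot (P.A σ) τ = ddot σ (P.A τ)
  A_pos : ∀ σ, σ ≠ 0 → 0 < ddot (P.A σ) σ
  K_zero : 0 ∈ interior P.K
  constitutive : IsConstitutive P.k P.w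
  Gc_pos : 0 < P.Gc
  ℓ_pos : 0 < P.ℓ
  L_pos : 0 < P.L
  σc_pos : 0 < P.σc
  σc_mem : P.σc • P.s ∈ closure P.K
  d₀_ne_zero : P.d₀ ≠ 0
  normal : symProd P.n P.d₀ ∈ normalCone P.K (P.σc • P.s)

lemma Standing.weak (hP : P.Standing) : P.WeakStanding where
  __ := hP
  σc_mem := frontier_subset_closure hP.σc_mem
  d₀_ne_zero := norm_ne_zero_iff.1 (by simp [hP.d₀_unit])

lemma epsE_eq (P : Problem) : P.epsE = P.σc * ddot (P.A.symm P.s) P.s := by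
  simp [epsE, stiffness]

namespace WeakStanding

variable (hP : P.WeakStanding)
include hP

lemma A_nonneg (ε : M3s) : 0 ≤ ddot (P.A ε) ε := by
  rcases eq_or_ne ε 0 with rfl | hε
  · simp [ddot_zero_left]
  · exact (hP.A_pos ε hε).le

lemma traction_pos : 0 < traction P.s P.n P.d₀ := by
  have h := ddot_pos_of_mem_normalCone hP.K_zero hP.normal
    (symProd_ne_zero (P.b.orthonormal.ne_zero 0) hP.d₀_ne_zero)
  rw [ddot_smul_left, ddot_symProd] at h
  exact pos_of_mul_pos_right h hP.σc_pos.le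

lemma compliance_pos : 0 < ddot (P.A.symm P.s) P.s := by
  have hs : P.s ≠ 0 := fun h => hP.traction_pos.ne' (by simp [h, traction])
  have := hP.A_pos (P.A.symm P.s) (by simpa using hs)
  rwa [LinearEquiv.apply_symm_apply, ddot_comm] at this

lemma epsE_pos : 0 < P.epsE := epsE_eq P ▸ mul_pos hP.σc_pos hP.compliance_pos

lemma size_ratio_eq : P.L / P.cohesiveLength = P.L * P.σc * P.epsE / P.Gc := by
  have := hP.compliance_pos
  have := hP.Gc_pos
  have := hP.σc_pos
  rw [epsE_eq, cohesiveLength, stiffness]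
  field_simp

end WeakStanding

end Problem

/-! ### The load and the reduced energy -/

namespace IsConstitutive

variable {k w : ℝ → ℝ} (h : IsConstitutive k w)
include h

lemma D01_k_neg {a : ℝ} (ha : D01 k a ≠ 0) : D01 k a < 0 :=
  h.antitoneOn_k.derivWithin_nonpos.lt_of_ne ha

lemma convex_D01_k_ne_zero : Convex ℝ {a | a ∈ Icc (0 : ℝ) 1 ∧ D01 k a ≠ 0} := by
  refine OrdConnected.convex ⟨fun x hx y hy a ha => ?_⟩
  have ha01 : a ∈ Icc (0 : ℝ) 1 := ⟨hx.1.1.trans ha.1, ha.2.trans hy.1.2⟩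
  exact ⟨ha01, ((h.monotoneOn_D01_k ha01 hy.1 ha.2).trans_lt (h.D01_k_neg hy.2)).ne⟩

lemma tendsto_sqrt_w_div_atTop (hk1 : D01 k 1 = 0) :
    Tendsto (fun a => √(w a) / |D01 k a|) (𝓝[<] 1) atTop := by
  have h1 := right_mem_Icc.2 (zero_le_one (α := ℝ))
  rw [← nhdsWithin_Ioo_eq_nhdsLT (zero_lt_one' ℝ)]
  have hw : Tendsto (fun a => √(w a)) (𝓝[Ioo 0 1] 1) (𝓝 1) := by
    simpa only [h.w_one, Real.sqrt_one] using
      (h.isDissipation.continuousOn_sqrt 1 h1).mono_left (nhdsWithin_mono _ Ioo_subset_Icc_self)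
  have hk : Tendsto (fun a => |D01 k a|) (𝓝[Ioo 0 1] 1) (𝓝[>] 0) := by
    refine tendsto_nhdsWithin_iff.2 ⟨?_, eventually_mem_nhdsWithin.mono fun a ha =>
      abs_pos.2 (h.k_deriv a ha).ne⟩
    simpa only [hk1, abs_zero] using
      (h.continuousOn_D01_k.abs 1 h1).mono_left (nhdsWithin_mono _ Ioo_subset_Icc_self)
  exact hw.pos_mul_atTop one_pos hk.inv_tendsto_nhdsGT_zero

end IsConstitutive

namespace Problem

variable {P : Problem}

lemma IsMaxDamage.mem_Ioc {t ā : ℝ} (hā : P.IsMaxDamage t ā) : ā ∈ Ioc (0 : ℝ) 1 := by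
  rcases hā with ⟨hā, -⟩ | ⟨rfl, -⟩
  · exact Ioo_subset_Ioc_self hā
  · exact right_mem_Ioc.2 one_pos

section LoadOf

variable (h : IsConstitutive P.k P.w)
include h

lemma loadOf_zero : P.loadOf 0 = P.epsE := by simp [loadOf, h.k_zero, h.w_zero]

lemma loadOf_one : P.loadOf 1 = P.Gc / (P.σc * P.L) * (1 / (cW P.w * |D01 P.k 1|)) := by
  simp only [loadOf, h.k_one, h.w_one, Real.sqrt_one]
  ring

lemma continuousOn_loadOf : ContinuousOn P.loadOf {a | a ∈ Icc (0 : ℝ) 1 ∧ D01 P.k a ≠ 0} :=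
  ((h.k_smooth.continuousOn.mul continuousOn_const).mono fun _ => And.left).add
    (continuousOn_const.mul ((h.isDissipation.continuousOn_sqrt.mono fun _ => And.left).div
      (h.continuousOn_D01_k.mono fun _ => And.left).abs fun _ ha => abs_ne_zero.2 ha.2))

lemma hasDerivAt_loadOf {a : ℝ} (ha : a ∈ Ioo (0 : ℝ) 1) :
    HasDerivAt P.loadOf
      (|D01 P.k a| * (P.Gc / (P.L * P.σc) * softening P.k P.w a - P.epsE)) a := by
  have hw := h.hasDerivAt_sqrt_w_div ha
  rw [← h.D01_sqrt_w_div ha] at hw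
  refine (((hasDerivAt_D01 h.differentiableOn_k ha).mul_const _).add
    (hw.const_mul _)).congr_deriv ?_
  have hk : |D01 P.k a| ≠ 0 := abs_ne_zero.2 (h.k_deriv a ha).ne
  have hmul : |D01 P.k a| * softening P.k P.w a =
      D01 (fun x => √(P.w x) / |D01 P.k x|) a / cW P.w := by
    rw [softening]
    field_simp
  rw [mul_sub, mul_left_comm, hmul, h.abs_D01_k]
  ring

end LoadOf

namespace WeakStanding

variable (hP : P.WeakStanding)
include hP

lemma tendsto_loadOf_atTop (hk1 : D01 P.k 1 = 0) : Tendsto P.loadOf (𝓝[<] 1) atTop := by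
  have h := hP.constitutive
  have hC : 0 < P.Gc / (cW P.w * P.σc * P.L) := by
    have := hP.Gc_pos; have := hP.L_pos; have := hP.σc_pos; have := h.isDissipation.cW_pos
    positivity
  have hk : Tendsto (fun a => P.k a * P.epsE) (𝓝[<] 1) (𝓝 (P.k 1 * P.epsE)) := by
    rw [← nhdsWithin_Ioo_eq_nhdsLT (zero_lt_one' ℝ)]
    exact ((h.k_smooth.continuousOn 1 (right_mem_Icc.2 zero_le_one)).mono_left
      (nhdsWithin_mono _ Ioo_subset_Icc_self)).mul_const _
  exact hk.add_atTop ((h.tendsto_sqrt_w_div_atTop hk1).const_mul_atTop hC)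

lemma monotoneOn_loadOf (hρ : P.L / P.cohesiveLength ≤ rhoC P.k P.w) :
    MonotoneOn P.loadOf {a | a ∈ Icc (0 : ℝ) 1 ∧ D01 P.k a ≠ 0} := by
  have h := hP.constitutive
  have hint : interior {a | a ∈ Icc (0 : ℝ) 1 ∧ D01 P.k a ≠ 0} ⊆ Ioo 0 1 :=
    (interior_mono fun _ => And.left).trans interior_Icc.subset
  refine monotoneOn_of_hasDerivWithinAt_nonneg h.convex_D01_k_ne_zero (continuousOn_loadOf h)
    (fun a ha => (hasDerivAt_loadOf h (hint ha)).hasDerivWithinAt) fun a ha => ?_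
  refine mul_nonneg (abs_nonneg _) (sub_nonneg.2 ?_)
  have hG := hP.Gc_pos
  have hL := hP.L_pos
  have hσ := hP.σc_pos
  calc P.epsE = P.Gc / (P.L * P.σc) * (P.L / P.cohesiveLength) := by
        rw [hP.size_ratio_eq]
        field_simp
    _ ≤ P.Gc / (P.L * P.σc) * softening P.k P.w a := by
        have := hρ.trans (h.rhoC_le_softening (hint ha))
        gcongr

lemma exists_isMaxDamage_of_lt_loadOf {t : ℝ} (ht : P.epsE < t) {c : ℝ}
    (hc : c ∈ Icc (0 : ℝ) 1) (hk : D01 P.k c ≠ 0) (htc : t < P.loadOf c) :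
    ∃ ā, P.IsMaxDamage t ā := by
  have h := hP.constitutive
  have hsub : Icc 0 c ⊆ {a | a ∈ Icc (0 : ℝ) 1 ∧ D01 P.k a ≠ 0} :=
    h.convex_D01_k_ne_zero.ordConnected.out
      ⟨left_mem_Icc.2 zero_le_one, h.D01_k_zero_neg.ne⟩ ⟨hc, hk⟩
  obtain ⟨ā, hā, rfl⟩ := intermediate_value_Ioo hc.1 ((continuousOn_loadOf h).mono hsub)
    ⟨(loadOf_zero h).symm ▸ ht, htc⟩
  exact ⟨ā, Or.inl ⟨⟨hā.1, hā.2.trans_le hc.2⟩, rfl⟩⟩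

lemma exists_isMaxDamage {t : ℝ} (ht : P.epsE < t) : ∃ ā, P.IsMaxDamage t ā := by
  have h := hP.constitutive
  by_cases hk1 : D01 P.k 1 = 0
  · obtain ⟨c, htc, hc⟩ := (((hP.tendsto_loadOf_atTop hk1).eventually_gt_atTop t).and
      (Ioo_mem_nhdsLT zero_lt_one)).exists
    exact hP.exists_isMaxDamage_of_lt_loadOf ht (Ioo_subset_Icc_self hc) (h.k_deriv c hc).ne htc
  · rcases lt_or_ge t (P.loadOf 1) with hlt | hle
    · exact hP.exists_isMaxDamage_of_lt_loadOf ht (right_mem_Icc.2 zero_le_one) hk1 hlt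
    · exact ⟨1, Or.inr ⟨rfl, hk1, (loadOf_one h).symm.trans_le hle⟩⟩

end WeakStanding

/-- The energy of the localized response at load `t` as a function of its maximal damage `b`. It
bounds the energy of every admissible state with damage `b` on the mid-plane from below. -/
noncomputable def redEnergy (P : Problem) (t b : ℝ) : ℝ :=
  P.L ^ 3 * (P.k b * P.σc * t - P.k b ^ 2 * P.σc * P.epsE / 2) +
    P.Gc * P.L ^ 2 / cW P.w * ∫ a in (0 : ℝ)..b, √(P.w a)

lemma continuousOn_redEnergy (h : IsConstitutive P.k P.w) (t : ℝ) :
    ContinuousOn (P.redEnergy t) (Icc 0 1) := by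
  have hk := h.k_smooth.continuousOn
  have hInt := h.isDissipation.continuousOn_integral_sqrt
  unfold redEnergy
  fun_prop

namespace WeakStanding

variable (hP : P.WeakStanding)
include hP

lemma hasDerivAt_redEnergy (t : ℝ) {b : ℝ} (hb : b ∈ Ioo (0 : ℝ) 1) :
    HasDerivAt (P.redEnergy t) (P.L ^ 3 * P.σc * |D01 P.k b| * (P.loadOf b - t)) b := by
  have h := hP.constitutive
  have hk := hasDerivAt_D01 h.differentiableOn_k hb
  refine (((((hk.mul_const P.σc).mul_const t).sub
    ((((hk.pow 2).mul_const P.σc).mul_const P.epsE).div_const 2)).const_mul (P.L ^ 3)).add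
    ((h.isDissipation.hasDerivAt_integral_sqrt hb).const_mul
      (P.Gc * P.L ^ 2 / cW P.w))).congr_deriv ?_
  have hL := hP.L_pos
  have hσ := hP.σc_pos
  have hc := h.isDissipation.cW_pos
  have hk' := (h.k_deriv b hb).ne
  rw [loadOf, h.abs_D01_k]
  field_simp
  ring

lemma antitoneOn_redEnergy (hρ : P.L / P.cohesiveLength ≤ rhoC P.k P.w) {t ā : ℝ}
    (hā : ā ∈ Icc (0 : ℝ) 1) (hk : D01 P.k ā ≠ 0) (ht : P.loadOf ā ≤ t) :
    AntitoneOn (P.redEnergy t) (Icc 0 ā) := by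
  have h := hP.constitutive
  have h01 {b : ℝ} (hb : b ∈ interior (Icc 0 ā)) : b ∈ Ioo (0 : ℝ) 1 :=
    Ioo_subset_Ioo_right hā.2 (interior_Icc.subset hb)
  refine antitoneOn_of_hasDerivWithinAt_nonpos (convex_Icc 0 ā)
    ((continuousOn_redEnergy h t).mono (Icc_subset_Icc_right hā.2))
    (fun b hb => (hP.hasDerivAt_redEnergy t (h01 hb)).hasDerivWithinAt) fun b hb => ?_
  have hle : P.loadOf b ≤ P.loadOf ā :=
    hP.monotoneOn_loadOf hρ ⟨Ioo_subset_Icc_self (h01 hb), (h.k_deriv b (h01 hb)).ne⟩ ⟨hā, hk⟩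
      (interior_subset hb).2
  have := hP.L_pos
  have := hP.σc_pos
  exact mul_nonpos_of_nonneg_of_nonpos (by positivity) (by linarith)

lemma monotoneOn_redEnergy (hρ : P.L / P.cohesiveLength ≤ rhoC P.k P.w) {t ā : ℝ}
    (hā : ā ∈ Icc (0 : ℝ) 1) (hk : D01 P.k ā ≠ 0) (ht : t ≤ P.loadOf ā) :
    MonotoneOn (P.redEnergy t) (Icc ā 1) := by
  have h := hP.constitutive
  have h01 {b : ℝ} (hb : b ∈ interior (Icc ā 1)) : b ∈ Ioo (0 : ℝ) 1 :=
    Ioo_subset_Ioo_left hā.1 (interior_Icc.subset hb)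
  refine monotoneOn_of_hasDerivWithinAt_nonneg (convex_Icc ā 1)
    ((continuousOn_redEnergy h t).mono (Icc_subset_Icc_left hā.1))
    (fun b hb => (hP.hasDerivAt_redEnergy t (h01 hb)).hasDerivWithinAt) fun b hb => ?_
  have hle : P.loadOf ā ≤ P.loadOf b :=
    hP.monotoneOn_loadOf hρ ⟨hā, hk⟩ ⟨Ioo_subset_Icc_self (h01 hb), (h.k_deriv b (h01 hb)).ne⟩
      (interior_subset hb).1
  have := hP.L_pos
  have := hP.σc_pos
  exact mul_nonneg (by positivity) (by linarith)

lemma redEnergy_le (hρ : P.L / P.cohesiveLength ≤ rhoC P.k P.w) {t ā b : ℝ}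
    (hā : P.IsMaxDamage t ā) (hb : b ∈ Icc (0 : ℝ) 1) : P.redEnergy t ā ≤ P.redEnergy t b := by
  have h := hP.constitutive
  have hā01 := Ioc_subset_Icc_self hā.mem_Ioc
  have antitone (hk : D01 P.k ā ≠ 0) (ht : P.loadOf ā ≤ t) (hba : b ≤ ā) :
      P.redEnergy t ā ≤ P.redEnergy t b :=
    hP.antitoneOn_redEnergy hρ hā01 hk ht ⟨hb.1, hba⟩ (right_mem_Icc.2 hā01.1) hba
  rcases hā with ⟨hā, rfl⟩ | ⟨rfl, hk, ht⟩
  · have hk := (h.k_deriv ā hā).ne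
    rcases le_total b ā with hba | hab
    · exact antitone hk le_rfl hba
    · exact hP.monotoneOn_redEnergy hρ hā01 hk le_rfl (left_mem_Icc.2 hā01.2) ⟨hab, hb.2⟩ hab
  · exact antitone hk ((loadOf_one h).trans_le ht) hb.2

end WeakStanding

end Problem

/-! ### The optimal profile -/

/-- Half the width of the support of the optimal profile with maximal damage `ā`. -/
noncomputable def halfWidth (w : ℝ → ℝ) (ℓ ā : ℝ) : ℝ := ℓ * ∫ β in (0 : ℝ)..ā, 1 / √(w β)

/-- The absolute value of the slope of the optimal profile `a`. -/
noncomputable def profileSlope (w : ℝ → ℝ) (ℓ : ℝ) (a : ℝ → ℝ) (x : ℝ) : ℝ := √(w (a x)) / ℓ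

/-- The derivative of the optimal profile `a`, off the origin and the edges of its support. -/
noncomputable def profileDeriv (w : ℝ → ℝ) (ℓ : ℝ) (a : ℝ → ℝ) (x : ℝ) : ℝ :=
  if 0 < x then -profileSlope w ℓ a x else profileSlope w ℓ a x

/-- The second derivative of the optimal profile `a` with maximal damage `ā`, off the origin and the
edges of its support. -/
noncomputable def profileDeriv₂ (w : ℝ → ℝ) (ℓ ā : ℝ) (a : ℝ → ℝ) (x : ℝ) : ℝ :=
  if |x| < halfWidth w ℓ ā then D01 w (a x) / (2 * ℓ ^ 2) else 0

/-- `a` is the profile that minimizes `∫ (w(a) / ℓ + ℓ a'²)` among the profiles with maximum `ā` at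
the origin. Truncating `|x|` at the half-width covers both clauses of `Problem.IsProfile`. -/
structure IsOptimalProfile (w : ℝ → ℝ) (ℓ ā : ℝ) (a : ℝ → ℝ) : Prop where
  dissipation : IsDissipation w
  integrable : IntervalIntegrable (fun a => 1 / √(w a)) volume 0 1
  ℓ_pos : 0 < ℓ
  max_mem : ā ∈ Icc (0 : ℝ) 1
  mem_Icc : ∀ x, a x ∈ Icc 0 ā
  min_abs_eq : ∀ x, min |x| (halfWidth w ℓ ā) = ℓ * ∫ β in (a x)..ā, 1 / √(w β)

section HalfWidth

variable {w : ℝ → ℝ} {ℓ : ℝ}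

lemma intervalIntegrable_one_div_sqrt
    (hw : IntervalIntegrable (fun a => 1 / √(w a)) volume 0 1) {x y : ℝ}
    (hx : x ∈ Icc (0 : ℝ) 1) (hy : y ∈ Icc (0 : ℝ) 1) :
    IntervalIntegrable (fun a => 1 / √(w a)) volume x y := by
  refine hw.mono_set ?_
  rw [uIcc_of_le zero_le_one]
  exact uIcc_subset_Icc hx hy

lemma IsDissipation.sub_le_sqrt_mul_integral (h : IsDissipation w)
    (hw : IntervalIntegrable (fun a => 1 / √(w a)) volume 0 1) {x y : ℝ} (hx : 0 ≤ x)
    (hxy : x ≤ y) (hy : y ≤ 1) : y - x ≤ √(w 1) * ∫ β in x..y, 1 / √(w β) := by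
  have hint := intervalIntegrable_one_div_sqrt hw ⟨hx, hxy.trans hy⟩ ⟨hx.trans hxy, hy⟩
  calc y - x = ∫ _ in x..y, (1 : ℝ) := by simp
    _ ≤ ∫ β in x..y, √(w 1) * (1 / √(w β)) := by
      refine intervalIntegral.integral_mono_on_of_le_Ioo hxy (by simp) (hint.const_mul _)
        fun β hβ => ?_
      have hβ' : β ∈ Ioc (0 : ℝ) 1 := ⟨hx.trans_lt hβ.1, hβ.2.le.trans hy⟩
      rw [mul_one_div, one_le_div (h.sqrt_pos hβ')]
      exact Real.sqrt_le_sqrt (h.le_apply_one (Ioc_subset_Icc_self hβ'))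
    _ = √(w 1) * ∫ β in x..y, 1 / √(w β) := intervalIntegral.integral_const_mul _ _

lemma halfWidth_nonneg (hℓ : 0 ≤ ℓ) {ā : ℝ} (hā : 0 ≤ ā) : 0 ≤ halfWidth w ℓ ā :=
  mul_nonneg hℓ (intervalIntegral.integral_nonneg hā fun β _ => by positivity)

lemma halfWidth_mono (hw : IntervalIntegrable (fun a => 1 / √(w a)) volume 0 1) (hℓ : 0 ≤ ℓ) :
    MonotoneOn (halfWidth w ℓ) (Icc 0 1) := by
  intro x hx y hy hxy
  refine mul_le_mul_of_nonneg_left ?_ hℓ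
  have h0 := left_mem_Icc.2 (zero_le_one (α := ℝ))
  rw [← intervalIntegral.integral_add_adjacent_intervals
    (intervalIntegrable_one_div_sqrt hw h0 hx) (intervalIntegrable_one_div_sqrt hw hx hy),
    le_add_iff_nonneg_right]
  exact intervalIntegral.integral_nonneg hxy fun β _ => by positivity

/-- The intermediate value theorem for `y ↦ ℓ ∫ β in y..ā, 1 / √(w β)`. -/
lemma exists_isOptimalProfile (h : IsDissipation w)
    (hw : IntervalIntegrable (fun a => 1 / √(w a)) volume 0 1) (hℓ : 0 < ℓ) {ā : ℝ}
    (hā : ā ∈ Icc (0 : ℝ) 1) : ∃ a, IsOptimalProfile w ℓ ā a := by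
  have hcont : ContinuousOn (fun y => ℓ * ∫ β in y..ā, 1 / √(w β)) (Icc 0 ā) := by
    have hint := intervalIntegrable_one_div_sqrt hw (left_mem_Icc.2 zero_le_one) hā
    rw [intervalIntegrable_iff_integrableOn_Icc_of_le hā.1, ← uIcc_of_le hā.1] at hint
    have := intervalIntegral.continuousOn_primitive_interval_left hint
    rw [uIcc_of_le hā.1] at this
    exact continuousOn_const.mul this
  have hex (x : ℝ) : ∃ y ∈ Icc 0 ā, ℓ * ∫ β in y..ā, 1 / √(w β) = min |x| (halfWidth w ℓ ā) :=
    intermediate_value_Icc' hā.1 hcont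
      ⟨by simpa using halfWidth_nonneg hℓ.le hā.1, min_le_right _ _⟩
  choose a ha ha' using hex
  exact ⟨a, h, hw, hℓ, hā, ha, fun x => (ha' x).symm⟩

end HalfWidth

lemma eventually_lt_abs {x R : ℝ} (hx : R < |x|) : ∀ᶠ y in 𝓝 x, R < |y| :=
  (isOpen_lt continuous_const continuous_abs).mem_nhds hx

namespace IsOptimalProfile

variable {w : ℝ → ℝ} {ℓ ā : ℝ} {a : ℝ → ℝ} (ha : IsOptimalProfile w ℓ ā a)
include ha

lemma mem_unit (x : ℝ) : a x ∈ Icc (0 : ℝ) 1 := Icc_subset_Icc_right ha.max_mem.2 (ha.mem_Icc x)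

lemma le_of_integral_eq_zero {x y : ℝ} (hx : x ∈ Icc (0 : ℝ) 1) (hy : y ∈ Icc (0 : ℝ) 1)
    (h : ∫ β in x..y, 1 / √(w β) = 0) : y ≤ x := by
  by_contra! hxy
  have := ha.dissipation.sub_le_sqrt_mul_integral ha.integrable hx.1 hxy.le hy.2
  rw [h] at this
  linarith

lemma eq_zero {x : ℝ} (hx : halfWidth w ℓ ā ≤ |x|) : a x = 0 := by
  have h0 := left_mem_Icc.2 (zero_le_one (α := ℝ))
  have heq := ha.min_abs_eq x
  rw [min_eq_right hx, halfWidth, mul_right_inj' ha.ℓ_pos.ne',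
    ← intervalIntegral.integral_add_adjacent_intervals
      (intervalIntegrable_one_div_sqrt ha.integrable h0 (ha.mem_unit x))
      (intervalIntegrable_one_div_sqrt ha.integrable (ha.mem_unit x) ha.max_mem)] at heq
  exact le_antisymm (ha.le_of_integral_eq_zero h0 (ha.mem_unit x) (by linarith)) (ha.mem_Icc x).1

lemma apply_zero : a 0 = ā := by
  have heq := ha.min_abs_eq 0
  rw [abs_zero, min_eq_left (halfWidth_nonneg ha.ℓ_pos.le ha.max_mem.1), zero_eq_mul] at heq
  exact le_antisymm (ha.mem_Icc 0).2 (ha.le_of_integral_eq_zero (ha.mem_unit 0) ha.max_mem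
    (heq.resolve_left ha.ℓ_pos.ne'))

lemma abs_sub_le (x y : ℝ) :
    |a x - a y| ≤ √(w 1) / ℓ * |min |x| (halfWidth w ℓ ā) - min |y| (halfWidth w ℓ ā)| := by
  wlog hxy : a x ≤ a y generalizing x y
  · rw [abs_sub_comm, abs_sub_comm (min _ _)]
    exact this y x (le_of_not_ge hxy)
  have hdiff : min |x| (halfWidth w ℓ ā) - min |y| (halfWidth w ℓ ā) =
      ℓ * ∫ β in (a x)..(a y), 1 / √(w β) := by
    rw [ha.min_abs_eq x, ha.min_abs_eq y, ← mul_sub, sub_eq_iff_eq_add.2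
      (intervalIntegral.integral_add_adjacent_intervals
        (intervalIntegrable_one_div_sqrt ha.integrable (ha.mem_unit x) (ha.mem_unit y))
        (intervalIntegrable_one_div_sqrt ha.integrable (ha.mem_unit y) ha.max_mem)).symm]
  have hℓ := ha.ℓ_pos
  rw [hdiff, abs_sub_comm, abs_of_nonneg (sub_nonneg.2 hxy)]
  calc a y - a x ≤ √(w 1) * ∫ β in (a x)..(a y), 1 / √(w β) :=
        ha.dissipation.sub_le_sqrt_mul_integral ha.integrable (ha.mem_unit x).1 hxy
          (ha.mem_unit y).2
    _ = √(w 1) / ℓ * (ℓ * ∫ β in (a x)..(a y), 1 / √(w β)) := by field_simp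
    _ ≤ √(w 1) / ℓ * |ℓ * ∫ β in (a x)..(a y), 1 / √(w β)| :=
        mul_le_mul_of_nonneg_left (le_abs_self _) (by positivity)

lemma even (x : ℝ) : a (-x) = a x := by
  have := ha.abs_sub_le (-x) x
  rw [abs_neg, sub_self, abs_zero, mul_zero] at this
  exact sub_eq_zero.1 (abs_nonpos_iff.1 this)

lemma lipschitzWith : LipschitzWith (Real.toNNReal (√(w 1) / ℓ)) a := by
  have hℓ := ha.ℓ_pos
  refine LipschitzWith.of_dist_le' fun x y => (ha.abs_sub_le x y).trans ?_
  refine mul_le_mul_of_nonneg_left ?_ (by positivity)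
  exact (abs_min_sub_min_le_max _ _ _ _).trans (max_le (abs_abs_sub_abs_le x y) (by simp))

lemma continuous : Continuous a := ha.lipschitzWith.continuous

lemma mem_Ioo {x : ℝ} (hx0 : x ≠ 0) (hx : |x| < halfWidth w ℓ ā) : a x ∈ Ioo 0 ā := by
  have heq := ha.min_abs_eq x
  rw [min_eq_left hx.le] at heq
  refine ⟨(ha.mem_Icc x).1.lt_of_ne fun h => ?_, (ha.mem_Icc x).2.lt_of_ne fun h => ?_⟩
  · rw [← h] at heq
    exact hx.ne heq
  · rw [h, intervalIntegral.integral_same, mul_zero] at heq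
    exact hx0 (abs_eq_zero.1 heq)

lemma mem_Ioo_unit {x : ℝ} (hx0 : x ≠ 0) (hx : |x| < halfWidth w ℓ ā) : a x ∈ Ioo (0 : ℝ) 1 :=
  Ioo_subset_Ioo_right ha.max_mem.2 (ha.mem_Ioo hx0 hx)

lemma hasDerivAt_of_pos {x : ℝ} (hx0 : 0 < x) (hx : x < halfWidth w ℓ ā) :
    HasDerivAt a (-profileSlope w ℓ a x) x := by
  have hax := ha.mem_Ioo_unit hx0.ne' ((abs_of_pos hx0).trans_lt hx)
  have hsqrt := ha.dissipation.sqrt_pos (Ioo_subset_Ioc_self hax)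
  have hℓ := ha.ℓ_pos
  have hcont : ContinuousOn (fun β => 1 / √(w β)) (Ioo 0 1) :=
    continuousOn_const.div (ha.dissipation.continuousOn_sqrt.mono Ioo_subset_Icc_self)
      fun β hβ => (ha.dissipation.sqrt_pos (Ioo_subset_Ioc_self hβ)).ne'
  have hinv : HasDerivAt (fun y => ℓ * ∫ β in y..ā, 1 / √(w β)) (ℓ * -(1 / √(w (a x)))) (a x) :=
    (intervalIntegral.integral_hasDerivAt_left
      (intervalIntegrable_one_div_sqrt ha.integrable (ha.mem_unit x) ha.max_mem)
      (hcont.stronglyMeasurableAtFilter isOpen_Ioo _ hax)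
      (hcont.continuousAt (isOpen_Ioo.mem_nhds hax))).const_mul _
  refine (HasDerivAt.of_local_left_inverse ha.continuous.continuousAt hinv
    (by simp only [mul_neg, neg_ne_zero]; positivity) ?_).congr_deriv ?_
  · filter_upwards [Ioo_mem_nhds hx0 hx] with y hy
    rw [← ha.min_abs_eq y, abs_of_pos hy.1, min_eq_left hy.2.le]
  · rw [profileSlope]
    field_simp

lemma profileSlope_neg (x : ℝ) : profileSlope w ℓ a (-x) = profileSlope w ℓ a x := by
  rw [profileSlope, profileSlope, ha.even]

lemma profileSlope_nonneg (x : ℝ) : 0 ≤ profileSlope w ℓ a x :=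
  div_nonneg (Real.sqrt_nonneg _) ha.ℓ_pos.le

lemma profileSlope_eq_zero {x : ℝ} (hx : halfWidth w ℓ ā ≤ |x|) : profileSlope w ℓ a x = 0 := by
  rw [profileSlope, ha.eq_zero hx, ha.dissipation.zero, Real.sqrt_zero, zero_div]

lemma profileDeriv_eq_zero {x : ℝ} (hx : halfWidth w ℓ ā ≤ |x|) : profileDeriv w ℓ a x = 0 := by
  simp [profileDeriv, ha.profileSlope_eq_zero hx]

lemma continuous_profileSlope : Continuous (profileSlope w ℓ a) :=
  (ha.dissipation.continuousOn_sqrt.comp_continuous ha.continuous ha.mem_unit).div_const _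

lemma hasDerivAt {x : ℝ} (hx0 : x ≠ 0) (hx : |x| ≠ halfWidth w ℓ ā) :
    HasDerivAt a (profileDeriv w ℓ a x) x := by
  rcases hx.lt_or_gt with hx | hx
  · rcases hx0.lt_or_gt with hneg | hpos
    · rw [abs_of_neg hneg] at hx
      have hcomp := (ha.hasDerivAt_of_pos (neg_pos.2 hneg) hx).scomp x (hasDerivAt_neg x)
      simpa only [Function.comp_def, ha.even, profileDeriv, if_neg hneg.not_gt,
        ha.profileSlope_neg, smul_eq_mul, neg_mul_neg, one_mul] using hcomp
    · rw [abs_of_pos hpos] at hx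
      rw [profileDeriv, if_pos hpos]
      exact ha.hasDerivAt_of_pos hpos hx
  · rw [ha.profileDeriv_eq_zero hx.le]
    refine (hasDerivAt_const x (0 : ℝ)).congr_of_eventuallyEq ?_
    filter_upwards [eventually_lt_abs hx] with y hy using ha.eq_zero hy.le

lemma hasDerivAt_profileDeriv {x : ℝ} (hx0 : x ≠ 0) (hx : |x| ≠ halfWidth w ℓ ā) :
    HasDerivAt (profileDeriv w ℓ a) (profileDeriv₂ w ℓ ā a x) x := by
  rcases hx.lt_or_gt with hx' | hx'
  · have hax := ha.mem_Ioo_unit hx0 hx'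
    have hsqrt := ha.dissipation.sqrt_pos (Ioo_subset_Ioc_self hax)
    have hℓ := ha.ℓ_pos
    have hslope : HasDerivAt (profileSlope w ℓ a)
        (D01 w (a x) / (2 * √(w (a x))) * profileDeriv w ℓ a x / ℓ) x :=
      ((ha.dissipation.hasDerivAt_sqrt hax).comp x (ha.hasDerivAt hx0 hx)).div_const _
    rw [profileDeriv₂, if_pos hx']
    rcases hx0.lt_or_gt with hneg | hpos
    · refine (hslope.congr_of_eventuallyEq ?_).congr_deriv ?_
      · filter_upwards [Iio_mem_nhds hneg] with y hy
        rw [profileDeriv, if_neg (not_lt.2 (mem_Iio.1 hy).le)]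
      · rw [profileDeriv, if_neg hneg.not_gt, profileSlope]
        field_simp
    · refine (hslope.neg.congr_of_eventuallyEq ?_).congr_deriv ?_
      · filter_upwards [Ioi_mem_nhds hpos] with y hy
        rw [profileDeriv, if_pos (mem_Ioi.1 hy), Pi.neg_apply]
      · rw [profileDeriv, if_pos hpos, profileSlope]
        field_simp
  · rw [profileDeriv₂, if_neg hx'.not_gt]
    refine (hasDerivAt_const x (0 : ℝ)).congr_of_eventuallyEq ?_
    filter_upwards [eventually_lt_abs hx'] with y hy using ha.profileDeriv_eq_zero hy.le

lemma measurable_profileDeriv : Measurable (profileDeriv w ℓ a) :=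
  have hm := ha.continuous_profileSlope.measurable
  Measurable.ite measurableSet_Ioi hm.neg hm

lemma abs_profileDeriv_le (x : ℝ) : |profileDeriv w ℓ a x| ≤ √(w 1) / ℓ := by
  have habs : |profileDeriv w ℓ a x| = profileSlope w ℓ a x := by
    rw [profileDeriv, apply_ite abs, abs_neg, ite_self, abs_of_nonneg (ha.profileSlope_nonneg x)]
  rw [habs]
  exact div_le_div_of_nonneg_right
    (Real.sqrt_le_sqrt (ha.dissipation.le_apply_one (ha.mem_unit x))) ha.ℓ_pos.le

lemma mul_profileDeriv_sq (x : ℝ) : ℓ * profileDeriv w ℓ a x ^ 2 = w (a x) / ℓ := by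
  have hsq : profileDeriv w ℓ a x ^ 2 = profileSlope w ℓ a x ^ 2 := by
    rw [profileDeriv]
    split_ifs <;> ring
  have hℓ := ha.ℓ_pos
  rw [hsq, profileSlope, div_pow, Real.sq_sqrt (ha.dissipation.nonneg (ha.mem_unit x))]
  field_simp

lemma measurable_profileDeriv₂ : Measurable (profileDeriv₂ w ℓ ā a) := by
  have hcont : Continuous fun x => D01 w (a x) :=
    (contDiffOn_D01 ha.dissipation.smooth).continuousOn.comp_continuous ha.continuous ha.mem_unit
  exact Measurable.ite (measurableSet_lt continuous_abs.measurable measurable_const)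
    (hcont.measurable.div_const _) measurable_const

lemma abs_profileDeriv₂_le (x : ℝ) : |profileDeriv₂ w ℓ ā a x| ≤ D01 w 1 / (2 * ℓ ^ 2) := by
  have hℓ := ha.ℓ_pos
  have hnonneg := ha.dissipation.D01_nonneg
  rw [profileDeriv₂]
  split_ifs
  · rw [abs_of_nonneg (div_nonneg (hnonneg _) (by positivity))]
    gcongr
    exact ha.dissipation.monotoneOn_D01 (ha.mem_unit x) (right_mem_Icc.2 zero_le_one)
      (ha.mem_unit x).2
  · rw [abs_zero]
    exact div_nonneg (hnonneg 1) (by positivity)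

end IsOptimalProfile

lemma intervalIntegrable_of_abs_le {f : ℝ → ℝ} (hf : Measurable f) {C : ℝ} (hC : ∀ x, |f x| ≤ C)
    (x y : ℝ) : IntervalIntegrable f volume x y :=
  intervalIntegrable_const.mono_fun' hf.aestronglyMeasurable (ae_of_all _ hC)

lemma countable_setOf_eq_zero_or_abs_eq (R : ℝ) : ({x | x = 0 ∨ |x| = R} : Set ℝ).Countable := by
  refine ((Set.toFinite {0, R, -R}).countable).mono ?_
  rintro x (rfl | hx)
  · simp
  · rcases eq_or_eq_neg_of_abs_eq hx with rfl | rfl <;> simp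

namespace IsOptimalProfile

variable {w : ℝ → ℝ} {ℓ ā : ℝ} {a : ℝ → ℝ} (ha : IsOptimalProfile w ℓ ā a)
include ha

lemma intervalIntegrable_by_parts {B B' : ℝ → ℝ} (hB : Continuous B)
    (hB' : ∀ x y, IntervalIntegrable B' volume x y) (x y : ℝ) :
    IntervalIntegrable (fun x => profileDeriv₂ w ℓ ā a x * B x + profileDeriv w ℓ a x * B' x)
      volume x y := by
  refine ((intervalIntegrable_of_abs_le ha.measurable_profileDeriv₂ ha.abs_profileDeriv₂_le x
    y).mul_continuousOn hB.continuousOn).add (intervalIntegrable_iff.2 ?_)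
  exact (intervalIntegrable_iff.1 (hB' x y)).bdd_mul
    ha.measurable_profileDeriv.aestronglyMeasurable (ae_of_all _ ha.abs_profileDeriv_le)

lemma hasDerivAt_profileDeriv_mul {B : ℝ → ℝ} {B' x : ℝ}
    (hx : x ∉ {x | x = 0 ∨ |x| = halfWidth w ℓ ā}) (hB : HasDerivAt B B' x) :
    HasDerivAt (fun x => profileDeriv w ℓ a x * B x)
      (profileDeriv₂ w ℓ ā a x * B x + profileDeriv w ℓ a x * B') x :=
  have hx' := not_or.1 hx
  (ha.hasDerivAt_profileDeriv hx'.1 hx'.2).mul hB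

lemma integral_by_parts_right {M : ℝ} (hM : 0 ≤ M) {B B' : ℝ → ℝ} (hB : Continuous B)
    {S : Set ℝ} (hS : S.Countable) (hBB' : ∀ x ∉ S, HasDerivAt B (B' x) x)
    (hB' : ∀ x y, IntervalIntegrable B' volume x y) :
    ∫ x in 0..M, (profileDeriv₂ w ℓ ā a x * B x + profileDeriv w ℓ a x * B' x) =
      profileSlope w ℓ a 0 * B 0 - profileSlope w ℓ a M * B M := by
  have hderiv : ∀ x ∈ Ioo 0 M \ (S ∪ {x | x = 0 ∨ |x| = halfWidth w ℓ ā}),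
      HasDerivAt (fun x => -profileSlope w ℓ a x * B x)
        (profileDeriv₂ w ℓ ā a x * B x + profileDeriv w ℓ a x * B' x) x := by
    intro x hx
    have hxS := not_or.1 hx.2
    refine (ha.hasDerivAt_profileDeriv_mul hxS.2 (hBB' x hxS.1)).congr_of_eventuallyEq ?_
    filter_upwards [Ioi_mem_nhds hx.1.1] with y hy
    rw [profileDeriv, if_pos (mem_Ioi.1 hy)]
  rw [integral_eq_of_hasDerivAt_off_countable_of_le _ _ hM
    (hS.union (countable_setOf_eq_zero_or_abs_eq _))
    (ha.continuous_profileSlope.neg.mul hB).continuousOn hderiv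
    (ha.intervalIntegrable_by_parts hB hB' 0 M)]
  simp only [Pi.mul_apply, Pi.neg_apply]
  ring

lemma integral_by_parts_left {M : ℝ} (hM : 0 ≤ M) {B B' : ℝ → ℝ} (hB : Continuous B)
    {S : Set ℝ} (hS : S.Countable) (hBB' : ∀ x ∉ S, HasDerivAt B (B' x) x)
    (hB' : ∀ x y, IntervalIntegrable B' volume x y) :
    ∫ x in (-M)..0, (profileDeriv₂ w ℓ ā a x * B x + profileDeriv w ℓ a x * B' x) =
      profileSlope w ℓ a 0 * B 0 - profileSlope w ℓ a M * B (-M) := by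
  have hderiv : ∀ x ∈ Ioo (-M) 0 \ (S ∪ {x | x = 0 ∨ |x| = halfWidth w ℓ ā}),
      HasDerivAt (fun x => profileSlope w ℓ a x * B x)
        (profileDeriv₂ w ℓ ā a x * B x + profileDeriv w ℓ a x * B' x) x := by
    intro x hx
    have hxS := not_or.1 hx.2
    refine (ha.hasDerivAt_profileDeriv_mul hxS.2 (hBB' x hxS.1)).congr_of_eventuallyEq ?_
    filter_upwards [Iio_mem_nhds hx.1.2] with y hy
    rw [profileDeriv, if_neg (not_lt.2 (mem_Iio.1 hy).le)]
  rw [integral_eq_of_hasDerivAt_off_countable_of_le _ _ (neg_nonpos.2 hM)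
    (hS.union (countable_setOf_eq_zero_or_abs_eq _))
    (ha.continuous_profileSlope.mul hB).continuousOn hderiv
    (ha.intervalIntegrable_by_parts hB hB' (-M) 0)]
  simp only [Pi.mul_apply, ha.profileSlope_neg]

lemma integral_by_parts {M : ℝ} (hM : 0 ≤ M) {B B' : ℝ → ℝ} (hB : Continuous B)
    {S : Set ℝ} (hS : S.Countable) (hBB' : ∀ x ∉ S, HasDerivAt B (B' x) x)
    (hB' : ∀ x y, IntervalIntegrable B' volume x y) :
    ∫ x in (-M)..M, (profileDeriv₂ w ℓ ā a x * B x + profileDeriv w ℓ a x * B' x) =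
      2 * profileSlope w ℓ a 0 * B 0 - profileSlope w ℓ a M * (B M + B (-M)) := by
  have hint := ha.intervalIntegrable_by_parts hB hB'
  rw [← intervalIntegral.integral_add_adjacent_intervals (hint (-M) 0) (hint 0 M),
    ha.integral_by_parts_left hM hB hS hBB' hB', ha.integral_by_parts_right hM hB hS hBB' hB']
  ring

lemma integral_by_parts_self {M : ℝ} (hM : halfWidth w ℓ ā ≤ M) :
    ∫ x in (-M)..M,
        (profileDeriv₂ w ℓ ā a x * a x + profileDeriv w ℓ a x * profileDeriv w ℓ a x) =
      2 * profileSlope w ℓ a 0 * ā := by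
  have hM0 := (halfWidth_nonneg ha.ℓ_pos.le ha.max_mem.1).trans hM
  rw [ha.integral_by_parts hM0 ha.continuous (countable_setOf_eq_zero_or_abs_eq _)
    (fun x hx => ha.hasDerivAt (not_or.1 hx).1 (not_or.1 hx).2)
    (intervalIntegrable_of_abs_le ha.measurable_profileDeriv ha.abs_profileDeriv_le),
    ha.profileSlope_eq_zero (hM.trans (le_abs_self M)), ha.apply_zero, zero_mul, sub_zero]

lemma continuous_w_comp : Continuous fun x => w (a x) :=
  ha.dissipation.continuousOn.comp_continuous ha.continuous ha.mem_unit

lemma hasDerivAt_integral_sqrt_comp {x : ℝ} (hx0 : 0 < x) (hx : x ≠ halfWidth w ℓ ā) :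
    HasDerivAt (fun x => ∫ β in (0 : ℝ)..(a x), √(w β)) (-(w (a x) / ℓ)) x := by
  have habs := abs_of_pos hx0
  have hne : |x| ≠ halfWidth w ℓ ā := by rwa [habs]
  rcases hne.lt_or_gt with hlt | hgt
  · have hax := ha.mem_Ioo_unit hx0.ne' hlt
    refine ((ha.dissipation.hasDerivAt_integral_sqrt hax).comp x
      (ha.hasDerivAt_of_pos hx0 (habs ▸ hlt))).congr_deriv ?_
    rw [profileSlope, mul_neg, ← mul_div_assoc,
      Real.mul_self_sqrt (ha.dissipation.nonneg (ha.mem_unit x))]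
  · rw [ha.eq_zero hgt.le, ha.dissipation.zero, zero_div, neg_zero]
    refine (hasDerivAt_const x (0 : ℝ)).congr_of_eventuallyEq ?_
    filter_upwards [eventually_lt_abs hgt] with y hy
    rw [ha.eq_zero hy.le, intervalIntegral.integral_same]

lemma integral_w_comp {M : ℝ} (hM : halfWidth w ℓ ā ≤ M) :
    ∫ x in (-M)..M, w (a x) / ℓ = 2 * ∫ β in (0 : ℝ)..ā, √(w β) := by
  have hcont : Continuous fun x => w (a x) / ℓ := ha.continuous_w_comp.div_const ℓ
  have hright : ∫ x in (0 : ℝ)..M, -(w (a x) / ℓ) =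
      (∫ β in (0 : ℝ)..(a M), √(w β)) - ∫ β in (0 : ℝ)..(a 0), √(w β) :=
    integral_eq_of_hasDerivAt_off_countable_of_le (fun x => ∫ β in (0 : ℝ)..(a x), √(w β)) _
      ((halfWidth_nonneg ha.ℓ_pos.le ha.max_mem.1).trans hM)
      (countable_singleton (halfWidth w ℓ ā))
      (ha.dissipation.continuousOn_integral_sqrt.comp_continuous ha.continuous
        ha.mem_unit).continuousOn
      (fun x hx => ha.hasDerivAt_integral_sqrt_comp hx.1.1 hx.2)
      (hcont.neg.intervalIntegrable _ _)
  have hleft : ∫ x in (-M)..0, w (a x) / ℓ = ∫ x in (0 : ℝ)..M, w (a x) / ℓ := by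
    have := intervalIntegral.integral_comp_neg (a := 0) (b := M) fun x => w (a x) / ℓ
    simpa only [ha.even, neg_zero] using this.symm
  rw [intervalIntegral.integral_neg, ha.apply_zero, ha.eq_zero (hM.trans (le_abs_self M)),
    intervalIntegral.integral_same] at hright
  rw [← intervalIntegral.integral_add_adjacent_intervals (hcont.intervalIntegrable (-M) 0)
    (hcont.intervalIntegrable 0 M), hleft]
  linarith

lemma tangent_w_le (x : ℝ) {β : ℝ} (hβ : β ∈ Icc (0 : ℝ) 1) :
    w (a x) / ℓ + 2 * ℓ * profileDeriv₂ w ℓ ā a x * (β - a x) ≤ w β / ℓ := by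
  have hℓ := ha.ℓ_pos
  rw [profileDeriv₂]
  split_ifs with hx
  · calc w (a x) / ℓ + 2 * ℓ * (D01 w (a x) / (2 * ℓ ^ 2)) * (β - a x)
        = (w (a x) + D01 w (a x) * (β - a x)) / ℓ := by field_simp
      _ ≤ w β / ℓ := div_le_div_of_nonneg_right (ha.dissipation.tangent_le (ha.mem_unit x) hβ) hℓ.le
  · rw [ha.eq_zero (not_lt.1 hx), ha.dissipation.zero, zero_div, mul_zero, zero_mul, add_zero]
    exact div_nonneg (ha.dissipation.nonneg hβ) hℓ.le

/-- The left-hand side is the linearization of the energy density at the profile, whose constant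
part comes from equipartition, `ℓ a'² = w(a) / ℓ`. -/
lemma linearization_le (x : ℝ) {β γ : ℝ} (hβ : β ∈ Icc (0 : ℝ) 1) :
    2 * (w (a x) / ℓ) + 2 * ℓ * (profileDeriv₂ w ℓ ā a x * β + profileDeriv w ℓ a x * γ) -
        2 * ℓ * (profileDeriv₂ w ℓ ā a x * a x + profileDeriv w ℓ a x * profileDeriv w ℓ a x) ≤
      w β / ℓ + ℓ * γ ^ 2 := by
  have hquad : 0 ≤ ℓ * (γ - profileDeriv w ℓ a x) ^ 2 := mul_nonneg ha.ℓ_pos.le (sq_nonneg _)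
  linarith [ha.tangent_w_le x hβ, ha.mul_profileDeriv_sq x]

end IsOptimalProfile

section Problem

variable {P : Problem}

lemma Problem.IsProfile.isOptimalProfile {ā : ℝ} {a : ℝ → ℝ} (ha : P.IsProfile ā a)
    (h : IsDissipation P.w) (hw : IntervalIntegrable (fun a => 1 / √(P.w a)) volume 0 1)
    (hℓ : 0 < P.ℓ) (hā : ā ∈ Icc (0 : ℝ) 1) : IsOptimalProfile P.w P.ℓ ā a := by
  refine ⟨h, hw, hℓ, hā, fun x => ?_, fun x => ?_⟩ <;>
    rcases le_total |x| (halfWidth P.w P.ℓ ā) with hx | hx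
  · exact ((ha x).1 hx).1
  · rw [(ha x).2 hx]
    exact left_mem_Icc.2 hā.1
  · rw [min_eq_left hx, ← ((ha x).1 hx).2]
  · rw [min_eq_right hx, (ha x).2 hx, halfWidth]

lemma IsOptimalProfile.isProfile {ā : ℝ} {a : ℝ → ℝ} (ha : IsOptimalProfile P.w P.ℓ ā a) :
    P.IsProfile ā a :=
  fun x => ⟨fun hx => ⟨ha.mem_Icc x, by rw [← ha.min_abs_eq x, halfWidth, min_eq_left hx]⟩,
    ha.eq_zero⟩

lemma Problem.WeakStanding.halfWidth_le (hP : P.WeakStanding)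
    (hw : IntervalIntegrable (fun a => 1 / √(P.w a)) volume 0 1)
    (hL : 2 * P.ℓ * cStar P.w ≤ P.L) {ā : ℝ} (hā : ā ∈ Icc (0 : ℝ) 1) :
    halfWidth P.w P.ℓ ā ≤ P.L / 2 := by
  have hmono := halfWidth_mono hw hP.ℓ_pos.le hā (right_mem_Icc.2 zero_le_one) hā.2
  have hone : halfWidth P.w P.ℓ 1 = P.ℓ * cStar P.w := rfl
  linarith

end Problem

/-! ### Coordinates in the cube -/

section Hyperplane

variable {E : Type*} [NormedAddCommGroup E] [InnerProductSpace ℝ E] [FiniteDimensional ℝ E]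
  [MeasurableSpace E] [BorelSpace E]

lemma ae_inner_ne (μ : Measure E) [μ.IsAddHaarMeasure] {v : E} (hv : v ≠ 0) (c : ℝ) :
    ∀ᵐ x ∂μ, inner ℝ v x ≠ c := by
  have hker : (innerSL ℝ v).ker ≠ ⊤ := fun h => hv <| by
    have hmem : v ∈ (innerSL ℝ v).ker := h ▸ Submodule.mem_top
    simpa using hmem
  have hnull := Measure.addHaar_submodule μ _ hker
  rcases eq_empty_or_nonempty {x | inner ℝ v x = c} with h | ⟨p, hp⟩
  · exact ae_of_all _ fun x hx => h.subset hx
  · rw [← measure_preimage_add μ (-p)] at hnull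
    refine measure_mono_null (fun x hx => ?_) hnull
    have hx' : inner ℝ v x = c := not_not.1 hx
    have hp' : inner ℝ v p = c := hp
    simp [inner_add_right, hx', hp']

end Hyperplane

section Coordinates

variable (b : OrthonormalBasis (Fin 3) ℝ V3) (L : ℝ)

/-- The coordinates along the frame `b`; the normal coordinate is the last one. -/
noncomputable def frame : (ℝ × ℝ) × ℝ ≃ᵐ V3 :=
  MeasurableEquiv.prodComm.trans
    (((MeasurableEquiv.refl ℝ).prodCongr MeasurableEquiv.finTwoArrow.symm).trans
      ((MeasurableEquiv.piFinSuccAbove (fun _ : Fin 3 => ℝ) 0).symm.trans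
        ((MeasurableEquiv.toLp 2 (Fin 3 → ℝ)).trans b.measurableEquiv.symm)))

lemma frame_apply (y : (ℝ × ℝ) × ℝ) :
    frame b y = y.1.1 • b 1 + y.1.2 • b 2 + y.2 • b 0 := by
  have h : frame b y = b.repr.symm (WithLp.toLp 2 ![y.2, y.1.1, y.1.2]) := by
    change b.repr.symm _ = _
    congr 1
    ext i
    fin_cases i <;> rfl
  rw [h, ← b.sum_repr_symm, Fin.sum_univ_three]
  simp only [Matrix.cons_val_zero, Matrix.cons_val_one, Matrix.cons_val]
  abel

lemma measurePreserving_frame : MeasurePreserving (frame b) volume volume := by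
  have hswap : MeasurePreserving (MeasurableEquiv.prodComm : (ℝ × ℝ) × ℝ ≃ᵐ ℝ × (ℝ × ℝ))
      volume volume := Measure.measurePreserving_swap
  have hprod : MeasurePreserving
      ((MeasurableEquiv.refl ℝ).prodCongr (MeasurableEquiv.finTwoArrow (α := ℝ)).symm)
      volume volume := (MeasurePreserving.id volume).prod (volume_preserving_finTwoArrow ℝ).symm
  have htoLp : MeasurePreserving (MeasurableEquiv.toLp 2 (Fin 3 → ℝ)) volume volume :=
    PiLp.volume_preserving_toLp (Fin 3)
  exact hswap.trans (hprod.trans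
    ((volume_preserving_piFinSuccAbove (fun _ : Fin 3 => ℝ) 0).symm.trans
      (htoLp.trans b.measurePreserving_measurableEquiv.symm)))

lemma inner_frame_zero (y : (ℝ × ℝ) × ℝ) : inner ℝ (b 0) (frame b y) = y.2 := by
  simp [frame_apply, inner_add_right, inner_smul_right, b.inner_eq_ite]

lemma inner_frame_one (y : (ℝ × ℝ) × ℝ) : inner ℝ (b 1) (frame b y) = y.1.1 := by
  simp [frame_apply, inner_add_right, inner_smul_right, b.inner_eq_ite]

lemma inner_frame_two (y : (ℝ × ℝ) × ℝ) : inner ℝ (b 2) (frame b y) = y.1.2 := by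
  simp [frame_apply, inner_add_right, inner_smul_right, b.inner_eq_ite]

/-- The open interval of length `L` centred at the origin. -/
abbrev side (L : ℝ) : Set ℝ := Ioo (-(L / 2)) (L / 2)

lemma frame_mem_cube {y : (ℝ × ℝ) × ℝ} :
    frame b y ∈ cube b L ↔ y ∈ (side L ×ˢ side L) ×ˢ side L := by
  simp only [cube, mem_ofPred_eq, Fin.forall_fin_succ, Fin.succ_zero_eq_one, Fin.succ_one_eq_two,
    inner_frame_zero, inner_frame_one, inner_frame_two, mem_prod, abs_lt, mem_Ioo,
    IsEmpty.forall_iff, and_true]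
  tauto

lemma frame_preimage_cube : frame b ⁻¹' cube b L = (side L ×ˢ side L) ×ˢ side L := by
  ext y
  exact frame_mem_cube b L

lemma isOpen_cube : IsOpen (cube b L) := by
  have : cube b L = ⋂ i, {x | |inner ℝ (b i) x| < L / 2} := by ext; simp [cube]
  rw [this]
  exact isOpen_iInter_of_finite fun i => isOpen_lt (by fun_prop) continuous_const

lemma measurableSet_cube : MeasurableSet (cube b L) := (isOpen_cube b L).measurableSet

lemma volume_side : volume (side L) = ENNReal.ofReal L := by
  rw [Real.volume_Ioo, sub_neg_eq_add, add_halves]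

lemma volume_square : volume (side L ×ˢ side L) = ENNReal.ofReal L ^ 2 := by
  rw [Measure.volume_eq_prod, Measure.prod_prod, volume_side, sq]

lemma volume_cube : volume (cube b L) = ENNReal.ofReal L ^ 3 := by
  rw [← (measurePreserving_frame b).measure_preimage (measurableSet_cube b L).nullMeasurableSet,
    frame_preimage_cube, Measure.volume_eq_prod, Measure.prod_prod, volume_square, volume_side]
  ring

instance isFiniteMeasure_restrict_cube : IsFiniteMeasure (volume.restrict (cube b L)) :=
  isFiniteMeasure_restrict.2 (by simp [volume_cube])

lemma volume_real_cube (hL : 0 ≤ L) : volume.real (cube b L) = L ^ 3 := by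
  rw [measureReal_def, volume_cube, ENNReal.toReal_pow, ENNReal.toReal_ofReal hL]

lemma setIntegral_cube (f : V3 → ℝ) :
    ∫ x in cube b L, f x = ∫ y in (side L ×ˢ side L) ×ˢ side L, f (frame b y) := by
  rw [← frame_preimage_cube b L]
  exact ((measurePreserving_frame b).setIntegral_preimage_emb
    (frame b).measurableEmbedding f _).symm

lemma integrableOn_cube_iff (f : V3 → ℝ) :
    IntegrableOn f (cube b L) ↔
      IntegrableOn (fun y => f (frame b y)) ((side L ×ˢ side L) ×ˢ side L) := by
  rw [← frame_preimage_cube b L]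
  exact ((measurePreserving_frame b).integrableOn_comp_preimage
    (frame b).measurableEmbedding).symm

lemma setIntegral_cube_eq_iterated {f : V3 → ℝ} (hf : IntegrableOn f (cube b L)) :
    ∫ x in cube b L, f x =
      ∫ y in side L ×ˢ side L, ∫ r in side L, f (frame b (y, r)) := by
  rw [setIntegral_cube, Measure.volume_eq_prod, setIntegral_prod]
  rwa [← Measure.volume_eq_prod, ← integrableOn_cube_iff]

lemma setIntegral_square_const (hL : 0 ≤ L) (c : ℝ) :
    ∫ _ in side L ×ˢ side L, c = L ^ 2 * c := by
  rw [setIntegral_const, measureReal_def, volume_square, smul_eq_mul, ENNReal.toReal_pow,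
    ENNReal.toReal_ofReal hL]

lemma setIntegral_side (hL : 0 ≤ L) (f : ℝ → ℝ) :
    ∫ r in side L, f r = ∫ r in (-(L / 2))..(L / 2), f r := by
  rw [intervalIntegral.integral_of_le (by linarith), integral_Ioc_eq_integral_Ioo]

lemma setIntegral_cube_normal (hL : 0 ≤ L) (f : ℝ → ℝ) :
    ∫ x in cube b L, f (inner ℝ (b 0) x) = L ^ 2 * ∫ r in (-(L / 2))..(L / 2), f r := by
  rw [setIntegral_cube]
  simp only [inner_frame_zero]
  have := setIntegral_prod_mul (μ := (volume : Measure (ℝ × ℝ))) (ν := (volume : Measure ℝ))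
    (fun _ => (1 : ℝ)) f (side L ×ˢ side L) (side L)
  simp only [one_mul] at this
  rw [Measure.volume_eq_prod, this, setIntegral_square_const L hL, mul_one, setIntegral_side L hL]

lemma midPlaneArea_eq_map : midPlaneArea b L =
    Measure.map (fun y => frame b (y, 0)) (volume.restrict (side L ×ˢ side L)) := by
  have h : (fun y : ℝ × ℝ => frame b (y, 0)) = fun y => y.1 • b 1 + y.2 • b 2 := by
    funext y
    simp [frame_apply]
  rw [h]
  rfl

lemma measurableEmbedding_frame_plane (r : ℝ) :
    MeasurableEmbedding fun y : ℝ × ℝ => frame b (y, r) :=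
  (frame b).measurableEmbedding.comp (measurableEmbedding_prod_mk_right r)

lemma integral_midPlaneArea (f : V3 → ℝ) :
    ∫ x, f x ∂midPlaneArea b L = ∫ y in side L ×ˢ side L, f (frame b (y, 0)) := by
  rw [midPlaneArea_eq_map]
  exact (measurableEmbedding_frame_plane b 0).integral_map f

lemma midPlaneArea_univ : midPlaneArea b L univ = ENNReal.ofReal L ^ 2 := by
  rw [midPlaneArea_eq_map,
    Measure.map_apply (measurableEmbedding_frame_plane b 0).measurable MeasurableSet.univ,
    preimage_univ, Measure.restrict_apply_univ, volume_square]

instance isFiniteMeasure_midPlaneArea : IsFiniteMeasure (midPlaneArea b L) :=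
  ⟨by simp [midPlaneArea_univ]⟩

lemma ae_midPlaneArea (hL : 0 < L) :
    ∀ᵐ x ∂midPlaneArea b L, x ∈ cube b L ∧ inner ℝ (b 0) x = 0 := by
  rw [midPlaneArea_eq_map, (measurableEmbedding_frame_plane b 0).ae_map_iff]
  refine (ae_restrict_mem (measurableSet_Ioo.prod measurableSet_Ioo)).mono fun y hy =>
    ⟨(frame_mem_cube b L).2 ⟨hy, ?_⟩, inner_frame_zero b _⟩
  simpa using hL

lemma midPlaneArea_restrict_cube (hL : 0 < L) :
    (midPlaneArea b L).restrict (cube b L) = midPlaneArea b L :=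
  Measure.restrict_eq_self_of_ae_mem ((ae_midPlaneArea b L hL).mono fun _ h => h.1)

end Coordinates

section LineIntegrals

variable {E : Type*} [NormedAddCommGroup E] [NormedSpace ℝ E] {φ : E → ℝ}

lemma integral_Ioi_fderiv_line (hφ : ContDiff ℝ 1 φ) (hc : HasCompactSupport φ) (x : E) {v : E}
    (hv : v ≠ 0) : ∫ r in Ioi (0 : ℝ), fderiv ℝ φ (x + r • v) v = -φ x := by
  have hline : ∀ r : ℝ, HasDerivAt (fun r : ℝ => x + r • v) v r := fun r => by
    simpa using ((hasDerivAt_id r).smul_const v).const_add x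
  have hderiv : ∀ r, deriv (fun r : ℝ => φ (x + r • v)) r = fderiv ℝ φ (x + r • v) v := fun r =>
    ((hφ.differentiable one_ne_zero _).hasFDerivAt.comp_hasDerivAt r (hline r)).deriv
  have hemb : IsClosedEmbedding fun r : ℝ => x + r • v :=
    (Homeomorph.addLeft x).isClosedEmbedding.comp (isClosedEmbedding_smul_left hv)
  have h := (hc.comp_isClosedEmbedding hemb).integral_Ioi_deriv_eq
    (f := fun r : ℝ => φ (x + r • v)) (hφ.comp (by fun_prop)) 0
  simpa only [hderiv, zero_smul, add_zero] using h

variable [FiniteDimensional ℝ E] [MeasurableSpace E] [BorelSpace E] {μ : Measure E}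
  [μ.IsAddHaarMeasure]

lemma setIntegral_fderiv_eq_zero_of_translation_invariant (hφ : Differentiable ℝ φ)
    (hi : Integrable φ μ) {v : E} (hi' : Integrable (fun x => fderiv ℝ φ x v) μ) {S : Set E}
    (hS : MeasurableSet S) (hv : ∀ x (r : ℝ), x + r • v ∈ S ↔ x ∈ S) :
    ∫ x in S, fderiv ℝ φ x v ∂μ = 0 := by
  have hmul : ∀ f : E → ℝ, (fun x => S.indicator (fun _ => (1 : ℝ)) x * f x) = S.indicator f :=
    fun f => by ext x; by_cases hx : x ∈ S <;> simp [hx]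
  have hconst : ∀ x, HasLineDerivAt ℝ (S.indicator fun _ => (1 : ℝ)) 0 x v := fun x => by
    have hline : ∀ r : ℝ, S.indicator (fun _ => (1 : ℝ)) (x + r • v) =
        S.indicator (fun _ => (1 : ℝ)) x := fun r => by by_cases hx : x ∈ S <;> simp [hv, hx]
    simp only [HasLineDerivAt, hline]
    exact hasDerivAt_const _ _
  have h := integral_bilinear_hasLineDerivAt_right_eq_neg_left_of_integrable (μ := μ)
    (f := S.indicator fun _ => (1 : ℝ)) (f' := 0) (g := φ) (g' := fun x => fderiv ℝ φ x v)
    (B := ContinuousLinearMap.mul ℝ ℝ) (by simp)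
    (by simpa only [ContinuousLinearMap.mul_apply', hmul] using hi'.indicator hS)
    (by simpa only [ContinuousLinearMap.mul_apply', hmul] using hi.indicator hS)
    (fun x _ => hconst x) fun x _ => (hφ x).hasFDerivAt.hasLineDerivAt v
  simpa [hmul, integral_indicator hS] using h

end LineIntegrals

namespace IsTest

variable {Ω : Set V3} {φ : V3 → ℝ} (hφ : IsTest Ω φ)
include hφ

lemma continuous : Continuous φ := hφ.1.continuous

lemma differentiable : Differentiable ℝ φ := hφ.1.differentiable (by simp)

lemma integrable : Integrable φ := hφ.continuous.integrable_of_hasCompactSupport hφ.2.1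

lemma continuous_fderiv_apply (v : V3) : Continuous fun x => fderiv ℝ φ x v :=
  (hφ.1.continuous_fderiv (by simp)).clm_apply continuous_const

lemma hasCompactSupport_fderiv_apply (v : V3) : HasCompactSupport fun x => fderiv ℝ φ x v :=
  hφ.2.1.fderiv_apply (𝕜 := ℝ) v

lemma integrable_fderiv_apply (v : V3) : Integrable fun x => fderiv ℝ φ x v :=
  (hφ.continuous_fderiv_apply v).integrable_of_hasCompactSupport
    (hφ.hasCompactSupport_fderiv_apply v)

lemma eq_zero {x : V3} (hx : x ∉ Ω) : φ x = 0 :=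
  image_eq_zero_of_notMem_tsupport fun h => hx (hφ.2.2 h)

lemma fderiv_apply_eq_zero {x : V3} (hx : x ∉ Ω) (v : V3) : fderiv ℝ φ x v = 0 := by
  rw [image_eq_zero_of_notMem_tsupport fun h => hx (hφ.2.2 (tsupport_fderiv_subset ℝ h)),
    zero_apply]

lemma setIntegral_mul (f : V3 → ℝ) : ∫ x in Ω, f x * φ x = ∫ x, f x * φ x :=
  setIntegral_eq_integral_of_forall_compl_eq_zero fun x hx => by rw [hφ.eq_zero hx, mul_zero]

lemma setIntegral_mul_fderiv (f : V3 → ℝ) (v : V3) :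
    ∫ x in Ω, f x * fderiv ℝ φ x v = ∫ x, f x * fderiv ℝ φ x v :=
  setIntegral_eq_integral_of_forall_compl_eq_zero fun x hx => by
    rw [hφ.fderiv_apply_eq_zero hx, mul_zero]

lemma integral_mul_fderiv {f f' : V3 → ℝ} {C : NNReal} (hf : LipschitzWith C f) {v : V3}
    (hf' : ∀ᵐ x, HasLineDerivAt ℝ f (f' x) x v) :
    ∫ x in Ω, f x * fderiv ℝ φ x v = -∫ x in Ω, f' x * φ x := by
  obtain ⟨D, hD⟩ := (hφ.1.of_le (by norm_num)).lipschitzWith_of_hasCompactSupport hφ.2.1 one_ne_zero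
  have hφ' : ∀ x, lineDeriv ℝ φ x (-v) * f x = -(f x * fderiv ℝ φ x v) := fun x => by
    rw [(hφ.differentiable x).lineDeriv_eq_fderiv, map_neg]
    ring
  calc ∫ x in Ω, f x * fderiv ℝ φ x v
      = -∫ x, lineDeriv ℝ φ x (-v) * f x := by
        simp only [hφ', integral_neg, neg_neg, hφ.setIntegral_mul_fderiv]
    _ = -∫ x, lineDeriv ℝ f x v * φ x := by rw [hf.integral_lineDeriv_mul_eq hD hφ.2.1 v]
    _ = -∫ x in Ω, f' x * φ x := by
        rw [hφ.setIntegral_mul]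
        exact congrArg Neg.neg
          (integral_congr_ae (hf'.mono fun x hx => by simp only [hx.lineDeriv]))

end IsTest

section HalfSpace

variable {b : OrthonormalBasis (Fin 3) ℝ V3} {L : ℝ} {φ : V3 → ℝ}

lemma measurableSet_halfSpace (v : V3) : MeasurableSet {x | 0 < inner ℝ v x} :=
  measurableSet_lt measurable_const (by fun_prop)

lemma IsTest.setIntegral_halfSpace_fderiv_normal (hφ : IsTest (cube b L) φ) :
    ∫ x in {x | 0 < inner ℝ (b 0) x}, fderiv ℝ φ x (b 0) = -∫ x, φ x ∂midPlaneArea b L := by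
  have hpre : frame b ⁻¹' {x | 0 < inner ℝ (b 0) x} = univ ×ˢ Ioi 0 := by
    ext y
    simp [inner_frame_zero]
  have hline : ∀ y r, frame b (y, r) = frame b (y, 0) + r • b 0 := fun y r => by
    simp [frame_apply]
  have hint : Integrable fun y => fderiv ℝ φ (frame b y) (b 0) :=
    ((measurePreserving_frame b).integrable_comp_emb (frame b).measurableEmbedding).2
      (hφ.integrable_fderiv_apply (b 0))
  calc ∫ x in {x | 0 < inner ℝ (b 0) x}, fderiv ℝ φ x (b 0)
      = ∫ y in (univ : Set (ℝ × ℝ)) ×ˢ Ioi (0 : ℝ), fderiv ℝ φ (frame b y) (b 0) := by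
        rw [← hpre]
        exact ((measurePreserving_frame b).setIntegral_preimage_emb (frame b).measurableEmbedding
          (fun x => fderiv ℝ φ x (b 0)) _).symm
    _ = ∫ y, ∫ r in Ioi (0 : ℝ), fderiv ℝ φ (frame b (y, 0) + r • b 0) (b 0) := by
        rw [Measure.volume_eq_prod, setIntegral_prod _ hint.integrableOn, setIntegral_univ]
        simp only [← hline]
    _ = -∫ y, φ (frame b (y, 0)) := by
        simp only [integral_Ioi_fderiv_line (hφ.1.of_le (by norm_num)) hφ.2.1 _
          (b.orthonormal.ne_zero 0), integral_neg]
    _ = -∫ x, φ x ∂midPlaneArea b L := by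
        rw [integral_midPlaneArea, setIntegral_eq_integral_of_forall_compl_eq_zero]
        exact fun y hy => hφ.eq_zero fun h => hy ((frame_mem_cube b L).1 h).1

lemma IsTest.setIntegral_halfSpace_fderiv (hφ : IsTest (cube b L) φ) (v : V3) :
    ∫ x in {x | 0 < inner ℝ (b 0) x}, fderiv ℝ φ x v =
      -(inner ℝ (b 0) v * ∫ x, φ x ∂midPlaneArea b L) := by
  set τ := v - inner ℝ (b 0) v • b 0 with hτ
  have hτ0 : inner ℝ (b 0) τ = (0 : ℝ) := by simp [hτ, inner_sub_right, inner_smul_right]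
  have htangential : ∫ x in {x | 0 < inner ℝ (b 0) x}, fderiv ℝ φ x τ = 0 :=
    setIntegral_fderiv_eq_zero_of_translation_invariant hφ.differentiable hφ.integrable
      (hφ.integrable_fderiv_apply τ) (measurableSet_halfSpace _)
      fun x r => by simp [inner_add_right, inner_smul_right, hτ0]
  have hsplit : ∀ x, fderiv ℝ φ x v =
      inner ℝ (b 0) v * fderiv ℝ φ x (b 0) + fderiv ℝ φ x τ := fun x => by
    rw [hτ, map_sub, map_smul, smul_eq_mul, add_sub_cancel]
  simp only [hsplit]
  rw [integral_add ((hφ.integrable_fderiv_apply _).const_mul _).integrableOn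
    (hφ.integrable_fderiv_apply τ).integrableOn, integral_const_mul,
    hφ.setIntegral_halfSpace_fderiv_normal, htangential]
  ring

end HalfSpace

section Densities

variable {α : Type*} [MeasurableSpace α] {μ : Measure α} {f φ : α → ℝ} {C : ℝ}

lemma ofReal_integral_le_lintegral (f : α → ℝ) :
    ENNReal.ofReal (∫ x, f x ∂μ) ≤ ∫⁻ x, ENNReal.ofReal (f x) ∂μ := by
  by_cases hf : Integrable f μ
  · rw [integral_eq_lintegral_pos_part_sub_lintegral_neg_part hf]
    exact (ENNReal.ofReal_le_ofReal (sub_le_self _ ENNReal.toReal_nonneg)).trans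
      ENNReal.ofReal_toReal_le
  · simp [integral_undef hf]

lemma integrable_withDensityᵥ (hf : Integrable f μ) (hφ : StronglyMeasurable φ)
    (hC : ∀ x, ‖φ x‖ ≤ C) : (μ.withDensityᵥ f).Integrable φ := by
  rw [VectorMeasure.Integrable, Measure.variation_withDensityᵥ hf]
  have : IsFiniteMeasure (μ.withDensity fun x => ‖f x‖ₑ) := ⟨by simpa using! hf.2⟩
  exact Integrable.of_bound hφ.aestronglyMeasurable C (ae_of_all _ hC)

lemma integral_withDensityᵥ (hf : Integrable f μ) (hφ : StronglyMeasurable φ)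
    (hC : ∀ x, ‖φ x‖ ≤ C) :
    (μ.withDensityᵥ f).integral φ (ContinuousLinearMap.lsmul ℝ ℝ) = ∫ x, f x * φ x ∂μ := by
  have hflip : (ContinuousLinearMap.lsmul ℝ ℝ : ℝ →L[ℝ] ℝ →L[ℝ] ℝ) =
      (ContinuousLinearMap.lsmul ℝ ℝ : ℝ →L[ℝ] ℝ →L[ℝ] ℝ).flip := by
    ext; simp
  have := isFiniteMeasure_withDensity_ofReal hf.2
  have := isFiniteMeasure_withDensity_ofReal hf.neg.2
  have hfn : AEMeasurable (fun x => ENNReal.ofReal (-f x)) μ := hf.neg.aemeasurable.ennreal_ofReal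
  have hi : ∀ ν : Measure α, ∀ [IsFiniteMeasure ν], ν.toSignedMeasure.Integrable φ := fun ν _ => by
    rw [VectorMeasure.Integrable, Measure.variation_toSignedMeasure]
    exact Integrable.of_bound hφ.aestronglyMeasurable C (ae_of_all _ hC)
  rw [withDensityᵥ_eq_withDensity_pos_part_sub_withDensity_neg_part hf,
    VectorMeasure.integral_sub_vectorMeasure (hi _) (hi _), hflip,
    VectorMeasure.integral_toSignedMeasure, VectorMeasure.integral_toSignedMeasure,
    integral_withDensity_eq_integral_toReal_smul₀ hf.aemeasurable.ennreal_ofReal (by simp),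
    integral_withDensity_eq_integral_toReal_smul₀ hfn (by simp)]
  simp only [ENNReal.toReal_ofReal', smul_eq_mul]
  rw [← integral_sub (hf.pos_part.mul_bdd hφ.aestronglyMeasurable (ae_of_all _ hC))
    ((Integrable.pos_part (f := fun x => -f x) hf.neg).mul_bdd hφ.aestronglyMeasurable
      (ae_of_all _ hC))]
  simp only [← sub_mul, max_zero_sub_max_neg_zero_eq_self]

end Densities

namespace TensorMeasure

variable (q : TensorMeasure)

instance isFiniteMeasure_dom : IsFiniteMeasure q.dom := by
  refine ⟨?_⟩
  simp only [dom, Measure.finsetSum_apply, SignedMeasure.totalVariation, Measure.add_apply]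
  exact ENNReal.sum_lt_top.2 fun i _ => ENNReal.sum_lt_top.2 fun j _ =>
    ENNReal.add_lt_top.2 ⟨measure_lt_top _ _, measure_lt_top _ _⟩

lemma totalVariation_le_dom (i j : Fin 3) : (q.comp i j).totalVariation ≤ q.dom :=
  (Finset.single_le_sum (f := fun j => (q.comp i j).totalVariation)
    (fun _ _ => bot_le) (Finset.mem_univ j)).trans
  (Finset.single_le_sum (f := fun i => ∑ j, (q.comp i j).totalVariation)
    (fun _ _ => bot_le) (Finset.mem_univ i))

lemma withDensityᵥ_density (i j : Fin 3) :
    q.dom.withDensityᵥ ((q.comp i j).rnDeriv q.dom) = q.comp i j := by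
  refine SignedMeasure.withDensityᵥ_rnDeriv_eq _ _ ?_
  rw [SignedMeasure.absolutelyContinuous_ennreal_iff,
    show q.dom.toENNRealVectorMeasure.ennrealToMeasure = q.dom from
      VectorMeasure.equivMeasure.right_inv q.dom]
  exact Measure.absolutelyContinuous_of_le (q.totalVariation_le_dom i j)

lemma setIntegral_ddot_density (σ : M3s) {S : Set V3} (hS : MeasurableSet S) :
    ∫ x in S, ddot σ (q.density x) ∂q.dom = ∑ i, ∑ j, σ.1 i j * q.comp i j S := by
  have hi : ∀ i j, Integrable (fun x => σ.1 i j * (q.comp i j).rnDeriv q.dom x)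
      (q.dom.restrict S) := fun i j =>
    ((SignedMeasure.integrable_rnDeriv _ _).const_mul _).integrableOn
  simp only [ddot, density, Matrix.of_apply]
  rw [integral_finsetSum _ fun i _ => integrable_finsetSum _ fun j _ => hi i j]
  refine Finset.sum_congr rfl fun i _ => ?_
  rw [integral_finsetSum _ fun j _ => hi i j]
  refine Finset.sum_congr rfl fun j _ => ?_
  rw [integral_const_mul, ← withDensityᵥ_apply (SignedMeasure.integrable_rnDeriv _ _) hS,
    q.withDensityᵥ_density]

end TensorMeasure

/-! ### Averages over small balls and precise representatives -/

section PreciseRep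

lemma eventually_ball_subset {E : Type*} [PseudoMetricSpace E] {Ω : Set E} {x : E}
    (hx : Ω ∈ 𝓝 x) : ∀ᶠ r in 𝓝[>] (0 : ℝ), 0 < r ∧ Metric.ball x r ⊆ Ω := by
  obtain ⟨ε, hε, hsub⟩ := Metric.mem_nhds_iff.1 hx
  filter_upwards [Ioo_mem_nhdsGT hε] with r hr
  exact ⟨hr.1, (Metric.ball_subset_ball hr.2.le).trans hsub⟩

variable {E : Type*} [PseudoMetricSpace E] [ProperSpace E] [MeasurableSpace E] {μ : Measure E}
  [μ.IsOpenPosMeasure] [IsFiniteMeasureOnCompacts μ]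
  {Ω : Set E} {β : E → ℝ} {c d : ℝ} {x : E}

lemma eventually_average_ball_mem_Icc (hx : Ω ∈ 𝓝 x) (hi : IntegrableOn β Ω μ)
    (hβ : ∀ᵐ y ∂μ.restrict Ω, β y ∈ Icc c d) :
    ∀ᶠ r in 𝓝[>] (0 : ℝ), ⨍ y in Metric.ball x r, β y ∂μ ∈ Icc c d := by
  filter_upwards [eventually_ball_subset hx] with r hr
  exact (convex_Icc c d).set_average_mem isClosed_Icc (Metric.measure_ball_pos _ _ hr.1).ne'
    measure_ball_lt_top.ne (ae_mono (Measure.restrict_mono hr.2 le_rfl) hβ) (hi.mono_set hr.2)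

variable [OpensMeasurableSpace E] in
lemma tendsto_average_ball_of_ae_eq_continuousAt {f : E → ℝ} (hΩ : Ω ∈ 𝓝 x)
    (hi : IntegrableOn β Ω μ) (hβ : β =ᵐ[μ.restrict Ω] f) (hf : ContinuousAt f x) :
    Tendsto (fun r => ⨍ y in Metric.ball x r, β y ∂μ) (𝓝[>] 0) (𝓝 (f x)) := by
  refine (nhds_basis_Icc_pos (f x)).tendsto_right_iff.2 fun ε hε => ?_
  obtain ⟨U, hU, hUo, hxU⟩ := mem_nhds_iff.1
    (Filter.inter_mem (hf (Icc_mem_nhds (sub_lt_self (f x) hε) (lt_add_of_pos_right (f x) hε))) hΩ)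
  refine eventually_average_ball_mem_Icc (hUo.mem_nhds hxU)
    (hi.mono_set fun y hy => (hU hy).2) ?_
  filter_upwards [ae_mono (Measure.restrict_mono (fun y hy => (hU hy).2) le_rfl) hβ,
    ae_restrict_mem hUo.measurableSet] with y hy hyU
  exact hy ▸ (hU hyU).1

lemma tendsto_average_ball_abs_sub (hx : Ω ∈ 𝓝 x) (hi : IntegrableOn β Ω μ)
    (hβ : ∀ᵐ y ∂μ.restrict Ω, β y ≤ d)
    (hlim : Tendsto (fun r => ⨍ y in Metric.ball x r, β y ∂μ) (𝓝[>] 0) (𝓝 d)) :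
    Tendsto (fun r => ⨍ y in Metric.ball x r, |β y - d| ∂μ) (𝓝[>] 0) (𝓝 0) := by
  have hsub : Tendsto (fun r => d - ⨍ y in Metric.ball x r, β y ∂μ) (𝓝[>] 0) (𝓝 0) := by
    simpa using hlim.const_sub d
  refine hsub.congr' ?_
  filter_upwards [eventually_ball_subset hx] with r hr
  have hne : μ (Metric.ball x r) ≠ 0 := (Metric.measure_ball_pos _ _ hr.1).ne'
  have hfin : μ (Metric.ball x r) ≠ ⊤ := measure_ball_lt_top.ne
  have habs : ∀ᵐ y ∂μ.restrict (Metric.ball x r), |β y - d| = d - β y := by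
    filter_upwards [ae_mono (Measure.restrict_mono hr.2 le_rfl) hβ] with y hy
    rw [abs_sub_comm, abs_of_nonneg (sub_nonneg.2 hy)]
  have hpos : 0 < μ.real (Metric.ball x r) := ENNReal.toReal_pos hne hfin
  have hconst : IntegrableOn (fun _ => d) (Metric.ball x r) μ := integrableOn_const hfin
  rw [setAverage_eq, setAverage_eq, integral_congr_ae habs,
    integral_sub hconst (hi.mono_set hr.2), setIntegral_const]
  simp only [smul_eq_mul]
  field_simp

end PreciseRep

section PreciseRep

variable {Ω : Set V3} {β f : V3 → ℝ} {d : ℝ} {x : V3}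

lemma preciseRep_eq_of_tendsto (h : Tendsto (fun r => ⨍ y in Metric.ball x r, β y) (𝓝[>] 0) (𝓝 d)) :
    preciseRep β x = d := by
  rw [preciseRep, if_pos ⟨d, h⟩, h.limUnder_eq]

lemma tendsto_average_ball_preciseRep (h : preciseRep β x ≠ 0) :
    Tendsto (fun r => ⨍ y in Metric.ball x r, β y) (𝓝[>] 0) (𝓝 (preciseRep β x)) := by
  by_cases hlim : ∃ d, Tendsto (fun r => ⨍ y in Metric.ball x r, β y) (𝓝[>] 0) (𝓝 d)
  · obtain ⟨d, hd⟩ := hlim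
    rwa [preciseRep_eq_of_tendsto hd]
  · exact absurd (if_neg hlim) h

lemma preciseRep_mem_Icc (hx : Ω ∈ 𝓝 x) (hd : 0 ≤ d) (hi : IntegrableOn β Ω)
    (hβ : ∀ᵐ y ∂volume.restrict Ω, β y ∈ Icc 0 d) : preciseRep β x ∈ Icc 0 d := by
  rcases eq_or_ne (preciseRep β x) 0 with h | h
  · simpa [h] using hd
  · exact isClosed_Icc.mem_of_tendsto (tendsto_average_ball_preciseRep h)
      (eventually_average_ball_mem_Icc hx hi hβ)

end PreciseRep

/-! ### Mollification -/

section Bump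

variable {E : Type*} [NormedAddCommGroup E]

variable (E) in
/-- A sequence of bump functions whose supports shrink to the origin. -/
noncomputable def bump (m : ℕ) : ContDiffBump (0 : E) where
  rIn := 1 / (m + 1) / 2
  rOut := 1 / (m + 1)
  rIn_pos := by positivity
  rIn_lt_rOut := half_lt_self (by positivity)

lemma tendsto_bump_rOut : Tendsto (fun m => (bump E m).rOut) atTop (𝓝 0) :=
  tendsto_one_div_add_atTop_nhds_zero_nat

lemma bump_rOut_le (m : ℕ) : (bump E m).rOut ≤ 2 * (bump E m).rIn := by
  simp only [bump]
  linarith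

end Bump

section Mollify

open scoped Convolution

variable {E : Type*} [NormedAddCommGroup E] [NormedSpace ℝ E] [FiniteDimensional ℝ E]
  [HasContDiffBump E] [MeasureSpace E] [BorelSpace E] [(volume : Measure E).IsAddHaarMeasure]

/-- The convolution of a function with a normalized bump function, used to approximate weakly
differentiable functions by smooth ones. -/
noncomputable def mollify (ρ : ContDiffBump (0 : E)) (f : E → ℝ) : E → ℝ :=
  ρ.normed volume ⋆[ContinuousLinearMap.lsmul ℝ ℝ, volume] f

variable (ρ : ContDiffBump (0 : E)) {f g : E → ℝ} {c d C : ℝ}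

lemma mollify_apply (f : E → ℝ) (x : E) :
    mollify ρ f x = ∫ t, ρ.normed volume (x - t) * f t :=
  convolution_lsmul_swap

lemma mollify_eq_convolution_mul (f : E → ℝ) :
    mollify ρ f = f ⋆[ContinuousLinearMap.mul ℝ ℝ, volume] ρ.normed volume := by
  funext x
  simp only [mollify_apply, convolution, ContinuousLinearMap.mul_apply', mul_comm]

lemma exists_abs_normed_le : ∃ C, ∀ x, |ρ.normed volume x| ≤ C :=
  ρ.continuous_normed.bounded_above_of_compact_support ρ.hasCompactSupport_normed

lemma integral_normed_sub (x : E) : ∫ t, ρ.normed volume (x - t) = 1 := by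
  rw [integral_sub_left_eq_self (fun t => ρ.normed volume t) volume x, ρ.integral_normed]

lemma mollify_mem_Icc (hf : Integrable f) (h : ∀ᵐ t, f t ∈ Icc c d) (x : E) :
    mollify ρ f x ∈ Icc c d := by
  obtain ⟨C, hC⟩ := exists_abs_normed_le ρ
  have hconst : ∀ c : ℝ, Integrable (fun t => ρ.normed volume (x - t) * c) ∧
      ∫ t, ρ.normed volume (x - t) * c = c := fun c =>
    ⟨(ρ.integrable_normed.comp_sub_left x).mul_const c,
      by rw [integral_mul_const, integral_normed_sub, one_mul]⟩
  have hint : Integrable fun t => ρ.normed volume (x - t) * f t :=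
    hf.bdd_mul (ρ.continuous_normed.comp (continuous_const.sub continuous_id)).aestronglyMeasurable
      (ae_of_all _ fun t => hC _)
  rw [mollify_apply]
  constructor
  · calc c = ∫ t, ρ.normed volume (x - t) * c := (hconst c).2.symm
      _ ≤ _ := integral_mono_ae (hconst c).1 hint
        (h.mono fun t ht => mul_le_mul_of_nonneg_left ht.1 (ρ.nonneg_normed _))
  · calc ∫ t, ρ.normed volume (x - t) * f t ≤ ∫ t, ρ.normed volume (x - t) * d :=
          integral_mono_ae hint (hconst d).1
            (h.mono fun t ht => mul_le_mul_of_nonneg_left ht.2 (ρ.nonneg_normed _))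
      _ = d := (hconst d).2

lemma contDiff_mollify (hf : LocallyIntegrable f) : ContDiff ℝ 1 (mollify ρ f) := by
  rw [mollify_eq_convolution_mul]
  exact ρ.hasCompactSupport_normed.contDiff_convolution_right _ hf (ρ.contDiff_normed (n := 1))

lemma fderiv_mollify_apply (hf : LocallyIntegrable f) (x v : E) :
    fderiv ℝ (mollify ρ f) x v = ∫ t, f t * fderiv ℝ (ρ.normed volume) (x - t) v := by
  have hρ : ContDiff ℝ 1 (ρ.normed volume) := ρ.contDiff_normed (n := 1)
  have hc : HasCompactSupport (ρ.normed volume) := ρ.hasCompactSupport_normed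
  rw [mollify_eq_convolution_mul, (hc.hasFDerivAt_convolution_right
    (ContinuousLinearMap.mul ℝ ℝ) hf hρ x).fderiv,
    convolution_precompR_apply _ hf (hc.fderiv ℝ) (hρ.continuous_fderiv one_ne_zero)]
  rfl

lemma integral_mul_mollify_comm (hf : Integrable f) (hg : Integrable g) :
    ∫ x, f x * mollify ρ g x = ∫ x, g x * mollify ρ f x := by
  obtain ⟨C, hC⟩ := exists_abs_normed_le ρ
  have hleft : ∀ x, f x * mollify ρ g x = ∫ t, ρ.normed volume (x - t) * (f x * g t) := fun x => by
    rw [mollify_apply, ← integral_const_mul]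
    exact integral_congr_ae (ae_of_all _ fun t => by ring)
  have hright : ∀ t, g t * mollify ρ f t = ∫ x, ρ.normed volume (x - t) * (f x * g t) :=
    fun t => by
      rw [mollify_apply, ← integral_const_mul]
      refine integral_congr_ae (ae_of_all _ fun x => ?_)
      simp only [← neg_sub t x, ρ.normed_neg]
      ring
  simp only [hleft, hright]
  refine integral_integral_swap ((hf.mul_prod hg).bdd_mul ?_ (ae_of_all _ fun t => hC _))
  exact (ρ.continuous_normed.comp (continuous_fst.sub continuous_snd)).aestronglyMeasurable

lemma ae_tendsto_mollify (hf : LocallyIntegrable f) :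
    ∀ᵐ x, Tendsto (fun m => mollify (bump E m) f x) atTop (𝓝 (f x)) :=
  ContDiffBump.ae_convolution_tendsto_right_of_locallyIntegrable tendsto_bump_rOut
    (Eventually.of_forall bump_rOut_le) hf

lemma tendsto_mollify_of_tendsto_average {x : E} (hf : LocallyIntegrable f)
    (h : Tendsto (fun r => ⨍ y in Metric.ball x r, |f y - d|) (𝓝[>] 0) (𝓝 0)) :
    Tendsto (fun m => mollify (bump E m) f x) atTop (𝓝 d) := by
  simp only [mollify_apply]
  refine tendsto_integral_smul_of_tendsto_average_norm_sub
    (a := fun m => Metric.ball x (bump E m).rOut) (2 ^ Module.finrank ℝ E)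
    (h.comp (tendsto_nhdsWithin_iff.2 ⟨tendsto_bump_rOut,
      Eventually.of_forall fun m => (bump E m).rOut_pos⟩)) ?_ ?_ ?_ ?_
  · exact Eventually.of_forall fun m => (hf.integrableOn_isCompact
      (isCompact_closedBall x _)).mono_set Metric.ball_subset_closedBall
  · simp only [integral_normed_sub]
    exact tendsto_const_nhds
  · refine Eventually.of_forall fun m y hy => ?_
    have hmem : x - y ∈ Function.support ((bump E m).normed volume) := hy
    rwa [ContDiffBump.support_normed_eq, mem_ball_zero_iff, ← dist_eq_norm, dist_comm] at hmem
  · refine Eventually.of_forall fun m y => ?_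
    rw [abs_of_nonneg (ContDiffBump.nonneg_normed _ _)]
    refine ((bump E m).normed_le_div_measure_closedBall_rOut volume 2 (bump_rOut_le m) _).trans ?_
    rw [measureReal_def, ← Measure.addHaar_closedBall_center volume x, ← measureReal_def]
    gcongr
    · exact ENNReal.toReal_pos (Metric.measure_ball_pos _ _ (bump E m).rOut_pos).ne'
        measure_ball_lt_top.ne
    · exact measure_closedBall_lt_top.ne
    · exact Metric.ball_subset_closedBall

lemma tendsto_setIntegral_mul_mollify {S : Set E} (hS : MeasurableSet S) (hf : IntegrableOn f S)
    (hC : ∀ x, |f x| ≤ C) (hg : Integrable g) :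
    Tendsto (fun m => ∫ x in S, f x * mollify (bump E m) g x) atTop (𝓝 (∫ x in S, f x * g x)) := by
  have hind : ∀ k : E → ℝ, ∫ x in S, f x * k x = ∫ x, S.indicator f x * k x := fun k => by
    rw [← integral_indicator hS]
    simp only [indicator_mul_left]
  have hfS : Integrable (S.indicator f) := hf.integrable_indicator hS
  have hfC : ∀ x, S.indicator f x ∈ Icc (-C) C := fun x =>
    abs_le.1 ((norm_indicator_le_norm_self f x).trans (hC x))
  simp only [hind, integral_mul_mollify_comm _ hfS hg, mul_comm (S.indicator f _) (g _)]
  refine tendsto_integral_of_dominated_convergence (fun x => ‖g x‖ * C) (fun m => ?_)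
    (hg.norm.mul_const _) (fun m => ae_of_all _ fun x => ?_) ?_
  · exact hg.aestronglyMeasurable.mul
      (contDiff_mollify _ hfS.locallyIntegrable).continuous.aestronglyMeasurable
  · rw [norm_mul]
    exact mul_le_mul_of_nonneg_left
      (abs_le.2 (mollify_mem_Icc _ hfS (ae_of_all _ hfC) x)) (norm_nonneg _)
  · filter_upwards [ae_tendsto_mollify hfS.locallyIntegrable] with x hx using hx.const_mul _

end Mollify

section WeakGradient

variable {Ω : Set V3} {β f g φ : V3 → ℝ} {x : V3}

lemma IsTest.integrableOn_mul (hφ : IsTest Ω φ) (hf : IntegrableOn f Ω) :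
    IntegrableOn (fun x => f x * φ x) Ω := by
  obtain ⟨C, hC⟩ := hφ.continuous.bounded_above_of_compact_support hφ.2.1
  exact hf.mul_bdd hφ.continuous.aestronglyMeasurable (ae_of_all _ hC)

lemma IsTest.integrableOn_mul_fderiv (hφ : IsTest Ω φ) (hf : IntegrableOn f Ω) (v : V3) :
    IntegrableOn (fun x => f x * fderiv ℝ φ x v) Ω := by
  obtain ⟨C, hC⟩ := (hφ.continuous_fderiv_apply v).bounded_above_of_compact_support
    (hφ.hasCompactSupport_fderiv_apply v)
  exact hf.mul_bdd (hφ.continuous_fderiv_apply v).aestronglyMeasurable (ae_of_all _ hC)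

lemma ae_eq_of_forall_isTest (hΩ : IsOpen Ω) (hf : IntegrableOn f Ω) (hg : IntegrableOn g Ω)
    (h : ∀ φ, IsTest Ω φ → ∫ x in Ω, f x * φ x = ∫ x in Ω, g x * φ x) :
    f =ᵐ[volume.restrict Ω] g := by
  rw [EventuallyEq, ae_restrict_iff' hΩ.measurableSet]
  suffices h0 : ∀ᵐ x, x ∈ Ω → f x - g x = 0 from h0.mono fun x hx hxΩ => sub_eq_zero.1 (hx hxΩ)
  refine hΩ.ae_eq_zero_of_integral_contDiff_smul_eq_zero (hf.sub hg).locallyIntegrableOn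
    fun φ hsmooth hcompact hsupp => ?_
  have hφ : IsTest Ω φ := ⟨hsmooth, hcompact, hsupp⟩
  calc ∫ x, φ x • (f x - g x) = ∫ x in Ω, (f x * φ x - g x * φ x) := by
        simp only [smul_eq_mul, mul_comm (φ _), ← sub_mul]
        exact (hφ.setIntegral_mul _).symm
    _ = 0 := by
        rw [integral_sub (hφ.integrableOn_mul hf) (hφ.integrableOn_mul hg), h φ hφ, sub_self]

lemma IsWeakGradient.setIntegral_mul_fderiv {γ : V3 → V3} (h : IsWeakGradient Ω β γ)
    (hβ : IntegrableOn β Ω) (hγ : IntegrableOn γ Ω) (hφ : IsTest Ω φ) (v : V3) :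
    ∫ x in Ω, β x * fderiv ℝ φ x v = -∫ x in Ω, inner ℝ v (γ x) * φ x := by
  have hv : v = ∑ i, v i • EuclideanSpace.single i (1 : ℝ) := by
    ext j
    simp [Pi.single_apply]
  have hfderiv : ∀ x, β x * fderiv ℝ φ x v = ∑ i, v i * (β x * partialD i φ x) := fun x => by
    conv_lhs => rw [hv]
    simp only [map_sum, map_smul, smul_eq_mul, Finset.mul_sum, partialD, mul_left_comm]
  have hinner : ∀ x, inner ℝ v (γ x) * φ x = ∑ i, v i * (γ x i * φ x) := fun x => by
    simp only [PiLp.inner_apply, RCLike.inner_apply, conj_trivial, Finset.sum_mul]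
    exact Finset.sum_congr rfl fun i _ => by ring
  have hγi : ∀ i, IntegrableOn (fun x => γ x i) Ω := fun i =>
    (EuclideanSpace.proj (𝕜 := ℝ) i).integrable_comp hγ
  have hβi : ∀ i, IntegrableOn (fun x => v i * (β x * partialD i φ x)) Ω := fun i =>
    (hφ.integrableOn_mul_fderiv hβ _).const_mul _
  simp only [hfderiv, hinner]
  rw [integral_finsetSum _ fun i _ => hβi i,
    integral_finsetSum _ fun i _ => (hφ.integrableOn_mul (hγi i)).const_mul _,
    ← Finset.sum_neg_distrib]
  refine Finset.sum_congr rfl fun i _ => ?_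
  rw [integral_const_mul, integral_const_mul, h φ hφ i, mul_neg]

lemma isTest_normed_sub (ρ : ContDiffBump (0 : V3)) (hx : Metric.closedBall x ρ.rOut ⊆ Ω) :
    IsTest Ω fun y => ρ.normed volume (x - y) := by
  have hsupp : tsupport (fun y => ρ.normed volume (x - y)) ⊆ Metric.closedBall x ρ.rOut := by
    refine closure_minimal (fun y hy => ?_) Metric.isClosed_closedBall
    have hmem : x - y ∈ Function.support (ρ.normed volume) := hy
    rw [ρ.support_normed_eq, mem_ball_zero_iff, ← dist_eq_norm, dist_comm] at hmem
    exact hmem.le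
  exact ⟨ρ.contDiff_normed.comp (contDiff_const.sub contDiff_id),
    HasCompactSupport.of_support_subset_isCompact (isCompact_closedBall x ρ.rOut)
      ((subset_tsupport _).trans hsupp), hsupp.trans hx⟩

lemma fderiv_mollify_indicator (ρ : ContDiffBump (0 : V3)) (hΩ : MeasurableSet Ω) {γ : V3 → V3}
    (hβ : IntegrableOn β Ω) (hγ : IntegrableOn γ Ω) (h : IsWeakGradient Ω β γ)
    (hx : Metric.closedBall x ρ.rOut ⊆ Ω) (v : V3) :
    fderiv ℝ (mollify ρ (Ω.indicator β)) x v =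
      mollify ρ (Ω.indicator fun y => inner ℝ v (γ y)) x := by
  have hind : ∀ f k : V3 → ℝ, ∫ t, Ω.indicator f t * k t = ∫ t in Ω, f t * k t := fun f k => by
    rw [← integral_indicator hΩ]
    simp only [indicator_mul_left]
  have hchain : ∀ t, fderiv ℝ (fun y => ρ.normed volume (x - y)) t v =
      -fderiv ℝ (ρ.normed volume) (x - t) v := fun t => by
    have hρ : DifferentiableAt ℝ (ρ.normed volume) (x - t) :=
      (ρ.contDiff_normed (n := 1)).differentiable one_ne_zero _
    have hcomp : HasFDerivAt (fun y => ρ.normed volume (x - y)) _ t :=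
      hρ.hasFDerivAt.comp t ((hasFDerivAt_id t).const_sub x)
    rw [hcomp.fderiv]
    simp
  rw [fderiv_mollify_apply ρ (hβ.integrable_indicator hΩ).locallyIntegrable, mollify_apply, hind]
  simp only [mul_comm (ρ.normed volume _), hind]
  rw [← neg_eq_iff_eq_neg.2 (h.setIntegral_mul_fderiv hβ hγ (isTest_normed_sub ρ hx) v),
    ← integral_neg]
  simp only [hchain, mul_neg, neg_neg]

lemma ae_indicator_mem_Icc {d : ℝ} (hΩ : MeasurableSet Ω) (hd : 0 ≤ d)
    (hβ : ∀ᵐ x ∂volume.restrict Ω, β x ∈ Icc 0 d) : ∀ᵐ x, Ω.indicator β x ∈ Icc 0 d := by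
  rw [ae_restrict_iff' hΩ] at hβ
  filter_upwards [hβ] with x hx
  by_cases hxΩ : x ∈ Ω
  · rw [indicator_of_mem hxΩ]
    exact hx hxΩ
  · rw [indicator_of_notMem hxΩ]
    exact left_mem_Icc.2 hd

lemma tendsto_mollify_indicator_of_preciseRep {d : ℝ} (hx : Ω ∈ 𝓝 x) (hΩ : MeasurableSet Ω)
    (hi : IntegrableOn β Ω) (hβ : ∀ᵐ y ∂volume.restrict Ω, β y ≤ d) (hd : d ≠ 0)
    (h : preciseRep β x = d) :
    Tendsto (fun m => mollify (bump V3 m) (Ω.indicator β) x) atTop (𝓝 d) := by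
  have hlim := tendsto_average_ball_preciseRep (h.trans_ne hd)
  rw [h] at hlim
  refine tendsto_mollify_of_tendsto_average (hi.integrable_indicator hΩ).locallyIntegrable
    ((tendsto_average_ball_abs_sub hx hi hβ hlim).congr' ?_)
  filter_upwards [eventually_ball_subset hx] with r hr
  refine setAverage_congr_fun measurableSet_ball (ae_of_all _ fun y hy => ?_)
  rw [indicator_of_mem (hr.2 hy)]

end WeakGradient

section Cube

variable {b : OrthonormalBasis (Fin 3) ℝ V3} {L M r : ℝ}

lemma cube_subset_closedBall : cube b L ⊆ Metric.closedBall 0 (3 * (L / 2)) := by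
  intro x hx
  rw [mem_closedBall_zero_iff, ← b.sum_repr' x]
  calc ‖∑ i, inner ℝ (b i) x • b i‖ ≤ ∑ i, ‖inner ℝ (b i) x • b i‖ := norm_sum_le _ _
    _ ≤ ∑ _i : Fin 3, L / 2 := Finset.sum_le_sum fun i _ => by
        rw [norm_smul, b.norm_eq_one, mul_one]
        exact (hx i).le
    _ = 3 * (L / 2) := by simp

lemma integrableOn_cube_of_continuous {E : Type*} [NormedAddCommGroup E] {f : V3 → E}
    (hf : Continuous f) : IntegrableOn f (cube b L) :=
  (hf.locallyIntegrable.integrableOn_isCompact (isCompact_closedBall 0 _)).mono_set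
    cube_subset_closedBall

lemma cube_subset_cube (h : M ≤ L) : cube b M ⊆ cube b L := fun x hx i =>
  (hx i).trans_le (by linarith)

lemma closedBall_subset_cube (hr : r < (L - M) / 2) {x : V3} (hx : x ∈ cube b M) :
    Metric.closedBall x r ⊆ cube b L := by
  intro y hy i
  have hyx : |inner ℝ (b i) (y - x)| ≤ r := by
    refine (abs_real_inner_le_norm _ _).trans ?_
    rw [b.norm_eq_one, one_mul, ← dist_eq_norm]
    exact hy
  calc |inner ℝ (b i) y| = |inner ℝ (b i) x + inner ℝ (b i) (y - x)| := by
        rw [inner_sub_right, add_sub_cancel]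
    _ ≤ |inner ℝ (b i) x| + |inner ℝ (b i) (y - x)| := abs_add_le _ _
    _ < L / 2 := by linarith [hx i]

lemma iUnion_cube {u : ℕ → ℝ} (hu : ∀ m, u m ≤ L) (hlim : Tendsto u atTop (𝓝 L)) :
    ⋃ m, cube b (u m) = cube b L := by
  refine Subset.antisymm (iUnion_subset fun m => cube_subset_cube (hu m)) fun x hx => ?_
  have hev : ∀ i, ∀ᶠ m in atTop, |inner ℝ (b i) x| < u m / 2 := fun i =>
    (hlim.div_const 2).eventually_const_lt (hx i)
  exact mem_iUnion.2 (eventually_all.2 hev).exists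

end Cube

namespace Problem

variable {P : Problem}

lemma isOpen_Ω (P : Problem) : IsOpen P.Ω := isOpen_cube _ _

lemma measurableSet_Ω (P : Problem) : MeasurableSet P.Ω := P.isOpen_Ω.measurableSet

instance isFiniteMeasure_restrict_Ω (P : Problem) : IsFiniteMeasure (volume.restrict P.Ω) :=
  isFiniteMeasure_restrict_cube _ _

namespace State

variable (z : P.State)

lemma integrable_e (i j : Fin 3) : Integrable (fun x => (z.e x).1 i j) (volume.restrict P.Ω) :=
  (z.e_memLp i j).integrable (by norm_num)

lemma integrable_α : IntegrableOn z.α P.Ω := z.α_memLp.integrable (by norm_num)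

lemma integrable_g : IntegrableOn z.g P.Ω := z.g_memLp.integrable (by norm_num)

lemma integrable_ddot_e (σ : M3s) :
    Integrable (fun x => ddot σ (z.e x)) (volume.restrict P.Ω) :=
  integrable_finsetSum _ fun i _ => integrable_finsetSum _ fun j _ =>
    (z.integrable_e i j).const_mul _

lemma integral_ddot_e_add (σ : M3s) :
    (∫ x in P.Ω, ddot σ (z.e x)) + ∑ i, ∑ j, σ.1 i j * z.p.comp i j P.Ω =
      ∑ i, ∑ j, σ.1 i j * z.E.comp i j P.Ω := by
  have hi : ∀ i j, Integrable (fun x => σ.1 i j * (z.e x).1 i j) (volume.restrict P.Ω) :=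
    fun i j => (z.integrable_e i j).const_mul _
  have hsum : ∫ x in P.Ω, ddot σ (z.e x) = ∑ i, ∑ j, σ.1 i j * ∫ x in P.Ω, (z.e x).1 i j := by
    unfold ddot
    rw [integral_finsetSum _ fun i _ => integrable_finsetSum _ fun j _ => hi i j]
    refine Finset.sum_congr rfl fun i _ => ?_
    rw [integral_finsetSum _ fun j _ => hi i j]
    exact Finset.sum_congr rfl fun j _ => integral_const_mul _ _
  simp only [hsum, ← Finset.sum_add_distrib]
  refine Finset.sum_congr rfl fun i _ => Finset.sum_congr rfl fun j _ => ?_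
  rw [z.decomposition i j, add_apply, withDensityᵥ_apply (z.integrable_e i j) P.measurableSet_Ω,
    Measure.restrict_restrict P.measurableSet_Ω, inter_self, mul_add]

end State

namespace WeakStanding

lemma elastic_le (hP : P.WeakStanding) (z : P.State) (κ : ℝ) :
    ENNReal.ofReal (κ * (∫ x in P.Ω, ddot P.s (z.e x)) -
        P.L ^ 3 * (κ ^ 2 * ddot (P.A.symm P.s) P.s / 2)) ≤
      ∫⁻ x in P.Ω, ENNReal.ofReal (ddot (P.A (z.e x)) (z.e x) / 2) := by
  have hFenchel : ∀ ε, κ * ddot P.s ε - κ ^ 2 * ddot (P.A.symm P.s) P.s / 2 ≤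
      ddot (P.A ε) ε / 2 := fun ε => by
    have h := ddot_sub_le_of_nonneg hP.A_symm hP.A_nonneg (κ • P.s) ε
    rwa [map_smul, ddot_smul_left, ddot_smul_left, ddot_smul_right, ← mul_assoc, ← sq] at h
  calc ENNReal.ofReal (κ * (∫ x in P.Ω, ddot P.s (z.e x)) -
        P.L ^ 3 * (κ ^ 2 * ddot (P.A.symm P.s) P.s / 2))
      = ENNReal.ofReal (∫ x in P.Ω,
          (κ * ddot P.s (z.e x) - κ ^ 2 * ddot (P.A.symm P.s) P.s / 2)) := by
        rw [integral_sub ((z.integrable_ddot_e P.s).const_mul κ) (integrable_const _),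
          integral_const_mul, integral_const, measureReal_restrict_apply_univ, Ω,
          volume_real_cube _ _ hP.L_pos.le, smul_eq_mul]
    _ ≤ _ := (ofReal_integral_le_lintegral _).trans
        (lintegral_mono fun x => ENNReal.ofReal_le_ofReal (hFenchel (z.e x)))

lemma nonlinear_le (hP : P.WeakStanding) (z : P.State) {b : ℝ} (hb : b ∈ Icc (0 : ℝ) 1)
    (hα : ∀ᵐ x ∂volume.restrict P.Ω, z.α x ∈ Icc 0 b) :
    ENNReal.ofReal (P.k b * P.σc * ∑ i, ∑ j, P.s.1 i j * z.p.comp i j P.Ω) ≤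
      ∫⁻ x in P.Ω, ENNReal.ofReal (P.k (preciseRep z.α x)) *
        supportFun P.K (z.p.density x) ∂z.p.dom := by
  have h := hP.constitutive
  rw [← z.p.setIntegral_ddot_density P.s P.measurableSet_Ω, ← integral_const_mul]
  refine (ofReal_integral_le_lintegral _).trans <|
    setLIntegral_mono' P.measurableSet_Ω fun x hx => ?_
  have hrep := preciseRep_mem_Icc (P.isOpen_Ω.mem_nhds hx) hb.1 z.integrable_α hα
  have hk : P.k b ≤ P.k (preciseRep z.α x) :=
    h.antitoneOn_k ⟨hrep.1, hrep.2.trans hb.2⟩ hb hrep.2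
  rw [mul_assoc, ENNReal.ofReal_mul (h.k_nonneg hb), ← ddot_smul_left]
  exact mul_le_mul' (ENNReal.ofReal_le_ofReal hk) (le_supportFun hP.σc_mem _)

end WeakStanding

end Problem

/-! ### Lower bound for the phase-field energy -/

section Planes

variable {b : OrthonormalBasis (Fin 3) ℝ V3} {L M ā : ℝ} {β : V3 → ℝ}

lemma integrableOn_square_of_continuous {f : ℝ × ℝ → ℝ} (hf : Continuous f) :
    IntegrableOn f (side M ×ˢ side M) :=
  (hf.locallyIntegrable.integrableOn_isCompact (isCompact_Icc.prod isCompact_Icc)).mono_set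
    (prod_mono Ioo_subset_Icc_self Ioo_subset_Icc_self)

lemma hasDerivAt_comp_frame {B : V3 → ℝ} (hB : ContDiff ℝ 1 B) (y : ℝ × ℝ) (r : ℝ) :
    HasDerivAt (fun r => B (frame b (y, r))) (fderiv ℝ B (frame b (y, r)) (b 0)) r := by
  refine (hB.differentiable one_ne_zero _).hasFDerivAt.comp_hasDerivAt r ?_
  simp only [frame_apply]
  simpa using ((hasDerivAt_id r).smul_const (b 0)).const_add (y.1 • b 1 + y.2 • b 2)

lemma continuous_frame : Continuous (frame b) := by
  simp only [funext (frame_apply b)]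
  fun_prop

lemma tendsto_setIntegral_square_mollify (hā : 0 < ā) (hβ : IntegrableOn β (cube b L))
    (hβā : ∀ᵐ x ∂volume.restrict (cube b L), β x ∈ Icc 0 ā)
    (hΓ : ∀ᵐ x ∂midPlaneArea b L, preciseRep β x = ā) (hM : 0 < M) (hML : M ≤ L) :
    Tendsto (fun m => ∫ y in side M ×ˢ side M,
      mollify (bump V3 m) ((cube b L).indicator β) (frame b (y, 0))) atTop (𝓝 (M ^ 2 * ā)) := by
  have hmeas := measurableSet_cube b L
  have hint : Integrable ((cube b L).indicator β) := hβ.integrable_indicator hmeas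
  have hmem : ∀ m x, mollify (bump V3 m) ((cube b L).indicator β) x ∈ Icc 0 ā := fun m =>
    mollify_mem_Icc _ hint (ae_indicator_mem_Icc hmeas hā.le hβā)
  have hside : side M ⊆ side L := Ioo_subset_Ioo (by linarith) (by linarith)
  have hsub : side M ×ˢ side M ⊆ side L ×ˢ side L := prod_mono hside hside
  have hΓ' : ∀ᵐ y ∂volume.restrict (side M ×ˢ side M), preciseRep β (frame b (y, 0)) = ā := by
    rw [midPlaneArea_eq_map, (measurableEmbedding_frame_plane b 0).ae_map_iff] at hΓ
    exact ae_restrict_of_ae_restrict_of_subset hsub hΓ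
  rw [← setIntegral_square_const M hM.le]
  refine tendsto_integral_of_dominated_convergence (fun _ => ā) (fun m => ?_)
    (integrableOn_square_of_continuous continuous_const) (fun m => ae_of_all _ fun y => ?_) ?_
  · exact ((contDiff_mollify _ hint.locallyIntegrable).continuous.comp
      (continuous_frame.comp (Continuous.prodMk_left 0))).aestronglyMeasurable
  · rw [Real.norm_eq_abs, abs_of_nonneg (hmem m _).1]
    exact (hmem m _).2
  · filter_upwards [hΓ', ae_restrict_mem (measurableSet_Ioo.prod measurableSet_Ioo)] with y hy hyM
    have hnhds : cube b L ∈ 𝓝 (frame b (y, 0)) := (isOpen_cube b L).mem_nhds <|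
      (frame_mem_cube b L).2 ⟨hsub hyM, by constructor <;> dsimp only <;> linarith⟩
    exact tendsto_mollify_indicator_of_preciseRep hnhds hmeas hβ (hβā.mono fun _ h => h.2)
      hā.ne' hy

end Planes

/-- The density of the first variation, divided by `2ℓ`, of the phase-field energy at the phase
field `x ↦ a (ν · x)`, in the direction of a function `β` with derivative `γ` along `ν`. -/
noncomputable def profileVariation (w : ℝ → ℝ) (ℓ ā : ℝ) (a : ℝ → ℝ) (ν : V3) (β γ : V3 → ℝ)
    (x : V3) : ℝ :=
  profileDeriv₂ w ℓ ā a (inner ℝ ν x) * β x + profileDeriv w ℓ a (inner ℝ ν x) * γ x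

namespace IsOptimalProfile

variable {w : ℝ → ℝ} {ℓ ā : ℝ} {a : ℝ → ℝ} (ha : IsOptimalProfile w ℓ ā a)
  {b : OrthonormalBasis (Fin 3) ℝ V3} {L M : ℝ}

section Integrable

include ha

variable {S : Set V3} {ν : V3} {f β γ : V3 → ℝ}

lemma integrableOn_profileDeriv_mul (hf : IntegrableOn f S) :
    IntegrableOn (fun x => profileDeriv w ℓ a (inner ℝ ν x) * f x) S :=
  hf.bdd_mul (ha.measurable_profileDeriv.comp (by fun_prop)).aestronglyMeasurable
    (ae_of_all _ fun _ => ha.abs_profileDeriv_le _)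

lemma integrableOn_profileDeriv₂_mul (hf : IntegrableOn f S) :
    IntegrableOn (fun x => profileDeriv₂ w ℓ ā a (inner ℝ ν x) * f x) S :=
  hf.bdd_mul (ha.measurable_profileDeriv₂.comp (by fun_prop)).aestronglyMeasurable
    (ae_of_all _ fun _ => ha.abs_profileDeriv₂_le _)

lemma integrableOn_profileVariation (hβ : IntegrableOn β S) (hγ : IntegrableOn γ S) :
    IntegrableOn (profileVariation w ℓ ā a ν β γ) S :=
  (ha.integrableOn_profileDeriv₂_mul hβ).add (ha.integrableOn_profileDeriv_mul hγ)

lemma setIntegral_profileVariation (hβ : IntegrableOn β S) (hγ : IntegrableOn γ S) :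
    ∫ x in S, profileVariation w ℓ ā a ν β γ x =
      (∫ x in S, profileDeriv₂ w ℓ ā a (inner ℝ ν x) * β x) +
        ∫ x in S, profileDeriv w ℓ a (inner ℝ ν x) * γ x :=
  integral_add (ha.integrableOn_profileDeriv₂_mul hβ) (ha.integrableOn_profileDeriv_mul hγ)

lemma integrableOn_profileVariation_self :
    IntegrableOn (profileVariation w ℓ ā a ν (fun x => a (inner ℝ ν x))
      fun x => profileDeriv w ℓ a (inner ℝ ν x)) (cube b L) := by
  refine ha.integrableOn_profileVariation
    (integrableOn_cube_of_continuous (ha.continuous.comp (by fun_prop))) ?_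
  simpa only [mul_one] using ha.integrableOn_profileDeriv_mul (ν := ν) (f := fun _ => 1)
    (integrable_const _)

end Integrable

section SmoothByParts

include ha

lemma setIntegral_cube_profileVariation (hM : 0 ≤ M) {B : V3 → ℝ} (hB : ContDiff ℝ 1 B) :
    ∫ x in cube b M, profileVariation w ℓ ā a (b 0) B (fun x => fderiv ℝ B x (b 0)) x =
      ∫ y in side M ×ˢ side M, (2 * profileSlope w ℓ a 0 * B (frame b (y, 0)) -
        profileSlope w ℓ a (M / 2) * (B (frame b (y, M / 2)) + B (frame b (y, -(M / 2))))) := by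
  have hD : Continuous fun x => fderiv ℝ B x (b 0) :=
    (hB.continuous_fderiv one_ne_zero).clm_apply continuous_const
  have hline : ∀ y : ℝ × ℝ, Continuous fun r : ℝ => frame b (y, r) := fun y =>
    continuous_frame.comp (Continuous.prodMk_right y)
  rw [setIntegral_cube_eq_iterated b M (ha.integrableOn_profileVariation
    (integrableOn_cube_of_continuous hB.continuous) (integrableOn_cube_of_continuous hD))]
  congr 1 with y
  rw [setIntegral_side M hM]
  simp only [profileVariation, inner_frame_zero]
  exact ha.integral_by_parts (by linarith) (hB.continuous.comp (hline y)) countable_empty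
    (fun r _ => hasDerivAt_comp_frame hB y r)
    fun _ _ => (hD.comp (hline y)).intervalIntegrable _ _

lemma le_setIntegral_cube_of_contDiff (hM : 0 ≤ M) {B : V3 → ℝ} (hB : ContDiff ℝ 1 B) {c : ℝ}
    (hc : ∀ x, B x ≤ c) :
    2 * profileSlope w ℓ a 0 * (∫ y in side M ×ˢ side M, B (frame b (y, 0))) -
        M ^ 2 * (2 * profileSlope w ℓ a (M / 2) * c) ≤
      ∫ x in cube b M, profileVariation w ℓ ā a (b 0) B (fun x => fderiv ℝ B x (b 0)) x := by
  have hplane : ∀ r : ℝ, IntegrableOn (fun y => B (frame b (y, r))) (side M ×ˢ side M) := fun r =>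
    integrableOn_square_of_continuous
      (hB.continuous.comp (continuous_frame.comp (Continuous.prodMk_left r)))
  have hconst : IntegrableOn (fun _ : ℝ × ℝ => 2 * profileSlope w ℓ a (M / 2) * c)
      (side M ×ˢ side M) := integrableOn_square_of_continuous continuous_const
  rw [ha.setIntegral_cube_profileVariation hM hB, ← integral_const_mul,
    ← setIntegral_square_const M hM, ← integral_sub ((hplane 0).const_mul _) hconst]
  refine integral_mono (((hplane 0).const_mul _).sub hconst) (((hplane 0).const_mul _).sub
    (((hplane _).add (hplane _)).const_mul _)) fun y => ?_
  have hfaces := mul_le_mul_of_nonneg_left (add_le_add (hc (frame b (y, M / 2)))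
    (hc (frame b (y, -(M / 2))))) (ha.profileSlope_nonneg (M / 2))
  dsimp only
  linarith

end SmoothByParts

section WeakByParts

variable {β : V3 → ℝ} {γ : V3 → V3}

include ha

lemma le_setIntegral_cube_mollify {ρ : ContDiffBump (0 : V3)} (hā : 0 ≤ ā)
    (hβ : IntegrableOn β (cube b L)) (hγ : IntegrableOn γ (cube b L))
    (hβγ : IsWeakGradient (cube b L) β γ)
    (hβā : ∀ᵐ x ∂volume.restrict (cube b L), β x ∈ Icc 0 ā) (hM : 0 ≤ M)
    (hρ : ρ.rOut < (L - M) / 2) :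
    2 * profileSlope w ℓ a 0 *
        (∫ y in side M ×ˢ side M, mollify ρ ((cube b L).indicator β) (frame b (y, 0))) -
        M ^ 2 * (2 * profileSlope w ℓ a (M / 2) * ā) ≤
      (∫ x in cube b M, profileDeriv₂ w ℓ ā a (inner ℝ (b 0) x) *
          mollify ρ ((cube b L).indicator β) x) +
        ∫ x in cube b M, profileDeriv w ℓ a (inner ℝ (b 0) x) *
          mollify ρ ((cube b L).indicator fun x => inner ℝ (b 0) (γ x)) x := by
  have hmeas := measurableSet_cube b L
  have hβ' := hβ.integrable_indicator hmeas
  have hB := contDiff_mollify ρ hβ'.locallyIntegrable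
  have hγn : IntegrableOn (fun x => inner ℝ (b 0) (γ x)) (cube b L) := hγ.const_inner _
  have hG := contDiff_mollify ρ (hγn.integrable_indicator hmeas).locallyIntegrable
  rw [← ha.setIntegral_profileVariation (integrableOn_cube_of_continuous hB.continuous)
    (integrableOn_cube_of_continuous hG.continuous)]
  refine (ha.le_setIntegral_cube_of_contDiff hM hB fun x =>
    (mollify_mem_Icc _ hβ' (ae_indicator_mem_Icc hmeas hā hβā) x).2).trans_eq ?_
  refine setIntegral_congr_fun (measurableSet_cube b M) fun x hx => ?_
  simp only [profileVariation, fderiv_mollify_indicator ρ hmeas hβ hγ hβγ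
    (closedBall_subset_cube hρ hx)]

lemma le_setIntegral_cube_of_lt (hā : 0 < ā) (hβ : IntegrableOn β (cube b L))
    (hγ : IntegrableOn γ (cube b L)) (hβγ : IsWeakGradient (cube b L) β γ)
    (hβā : ∀ᵐ x ∂volume.restrict (cube b L), β x ∈ Icc 0 ā)
    (hΓ : ∀ᵐ x ∂midPlaneArea b L, preciseRep β x = ā) (hM : 0 < M) (hML : M < L) :
    2 * profileSlope w ℓ a 0 * (M ^ 2 * ā) - M ^ 2 * (2 * profileSlope w ℓ a (M / 2) * ā) ≤
      ∫ x in cube b M, profileVariation w ℓ ā a (b 0) β (fun x => inner ℝ (b 0) (γ x)) x := by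
  have hmeas := measurableSet_cube b L
  have hsub : cube b M ⊆ cube b L := cube_subset_cube hML.le
  have hγn : IntegrableOn (fun x => inner ℝ (b 0) (γ x)) (cube b L) := hγ.const_inner _
  set β' := (cube b L).indicator β
  set γ' := (cube b L).indicator fun x => inner ℝ (b 0) (γ x)
  have hβ' : Integrable β' := hβ.integrable_indicator hmeas
  have hγ' : Integrable γ' := hγn.integrable_indicator hmeas
  have hone : IntegrableOn (fun _ : V3 => (1 : ℝ)) (cube b M) := integrable_const _
  have hlim₂ := tendsto_setIntegral_mul_mollify (measurableSet_cube b M)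
    (by simpa only [mul_one] using ha.integrableOn_profileDeriv₂_mul (ν := b 0) hone)
    (fun x => ha.abs_profileDeriv₂_le _) hβ'
  have hlim₁ := tendsto_setIntegral_mul_mollify (measurableSet_cube b M)
    (by simpa only [mul_one] using ha.integrableOn_profileDeriv_mul (ν := b 0) hone)
    (fun x => ha.abs_profileDeriv_le _) hγ'
  have hlimΓ := tendsto_setIntegral_square_mollify hā hβ hβā hΓ hM hML.le
  have hsmooth : ∀ᶠ m in atTop, (bump V3 m).rOut < (L - M) / 2 :=
    tendsto_bump_rOut.eventually_lt_const (by linarith)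
  have hlim := le_of_tendsto_of_tendsto ((hlimΓ.const_mul _).sub_const _) (hlim₂.add hlim₁)
    (hsmooth.mono fun m hm => ha.le_setIntegral_cube_mollify hā.le hβ hγ hβγ hβā hM.le hm)
  have hfield : ∀ x ∈ cube b M, β' x = β x ∧ γ' x = inner ℝ (b 0) (γ x) := fun x hx =>
    ⟨indicator_of_mem (hsub hx) _, indicator_of_mem (hsub hx) _⟩
  rw [← ha.setIntegral_profileVariation hβ'.integrableOn hγ'.integrableOn] at hlim
  refine hlim.trans_eq (setIntegral_congr_fun (measurableSet_cube b M) fun x hx => ?_)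
  simp only [profileVariation, hfield x hx]

lemma le_setIntegral_cube (hL0 : 0 < L) (hL : halfWidth w ℓ ā ≤ L / 2) (hā : 0 < ā)
    (hβ : IntegrableOn β (cube b L)) (hγ : IntegrableOn γ (cube b L))
    (hβγ : IsWeakGradient (cube b L) β γ)
    (hβā : ∀ᵐ x ∂volume.restrict (cube b L), β x ∈ Icc 0 ā)
    (hΓ : ∀ᵐ x ∂midPlaneArea b L, preciseRep β x = ā) :
    L ^ 2 * (2 * profileSlope w ℓ a 0 * ā) ≤
      ∫ x in cube b L, profileVariation w ℓ ā a (b 0) β (fun x => inner ℝ (b 0) (γ x)) x := by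
  obtain ⟨M, hMmono, hM, hMlim⟩ := exists_seq_strictMono_tendsto' hL0
  have hunion := iUnion_cube (b := b) (fun m => (hM m).2.le) hMlim
  have hlim := tendsto_setIntegral_of_monotone (μ := volume)
    (f := profileVariation w ℓ ā a (b 0) β fun x => inner ℝ (b 0) (γ x))
    (fun m => measurableSet_cube b (M m)) (fun _ _ h => cube_subset_cube (hMmono.monotone h))
    (by rw [hunion]; exact ha.integrableOn_profileVariation hβ (hγ.const_inner _))
  rw [hunion] at hlim
  have hface : Tendsto (fun m => profileSlope w ℓ a (M m / 2)) atTop (𝓝 0) := by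
    rw [← ha.profileSlope_eq_zero (hL.trans (le_abs_self _))]
    exact (ha.continuous_profileSlope.tendsto _).comp (hMlim.div_const 2)
  have hbound := (((hMlim.pow 2).mul_const ā).const_mul (2 * profileSlope w ℓ a 0)).sub
    ((hMlim.pow 2).mul ((hface.const_mul 2).mul_const ā))
  refine (le_of_eq ?_).trans (le_of_tendsto_of_tendsto' hbound hlim fun m =>
    ha.le_setIntegral_cube_of_lt hā hβ hγ hβγ hβā hΓ (hM m).1 (hM m).2)
  ring

lemma setIntegral_cube_profileVariation_self (hL0 : 0 ≤ L) (hL : halfWidth w ℓ ā ≤ L / 2) :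
    ∫ x in cube b L, profileVariation w ℓ ā a (b 0) (fun x => a (inner ℝ (b 0) x))
        (fun x => profileDeriv w ℓ a (inner ℝ (b 0) x)) x =
      L ^ 2 * (2 * profileSlope w ℓ a 0 * ā) := by
  unfold profileVariation
  rw [setIntegral_cube_normal b L hL0
    fun r => profileDeriv₂ w ℓ ā a r * a r + profileDeriv w ℓ a r * profileDeriv w ℓ a r,
    ha.integral_by_parts_self hL]

lemma setIntegral_cube_w_comp (hL0 : 0 ≤ L) (hL : halfWidth w ℓ ā ≤ L / 2) :
    ∫ x in cube b L, w (a (inner ℝ (b 0) x)) / ℓ = L ^ 2 * (2 * ∫ β in (0 : ℝ)..ā, √(w β)) := by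
  rw [setIntegral_cube_normal b L hL0 fun r => w (a r) / ℓ, ha.integral_w_comp hL]

end WeakByParts

end IsOptimalProfile

section PhaseField

variable {w : ℝ → ℝ} {ℓ ā L c : ℝ} {a : ℝ → ℝ} {b : OrthonormalBasis (Fin 3) ℝ V3} {β : V3 → ℝ}
  {γ : V3 → V3}

lemma IsOptimalProfile.profileVariation_sub_le (ha : IsOptimalProfile w ℓ ā a) (x : V3)
    (hβ : β x ∈ Icc (0 : ℝ) 1) :
    2 * (w (a (inner ℝ (b 0) x)) / ℓ) +
        2 * ℓ * (profileVariation w ℓ ā a (b 0) β (fun x => inner ℝ (b 0) (γ x)) x -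
          profileVariation w ℓ ā a (b 0) (fun x => a (inner ℝ (b 0) x))
            (fun x => profileDeriv w ℓ a (inner ℝ (b 0) x)) x) ≤
      w (β x) / ℓ + ℓ * ‖γ x‖ ^ 2 := by
  have hnormal : inner ℝ (b 0) (γ x) ^ 2 ≤ ‖γ x‖ ^ 2 := by
    simpa only [b.norm_eq_one, one_mul, abs_norm, sq_abs] using
      pow_le_pow_left₀ (abs_nonneg _) (abs_real_inner_le_norm (b 0) (γ x)) 2
  have hlin := ha.linearization_le (inner ℝ (b 0) x) (γ := inner ℝ (b 0) (γ x)) hβ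
  have hℓ := mul_le_mul_of_nonneg_left hnormal ha.ℓ_pos.le
  simp only [profileVariation]
  linarith

lemma IsOptimalProfile.phaseField_le (ha : IsOptimalProfile w ℓ ā a) (hL0 : 0 < L)
    (hL : halfWidth w ℓ ā ≤ L / 2) (hā : 0 < ā) (hc : 0 ≤ c) (hβ : IntegrableOn β (cube b L))
    (hγ : IntegrableOn γ (cube b L)) (hβγ : IsWeakGradient (cube b L) β γ)
    (hβā : ∀ᵐ x ∂volume.restrict (cube b L), β x ∈ Icc 0 ā)
    (hΓ : ∀ᵐ x ∂midPlaneArea b L, preciseRep β x = ā) :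
    ENNReal.ofReal (c * (4 * (L ^ 2 * ∫ y in (0 : ℝ)..ā, √(w y)))) ≤
      ∫⁻ x in cube b L, ENNReal.ofReal (c * (w (β x) / ℓ + ℓ * ‖γ x‖ ^ 2)) := by
  set W : V3 → ℝ := fun x => w (a (inner ℝ (b 0) x)) / ℓ
  set X := profileVariation w ℓ ā a (b 0) β fun x => inner ℝ (b 0) (γ x)
  set Y := profileVariation w ℓ ā a (b 0) (fun x => a (inner ℝ (b 0) x))
    fun x => profileDeriv w ℓ a (inner ℝ (b 0) x)
  have hW : IntegrableOn W (cube b L) := integrableOn_cube_of_continuous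
    ((ha.continuous_w_comp.comp (by fun_prop)).div_const _)
  have hX : IntegrableOn X (cube b L) := ha.integrableOn_profileVariation hβ (hγ.const_inner _)
  have hY : IntegrableOn Y (cube b L) := ha.integrableOn_profileVariation_self
  have hXY : IntegrableOn (fun x => X x - Y x) (cube b L) := hX.sub hY
  have hintegral : 4 * (L ^ 2 * ∫ y in (0 : ℝ)..ā, √(w y)) ≤
      ∫ x in cube b L, (2 * W x + 2 * ℓ * (X x - Y x)) := by
    have hle : 0 ≤ ∫ x in cube b L, (X x - Y x) := by
      rw [integral_sub hX hY, ha.setIntegral_cube_profileVariation_self hL0.le hL, sub_nonneg]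
      exact ha.le_setIntegral_cube hL0 hL hā hβ hγ hβγ hβā hΓ
    have hnonneg := mul_nonneg (mul_nonneg zero_le_two ha.ℓ_pos.le) hle
    rw [integral_add (hW.const_mul 2) (hXY.const_mul (2 * ℓ)), integral_const_mul,
      integral_const_mul, ha.setIntegral_cube_w_comp hL0.le hL]
    linarith
  calc ENNReal.ofReal (c * (4 * (L ^ 2 * ∫ y in (0 : ℝ)..ā, √(w y))))
      ≤ ENNReal.ofReal (∫ x in cube b L, c * (2 * W x + 2 * ℓ * (X x - Y x))) := by
        rw [integral_const_mul]
        exact ENNReal.ofReal_le_ofReal (mul_le_mul_of_nonneg_left hintegral hc)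
    _ ≤ ∫⁻ x in cube b L, ENNReal.ofReal (c * (2 * W x + 2 * ℓ * (X x - Y x))) :=
        ofReal_integral_le_lintegral _
    _ ≤ _ := lintegral_mono_ae (hβā.mono fun x hx => ENNReal.ofReal_le_ofReal
        (mul_le_mul_of_nonneg_left
          (ha.profileVariation_sub_le x (Icc_subset_Icc_right ha.max_mem.2 hx)) hc))

lemma IsOptimalProfile.phaseField_eq (ha : IsOptimalProfile w ℓ ā a) (hL0 : 0 ≤ L)
    (hL : halfWidth w ℓ ā ≤ L / 2) (hc : 0 ≤ c) :
    ∫⁻ x in cube b L, ENNReal.ofReal (c * (w (a (inner ℝ (b 0) x)) / ℓ +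
        ℓ * ‖profileDeriv w ℓ a (inner ℝ (b 0) x) • b 0‖ ^ 2)) =
      ENNReal.ofReal (c * (4 * (L ^ 2 * ∫ y in (0 : ℝ)..ā, √(w y)))) := by
  have hequi : ∀ x, c * (w (a (inner ℝ (b 0) x)) / ℓ +
      ℓ * ‖profileDeriv w ℓ a (inner ℝ (b 0) x) • b 0‖ ^ 2) =
        c * 2 * (w (a (inner ℝ (b 0) x)) / ℓ) := fun x => by
    rw [norm_smul, b.norm_eq_one, mul_one, Real.norm_eq_abs, sq_abs, ha.mul_profileDeriv_sq]
    ring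
  simp only [hequi]
  rw [← ofReal_integral_eq_lintegral_ofReal, integral_const_mul,
    ha.setIntegral_cube_w_comp hL0 hL]
  · congr 1
    ring
  · exact (integrableOn_cube_of_continuous
      ((ha.continuous_w_comp.comp (by fun_prop)).div_const _)).const_mul _
  · exact ae_of_all _ fun x => mul_nonneg (mul_nonneg hc zero_le_two)
      (div_nonneg (ha.dissipation.nonneg (ha.mem_unit _)) ha.ℓ_pos.le)

end PhaseField

namespace Problem

variable {P : Problem}

lemma WeakStanding.energy_const_nonneg (hP : P.WeakStanding) : 0 ≤ P.Gc / (4 * cW P.w) :=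
  div_nonneg hP.Gc_pos.le (mul_nonneg zero_le_four hP.constitutive.isDissipation.cW_pos.le)

lemma WeakStanding.phaseField_le (hP : P.WeakStanding)
    (hw : IntervalIntegrable (fun a => 1 / √(P.w a)) volume 0 1)
    (hL : 2 * P.ℓ * cStar P.w ≤ P.L) (z : P.State) {b : ℝ} (hb : b ∈ Icc (0 : ℝ) 1)
    (hα : ∀ᵐ x ∂volume.restrict P.Ω, z.α x ∈ Icc 0 b)
    (hΓ : ∀ᵐ x ∂midPlaneArea P.b P.L, preciseRep z.α x = b) :
    ENNReal.ofReal (P.Gc * P.L ^ 2 / cW P.w * ∫ a in (0 : ℝ)..b, √(P.w a)) ≤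
      ∫⁻ x in P.Ω, ENNReal.ofReal
        (P.Gc / (4 * cW P.w) * (P.w (z.α x) / P.ℓ + P.ℓ * ‖z.g x‖ ^ 2)) := by
  rcases hb.1.eq_or_lt with rfl | hb0
  · simp
  obtain ⟨a, ha⟩ := exists_isOptimalProfile hP.constitutive.isDissipation hw hP.ℓ_pos hb
  refine (ENNReal.ofReal_le_ofReal (le_of_eq ?_)).trans
    (ha.phaseField_le hP.L_pos (hP.halfWidth_le hw hL hb) hb0 hP.energy_const_nonneg z.integrable_α
      z.integrable_g z.gradient hα hΓ)
  have hcW := hP.constitutive.isDissipation.cW_pos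
  field_simp

lemma WeakStanding.redEnergy_le_energy (hP : P.WeakStanding)
    (hw : IntervalIntegrable (fun a => 1 / √(P.w a)) volume 0 1)
    (hL : 2 * P.ℓ * cStar P.w ≤ P.L) (z : P.State) {t b : ℝ} (hb : b ∈ Icc (0 : ℝ) 1)
    (ht : P.HasAverageStrain t z) (hα : ∀ᵐ x ∂volume.restrict P.Ω, z.α x ∈ Icc 0 b)
    (hΓ : ∀ᵐ x ∂midPlaneArea P.b P.L, preciseRep z.α x = b) :
    ENNReal.ofReal (P.redEnergy t b) ≤ P.energy z := by
  have hstrain : ∑ i, ∑ j, P.s.1 i j * z.E.comp i j P.Ω = P.L ^ 3 * t := by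
    rw [← ht, one_div, mul_inv_cancel_left₀ (pow_pos hP.L_pos 3).ne']
  have hsplit := z.integral_ddot_e_add P.s
  refine le_trans ?_ (add_le_add (add_le_add (hP.elastic_le z (P.k b * P.σc))
    (hP.nonlinear_le z hb hα)) (hP.phaseField_le hw hL z hb hα hΓ))
  refine (ENNReal.ofReal_le_ofReal (le_of_eq ?_)).trans
    (ENNReal.ofReal_add_le.trans (add_le_add ENNReal.ofReal_add_le le_rfl))
  rw [hstrain] at hsplit
  rw [redEnergy, P.epsE_eq]
  linear_combination -P.k b * P.σc * hsplit

end Problem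

/-! ### The localized response -/

namespace TensorMeasure

/-- The tensor-valued measure with constant density `ν` with respect to `μ`. -/
noncomputable def withConstDensity (μ : Measure V3) (ν : M3s) : TensorMeasure where
  comp i j := μ.withDensityᵥ fun _ => ν.1 i j
  symm i j := by rw [ν.2.apply i j]

variable {μ : Measure V3} [IsFiniteMeasure μ] {ν : M3s}

lemma withConstDensity_apply {i j : Fin 3} {S : Set V3} (hS : MeasurableSet S) :
    (withConstDensity μ ν).comp i j S = μ.real S * ν.1 i j := by
  simp only [withConstDensity]
  rw [withDensityᵥ_apply (integrable_const _) hS, setIntegral_const, smul_eq_mul]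

lemma withConstDensity_restrict {Ω : Set V3} (hΩ : MeasurableSet Ω) (hμ : μ.restrict Ω = μ)
    (i j : Fin 3) :
    ((withConstDensity μ ν).comp i j).restrict Ω = (withConstDensity μ ν).comp i j := by
  ext S hS
  rw [VectorMeasure.restrict_apply _ hΩ hS, withConstDensity_apply (hS.inter hΩ),
    withConstDensity_apply hS, ← measureReal_restrict_apply hS, hμ]

lemma withConstDensity_dom :
    (withConstDensity μ ν).dom = ENNReal.ofReal (∑ i, ∑ j, |ν.1 i j|) • μ := by
  have hvariation : ∀ i j, ((withConstDensity μ ν).comp i j).totalVariation =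
      ENNReal.ofReal |ν.1 i j| • μ := fun i j => by
    rw [SignedMeasure.totalVariation_eq_variation]
    simp only [withConstDensity]
    rw [Measure.variation_withDensityᵥ (integrable_const _), withDensity_const,
      Real.enorm_eq_ofReal_abs]
  simp only [dom, hvariation, ← Finset.sum_smul]
  congr 1
  refine Eq.symm <| (ENNReal.ofReal_sum_of_nonneg fun i _ => Finset.sum_nonneg fun j _ =>
    abs_nonneg _).trans (Finset.sum_congr rfl fun i _ =>
      ENNReal.ofReal_sum_of_nonneg fun j _ => abs_nonneg _)

lemma sum_abs_pos (hν : ν ≠ 0) : 0 < ∑ i, ∑ j, |ν.1 i j| := by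
  have hsum : ∀ i, 0 ≤ ∑ j, |ν.1 i j| := fun i => Finset.sum_nonneg fun j _ => abs_nonneg _
  refine (Finset.sum_nonneg fun i _ => hsum i).lt_of_ne fun h => hν ?_
  ext i j
  have hrow := (Finset.sum_eq_zero_iff_of_nonneg fun i _ => hsum i).1 h.symm i (Finset.mem_univ i)
  exact abs_eq_zero.1 <|
    (Finset.sum_eq_zero_iff_of_nonneg fun j _ => abs_nonneg _).1 hrow j (Finset.mem_univ j)

lemma withConstDensity_density (hν : ν ≠ 0) : ∀ᵐ x ∂(withConstDensity μ ν).dom,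
    (withConstDensity μ ν).density x = (∑ i, ∑ j, |ν.1 i j|)⁻¹ • ν := by
  have hpos := sum_abs_pos hν
  have hcomp : ∀ i j, ∀ᵐ x ∂(withConstDensity μ ν).dom,
      ((withConstDensity μ ν).comp i j).rnDeriv (withConstDensity μ ν).dom x =
        (∑ i, ∑ j, |ν.1 i j|)⁻¹ * ν.1 i j := fun i j => by
    refine (SignedMeasure.integrable_rnDeriv _ _).ae_eq_of_withDensityᵥ_eq (integrable_const _) ?_
    ext S hS
    rw [withDensityᵥ_density, withConstDensity_apply hS,
      withDensityᵥ_apply (integrable_const _) hS, setIntegral_const, withConstDensity_dom,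
      measureReal_ennreal_smul_apply, ENNReal.toReal_ofReal hpos.le, smul_eq_mul]
    field_simp
  filter_upwards [ae_all_iff.2 fun i => ae_all_iff.2 fun j => hcomp i j] with x hx
  ext i j
  exact hx i j

lemma setLIntegral_mul_supportFun_density (K : Set M3s) (hν : ν ≠ 0) (f : V3 → ℝ≥0∞)
    (S : Set V3) :
    ∫⁻ x in S, f x * supportFun K ((withConstDensity μ ν).density x)
        ∂(withConstDensity μ ν).dom =
      ∫⁻ x in S, f x * supportFun K ν ∂μ := by
  have hpos := sum_abs_pos hν
  have hscale : ∀ x, f x * supportFun K ν = ENNReal.ofReal (∑ i, ∑ j, |ν.1 i j|) *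
      (f x * supportFun K ((∑ i, ∑ j, |ν.1 i j|)⁻¹ • ν)) := fun x => by
    rw [supportFun_smul K (inv_nonneg.2 hpos.le), mul_left_comm, ← mul_assoc (ENNReal.ofReal _),
      ← ENNReal.ofReal_mul hpos.le, mul_inv_cancel₀ hpos.ne', ENNReal.ofReal_one, one_mul]
  rw [lintegral_congr hscale, lintegral_const_mul' _ _ ENNReal.ofReal_ne_top, ← smul_eq_mul,
    ← lintegral_smul_measure, ← Measure.restrict_smul, ← withConstDensity_dom]
  refine lintegral_congr_ae ?_
  filter_upwards [ae_restrict_of_ae (withConstDensity_density hν)] with x hx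
  rw [hx]

end TensorMeasure

section Test

variable {Ω : Set V3} {φ : V3 → ℝ}

lemma IsTest.integral_withDensityᵥ_add (hφ : IsTest Ω φ) {ρ μ : Measure V3} [IsFiniteMeasure μ]
    {e : V3 → ℝ} (he : Integrable e ρ) (ν : M3s) (i j : Fin 3) :
    VectorMeasure.integral (ρ.withDensityᵥ e + (TensorMeasure.withConstDensity μ ν).comp i j) φ
        (ContinuousLinearMap.lsmul ℝ ℝ) =
      (∫ x, e x * φ x ∂ρ) + ν.1 i j * ∫ x, φ x ∂μ := by
  obtain ⟨C, hC⟩ := hφ.2.1.exists_bound_of_continuous hφ.continuous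
  have hmeas := hφ.continuous.stronglyMeasurable
  have hconst : Integrable (fun _ => ν.1 i j) μ := integrable_const _
  refine (VectorMeasure.integral_add_vectorMeasure (integrable_withDensityᵥ he hmeas hC)
    (integrable_withDensityᵥ hconst hmeas hC)).trans (congrArg₂ _
      (integral_withDensityᵥ he hmeas hC) ?_)
  exact (integral_withDensityᵥ hconst hmeas hC).trans (integral_const_mul _ _)

lemma IsTest.setIntegral_continuousLinearMap_mul_fderiv (hφ : IsTest Ω φ) (f : V3 →L[ℝ] ℝ)
    (v : V3) : ∫ x in Ω, f x * fderiv ℝ φ x v = -(f v * ∫ x in Ω, φ x) := by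
  rw [← integral_const_mul]
  exact hφ.integral_mul_fderiv f.lipschitz
    (ae_of_all _ fun x => f.hasFDerivAt.hasLineDerivAt v)

lemma IsTest.setIntegral_indicator_halfSpace_mul_fderiv {b : OrthonormalBasis (Fin 3) ℝ V3} {L : ℝ}
    (hφ : IsTest (cube b L) φ) (c : ℝ) (v : V3) :
    ∫ x in cube b L, {x | 0 < inner ℝ (b 0) x}.indicator (fun _ => c) x * fderiv ℝ φ x v =
      -(c * inner ℝ (b 0) v * ∫ x, φ x ∂midPlaneArea b L) := by
  have hmul : ∀ x, {x | 0 < inner ℝ (b 0) x}.indicator (fun _ => c) x * fderiv ℝ φ x v =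
      {x | 0 < inner ℝ (b 0) x}.indicator (fun x => c * fderiv ℝ φ x v) x := fun x =>
    (indicator_mul_left _ (fun _ => c) fun x => fderiv ℝ φ x v).symm
  rw [hφ.setIntegral_mul_fderiv, integral_congr_ae (ae_of_all _ hmul),
    integral_indicator (measurableSet_halfSpace _), integral_const_mul,
    hφ.setIntegral_halfSpace_fderiv]
  ring

lemma IsWeakGradient.ae_eq {β β' : V3 → ℝ} {γ γ' : V3 → V3} (hΩ : IsOpen Ω)
    (h : IsWeakGradient Ω β γ) (h' : IsWeakGradient Ω β' γ') (hβ : β =ᵐ[volume.restrict Ω] β')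
    (hγ : IntegrableOn γ Ω) (hγ' : IntegrableOn γ' Ω) : γ =ᵐ[volume.restrict Ω] γ' := by
  have hcomp : ∀ i, ∀ᵐ x ∂volume.restrict Ω, γ x i = γ' x i := fun i => by
    refine ae_eq_of_forall_isTest hΩ ((EuclideanSpace.proj (𝕜 := ℝ) i).integrable_comp hγ)
      ((EuclideanSpace.proj (𝕜 := ℝ) i).integrable_comp hγ') fun φ hφ => neg_inj.1 ?_
    refine (h φ hφ i).symm.trans ((integral_congr_ae (hβ.mono fun x hx => ?_)).trans (h' φ hφ i))
    simp only [hx]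
  filter_upwards [ae_all_iff.2 hcomp] with x hx
  ext i
  exact hx i

lemma IsOptimalProfile.isWeakGradient {w : ℝ → ℝ} {ℓ ā : ℝ} {a : ℝ → ℝ}
    (ha : IsOptimalProfile w ℓ ā a) {ν : V3} (hν : ν ≠ 0) :
    IsWeakGradient Ω (fun x => a (inner ℝ ν x))
      (fun x => profileDeriv w ℓ a (inner ℝ ν x) • ν) := by
  intro φ hφ i
  refine hφ.integral_mul_fderiv (ha.lipschitzWith.comp (innerSL ℝ ν).lipschitz) ?_
  filter_upwards [ae_inner_ne volume hν 0, ae_inner_ne volume hν (halfWidth w ℓ ā),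
    ae_inner_ne volume hν (-halfWidth w ℓ ā)] with x h0 hright hleft
  have habs : |inner ℝ ν x| ≠ halfWidth w ℓ ā := fun h =>
    (eq_or_eq_neg_of_abs_eq h).elim hright hleft
  have hchain := ((ha.hasDerivAt h0 habs).comp_hasFDerivAt x
    (innerSL ℝ ν).hasFDerivAt).hasLineDerivAt (EuclideanSpace.single i (1 : ℝ))
  simpa [EuclideanSpace.inner_single_right] using! hchain

end Test

namespace Problem

variable {P : Problem} {t ā : ℝ} {a : ℝ → ℝ}

/-- The uniform elastic strain `k(ā) σc A⁻¹ s` of the localized response. -/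
noncomputable def locElastic (P : Problem) (ā : ℝ) : M3s := (P.k ā * P.σc) • P.A.symm P.s

lemma ddot_s_locElastic (P : Problem) (ā : ℝ) : ddot P.s (P.locElastic ā) = P.k ā * P.epsE := by
  rw [locElastic, ddot_smul_right, ddot_comm, P.epsE_eq, mul_assoc]

lemma ddot_A_locElastic (P : Problem) (ā : ℝ) :
    ddot (P.A (P.locElastic ā)) (P.locElastic ā) = P.k ā ^ 2 * P.σc * P.epsE := by
  have hstress : P.A (P.locElastic ā) = (P.k ā * P.σc) • P.s := by
    rw [locElastic, map_smul, LinearEquiv.apply_symm_apply]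
  rw [hstress, ddot_smul_left, ddot_s_locElastic]
  ring

lemma locPlastic_eq (P : Problem) (t ā : ℝ) :
    P.locPlastic t ā =
      .withConstDensity (midPlaneArea P.b P.L) (P.jump t ā • symProd P.n P.d₀) := rfl

/-- The strain measure of the localized response. -/
noncomputable def locStrain (P : Problem) (t ā : ℝ) : TensorMeasure where
  comp i j := (volume.restrict P.Ω).withDensityᵥ (fun _ => (P.locElastic ā).1 i j) +
    (P.locPlastic t ā).comp i j
  symm i j := by rw [(P.locPlastic t ā).symm i j, (P.locElastic ā).2.apply i j]

section Displacement

lemma locDisp_apply (P : Problem) (t ā : ℝ) (x : V3) (i : Fin 3) :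
    P.locDisp t ā x i = innerSL ℝ (WithLp.toLp 2 ((P.locElastic ā).1 i)) x +
      {x | 0 < inner ℝ P.n x}.indicator (fun _ => P.jump t ā * P.d₀ i) x := by
  have hlinear : innerSL ℝ (WithLp.toLp 2 ((P.locElastic ā).1 i)) x =
      (P.k ā * P.σc) * (P.A.symm P.s).1.mulVec (WithLp.ofLp x) i := by
    simp only [innerSL_apply_apply, PiLp.inner_apply, locElastic, Matrix.mulVec, dotProduct,
      Submodule.coe_smul, Matrix.smul_apply, Finset.mul_sum, RCLike.inner_apply, conj_trivial,
      smul_eq_mul]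
    exact Finset.sum_congr rfl fun k _ => by ring
  rw [hlinear]
  simp only [locDisp, indicator_apply, mem_ofPred_eq]
  split_ifs <;> simp

lemma integrableOn_locDisp (P : Problem) (t ā : ℝ) : IntegrableOn (P.locDisp t ā) P.Ω := by
  refine IntegrableOn.add (integrableOn_cube_of_continuous ?_) ?_
  · have hmulVec : Continuous fun x : V3 => (P.A.symm P.s).1.mulVec (WithLp.ofLp x) :=
      Continuous.matrix_mulVec continuous_const (PiLp.continuous_ofLp 2 _)
    exact (PiLp.continuous_toLp 2 _).comp (hmulVec.const_smul (P.k ā * P.σc))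
  · have hjump : IntegrableOn ({x | 0 < inner ℝ P.n x}.indicator fun _ => P.jump t ā) P.Ω :=
      (integrable_const _).indicator (measurableSet_halfSpace _)
    exact hjump.smul_const _

variable {φ : V3 → ℝ}

lemma setIntegral_locDisp_mul_fderiv (t ā : ℝ) (hφ : IsTest P.Ω φ) (i : Fin 3) (v : V3) :
    ∫ x in P.Ω, P.locDisp t ā x i * fderiv ℝ φ x v =
      -(inner ℝ (WithLp.toLp 2 ((P.locElastic ā).1 i)) v * ∫ x in P.Ω, φ x) -
        P.jump t ā * P.d₀ i * inner ℝ P.n v * ∫ x, φ x ∂midPlaneArea P.b P.L := by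
  have hlinear : IntegrableOn (innerSL ℝ (WithLp.toLp 2 ((P.locElastic ā).1 i))) P.Ω :=
    integrableOn_cube_of_continuous (ContinuousLinearMap.continuous _)
  have hjump : IntegrableOn ({x | 0 < inner ℝ P.n x}.indicator fun _ => P.jump t ā * P.d₀ i)
      P.Ω := (integrable_const _).indicator (measurableSet_halfSpace _)
  simp only [locDisp_apply, add_mul]
  rw [integral_add (hφ.integrableOn_mul_fderiv hlinear v) (hφ.integrableOn_mul_fderiv hjump v),
    hφ.setIntegral_continuousLinearMap_mul_fderiv, innerSL_apply_apply, sub_eq_add_neg]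
  exact congrArg _ (IsTest.setIntegral_indicator_halfSpace_mul_fderiv hφ _ v)

lemma integral_locStrain (t ā : ℝ) (hφ : IsTest P.Ω φ) (i j : Fin 3) :
    ((P.locStrain t ā).comp i j).integral φ (ContinuousLinearMap.lsmul ℝ ℝ) =
      (∫ x in P.Ω, (P.locElastic ā).1 i j * φ x) +
        (P.jump t ā • symProd P.n P.d₀).1 i j * ∫ x, φ x ∂midPlaneArea P.b P.L :=
  hφ.integral_withDensityᵥ_add (ρ := volume.restrict P.Ω) (μ := midPlaneArea P.b P.L)
    (integrable_const _) (P.jump t ā • symProd P.n P.d₀) i j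

lemma isStrain_locDisp (P : Problem) (t ā : ℝ) :
    IsStrain P.Ω (P.locDisp t ā) (P.locStrain t ā) := by
  intro φ hφ i j
  have hint : ∀ i j, IntegrableOn (fun x => P.locDisp t ā x i * partialD j φ x) P.Ω := fun i j =>
    hφ.integrableOn_mul_fderiv
      ((EuclideanSpace.proj (𝕜 := ℝ) i).integrable_comp (P.integrableOn_locDisp t ā)) _
  have hvalue : ∀ i j, ∫ x in P.Ω, P.locDisp t ā x i * partialD j φ x =
      -((P.locElastic ā).1 i j * ∫ x in P.Ω, φ x) -
        P.jump t ā * P.d₀ i * P.n j * ∫ x, φ x ∂midPlaneArea P.b P.L := fun i j => by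
    simpa [EuclideanSpace.inner_single_right] using!
      setIntegral_locDisp_mul_fderiv t ā hφ i (EuclideanSpace.single j (1 : ℝ))
  have hsymm : (P.locElastic ā).1 j i = (P.locElastic ā).1 i j := (P.locElastic ā).2.apply i j
  rw [integral_locStrain t ā hφ i j, integral_div, integral_add (hint i j) (hint j i),
    hvalue, hvalue, integral_const_mul, hsymm]
  simp only [symProd, Submodule.coe_smul, Matrix.smul_apply, Matrix.of_apply, smul_eq_mul]
  ring

end Displacement

/-- The localized response, with phase field `x ↦ a (x · n)`. -/
noncomputable def locState (hL : 0 < P.L) (ha : IsOptimalProfile P.w P.ℓ ā a) (t : ℝ) :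
    P.State where
  u := P.locDisp t ā
  p := P.locPlastic t ā
  α x := a (inner ℝ P.n x)
  E := P.locStrain t ā
  e _ := P.locElastic ā
  g x := profileDeriv P.w P.ℓ a (inner ℝ P.n x) • P.n
  u_integrable := P.integrableOn_locDisp t ā
  strain := P.isStrain_locDisp t ā
  p_carried := TensorMeasure.withConstDensity_restrict (ν := P.jump t ā • symProd P.n P.d₀)
    P.measurableSet_Ω (midPlaneArea_restrict_cube P.b P.L hL)
  e_memLp _ _ := memLp_const _
  decomposition _ _ := rfl
  α_memLp := MemLp.of_bound (ha.continuous.comp (by fun_prop)).aestronglyMeasurable 1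
    (ae_of_all _ fun x => abs_le.2 ⟨by linarith [(ha.mem_unit (inner ℝ P.n x)).1],
      (ha.mem_unit _).2⟩)
  g_memLp := MemLp.of_bound ((ha.measurable_profileDeriv.comp
      (by fun_prop)).smul_const _).aestronglyMeasurable (√(P.w 1) / P.ℓ)
    (ae_of_all _ fun x => by
      rw [norm_smul, n, P.b.norm_eq_one, mul_one]
      exact ha.abs_profileDeriv_le _)
  gradient := ha.isWeakGradient (P.b.orthonormal.ne_zero 0)

lemma WeakStanding.exists_isLocalizedResponse (hP : P.WeakStanding)
    (hw : IntervalIntegrable (fun a => 1 / √(P.w a)) volume 0 1) (ht : P.epsE < t) :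
    ∃ z : P.State, P.IsLocalizedResponse t z := by
  obtain ⟨ā, hā⟩ := hP.exists_isMaxDamage ht
  obtain ⟨a, ha⟩ := exists_isOptimalProfile hP.constitutive.isDissipation hw hP.ℓ_pos
    (Ioc_subset_Icc_self hā.mem_Ioc)
  exact ⟨locState hP.L_pos ha t, ā, a, hā, ha.isProfile, ae_eq_rfl, rfl, ae_eq_rfl⟩

namespace State

variable {z : P.State}

lemma e_ae_eq_locElastic (hu : z.u =ᵐ[volume.restrict P.Ω] P.locDisp t ā)
    (hp : z.p = P.locPlastic t ā) : ∀ᵐ x ∂volume.restrict P.Ω, z.e x = P.locElastic ā := by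
  have hcomp : ∀ i j, ∀ᵐ x ∂volume.restrict P.Ω, (z.e x).1 i j = (P.locElastic ā).1 i j := by
    refine fun i j => ae_eq_of_forall_isTest P.isOpen_Ω (z.integrable_e i j) (integrable_const _)
      fun φ hφ => ?_
    have hstrain : (z.E.comp i j).integral φ (ContinuousLinearMap.lsmul ℝ ℝ) =
        ((P.locStrain t ā).comp i j).integral φ (ContinuousLinearMap.lsmul ℝ ℝ) := by
      rw [z.strain φ hφ i j, P.isStrain_locDisp t ā φ hφ i j]
      exact congrArg Neg.neg (integral_congr_ae (hu.mono fun x hx => by simp only [hx]))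
    have he : (z.E.comp i j).integral φ (ContinuousLinearMap.lsmul ℝ ℝ) =
        (∫ x in P.Ω, (z.e x).1 i j * φ x) +
          (P.jump t ā • symProd P.n P.d₀).1 i j * ∫ x, φ x ∂midPlaneArea P.b P.L := by
      rw [z.decomposition i j, hp, locPlastic_eq]
      exact hφ.integral_withDensityᵥ_add (z.integrable_e i j) _ i j
    rw [he, integral_locStrain t ā hφ i j] at hstrain
    exact add_right_cancel hstrain
  filter_upwards [ae_all_iff.2 fun i => ae_all_iff.2 fun j => hcomp i j] with x hx
  ext i j
  exact hx i j

lemma preciseRep_ae_eq (hL : 0 < P.L) (ha : IsOptimalProfile P.w P.ℓ ā a)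
    (hα : z.α =ᵐ[volume.restrict P.Ω] fun x => a (inner ℝ P.n x)) :
    ∀ᵐ x ∂midPlaneArea P.b P.L, preciseRep z.α x = ā := by
  filter_upwards [ae_midPlaneArea P.b P.L hL] with x hx
  have hcont : Continuous fun x : V3 => a (inner ℝ P.n x) := ha.continuous.comp (by fun_prop)
  rw [preciseRep_eq_of_tendsto (tendsto_average_ball_of_ae_eq_continuousAt
    (P.isOpen_Ω.mem_nhds hx.1) z.integrable_α hα hcont.continuousAt), n, hx.2, ha.apply_zero]

end State

namespace WeakStanding

variable (hP : P.WeakStanding) {z : P.State}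

include hP

lemma jump_mul_traction (t ā : ℝ) :
    P.jump t ā * traction P.s P.n P.d₀ = P.L * (t - P.k ā * P.epsE) :=
  div_mul_cancel₀ _ hP.traction_pos.ne'

lemma jump_pos (ht : P.epsE < t) (hā : ā ∈ Icc (0 : ℝ) 1) : 0 < P.jump t ā := by
  have := mul_le_of_le_one_left hP.epsE_pos.le (hP.constitutive.k_le_one hā)
  exact div_pos (mul_pos hP.L_pos (by linarith)) hP.traction_pos

lemma hasAverageStrain (hu : z.u =ᵐ[volume.restrict P.Ω] P.locDisp t ā)
    (hp : z.p = P.locPlastic t ā) : P.HasAverageStrain t z := by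
  have helastic : ∫ x in P.Ω, ddot P.s (z.e x) = P.L ^ 3 * (P.k ā * P.epsE) := by
    rw [integral_congr_ae (g := fun _ => P.k ā * P.epsE) ((z.e_ae_eq_locElastic hu hp).mono
      fun x hx => by rw [hx, ddot_s_locElastic]), setIntegral_const, Ω,
      volume_real_cube _ _ hP.L_pos.le, smul_eq_mul]
  have hplastic : ∑ i, ∑ j, P.s.1 i j * z.p.comp i j P.Ω =
      (midPlaneArea P.b P.L).real P.Ω * (P.L * (t - P.k ā * P.epsE)) := by
    rw [← hP.jump_mul_traction, ← ddot_symProd, ← ddot_smul_right, hp, locPlastic_eq]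
    simp only [TensorMeasure.withConstDensity_apply P.measurableSet_Ω, ddot, Finset.mul_sum,
      mul_left_comm]
  have harea : (midPlaneArea P.b P.L).real P.Ω = P.L ^ 2 := by
    rw [← measureReal_restrict_apply_univ, Ω, midPlaneArea_restrict_cube _ _ hP.L_pos,
      Measure.real, midPlaneArea_univ, ENNReal.toReal_pow, ENNReal.toReal_ofReal hP.L_pos.le]
  rw [HasAverageStrain, ← z.integral_ddot_e_add, helastic, hplastic, harea]
  field_simp [hP.L_pos.ne']
  ring

lemma elastic_eq (hu : z.u =ᵐ[volume.restrict P.Ω] P.locDisp t ā)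
    (hp : z.p = P.locPlastic t ā) :
    ∫⁻ x in P.Ω, ENNReal.ofReal (ddot (P.A (z.e x)) (z.e x) / 2) =
      ENNReal.ofReal (P.L ^ 3 * (P.k ā ^ 2 * P.σc * P.epsE / 2)) := by
  rw [lintegral_congr_ae (g := fun _ => ENNReal.ofReal (P.k ā ^ 2 * P.σc * P.epsE / 2))
    ((z.e_ae_eq_locElastic hu hp).mono fun x hx => by rw [hx, ddot_A_locElastic]),
    lintegral_const, Measure.restrict_apply_univ, Ω, volume_cube,
    ENNReal.ofReal_mul (pow_nonneg hP.L_pos.le 3), ENNReal.ofReal_pow hP.L_pos.le, mul_comm]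

lemma nonlinear_eq (ht : P.epsE < t) (hā : ā ∈ Icc (0 : ℝ) 1) {β : V3 → ℝ}
    (hβ : ∀ᵐ x ∂midPlaneArea P.b P.L, preciseRep β x = ā) :
    ∫⁻ x in P.Ω, ENNReal.ofReal (P.k (preciseRep β x)) *
        supportFun P.K ((P.locPlastic t ā).density x) ∂(P.locPlastic t ā).dom =
      ENNReal.ofReal (P.L ^ 3 * (P.k ā * P.σc * (t - P.k ā * P.epsE))) := by
  have hJ := hP.jump_pos ht hā
  have hk := hP.constitutive.k_nonneg hā
  have hν : P.jump t ā • symProd P.n P.d₀ ≠ 0 :=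
    smul_ne_zero hJ.ne' (symProd_ne_zero (P.b.orthonormal.ne_zero 0) hP.d₀_ne_zero)
  have hsupport : supportFun P.K (P.jump t ā • symProd P.n P.d₀) =
      ENNReal.ofReal (P.σc * (P.L * (t - P.k ā * P.epsE))) := by
    rw [supportFun_smul _ hJ.le, supportFun_of_mem_normalCone hP.σc_mem hP.normal,
      ← ENNReal.ofReal_mul hJ.le, ddot_smul_left, ddot_symProd, mul_left_comm,
      hP.jump_mul_traction]
  rw [locPlastic_eq, TensorMeasure.setLIntegral_mul_supportFun_density _ hν, Ω,
    midPlaneArea_restrict_cube _ _ hP.L_pos, hsupport,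
    lintegral_congr_ae (hβ.mono fun x hx => by simp only [hx]; rfl), lintegral_const,
    midPlaneArea_univ, ← ENNReal.ofReal_mul hk, ← ENNReal.ofReal_pow hP.L_pos.le,
    ← ENNReal.ofReal_mul' (pow_nonneg hP.L_pos.le 2)]
  congr 1
  ring

lemma phaseField_eq (hL : halfWidth P.w P.ℓ ā ≤ P.L / 2) (ha : IsOptimalProfile P.w P.ℓ ā a)
    (hα : z.α =ᵐ[volume.restrict P.Ω] fun x => a (inner ℝ P.n x)) :
    ∫⁻ x in P.Ω, ENNReal.ofReal
        (P.Gc / (4 * cW P.w) * (P.w (z.α x) / P.ℓ + P.ℓ * ‖z.g x‖ ^ 2)) =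
      ENNReal.ofReal (P.Gc * P.L ^ 2 / cW P.w * ∫ a in (0 : ℝ)..ā, √(P.w a)) := by
  have hcW := hP.constitutive.isDissipation.cW_pos
  let z₀ := locState hP.L_pos ha 0
  have hg : z.g =ᵐ[volume.restrict P.Ω] z₀.g :=
    z.gradient.ae_eq P.isOpen_Ω z₀.gradient hα z.integrable_g z₀.integrable_g
  refine (lintegral_congr_ae ?_).trans ((ha.phaseField_eq (b := P.b) hP.L_pos.le hL
    hP.energy_const_nonneg).trans (congrArg _ ?_))
  · filter_upwards [hα, hg] with x hx hgx
    rw [hx, hgx]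
    rfl
  · field_simp

lemma energy_eq (hL : halfWidth P.w P.ℓ ā ≤ P.L / 2) (ht : P.epsE < t)
    (ha : IsOptimalProfile P.w P.ℓ ā a)
    (hu : z.u =ᵐ[volume.restrict P.Ω] P.locDisp t ā) (hp : z.p = P.locPlastic t ā)
    (hα : z.α =ᵐ[volume.restrict P.Ω] fun x => a (inner ℝ P.n x)) :
    P.energy z = ENNReal.ofReal (P.redEnergy t ā) := by
  have hk := hP.constitutive.k_nonneg ha.max_mem
  have hL3 := pow_pos hP.L_pos 3
  have hjump : 0 ≤ t - P.k ā * P.epsE := by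
    have := mul_le_of_le_one_left hP.epsE_pos.le (hP.constitutive.k_le_one ha.max_mem)
    linarith
  have hint : 0 ≤ ∫ a in (0 : ℝ)..ā, √(P.w a) :=
    intervalIntegral.integral_nonneg ha.max_mem.1 fun x _ => Real.sqrt_nonneg _
  have hcW := hP.constitutive.isDissipation.cW_pos
  have := hP.σc_pos
  have := hP.epsE_pos
  have := hP.Gc_pos
  rw [energy, hp, hP.elastic_eq hu hp,
    hP.nonlinear_eq ht ha.max_mem (z.preciseRep_ae_eq hP.L_pos ha hα), hP.phaseField_eq hL ha hα,
    ← ENNReal.ofReal_add (by positivity) (by positivity),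
    ← ENNReal.ofReal_add (by positivity) (by positivity), redEnergy]
  congr 1
  ring

end WeakStanding

end Problem

end CohesivePF

theorem mainTheorem1_general (P : CohesivePF.Problem) (hP : P.WeakStanding)
    (hw : IntervalIntegrable (fun a => 1 / √(P.w a)) volume 0 1) :
    0 < CohesivePF.rhoC P.k P.w ∧
    (2 * P.ℓ * CohesivePF.cStar P.w ≤ P.L →
      P.L / P.cohesiveLength ≤ CohesivePF.rhoC P.k P.w →
      ∀ t : ℝ, P.epsE < t →
        (∃ z : P.State, P.IsLocalizedResponse t z) ∧
        ∀ z : P.State, P.IsLocalizedResponse t z →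
          P.HasAverageStrain t z ∧ P.MaxOnMidPlane z ∧ P.energy z < ⊤ ∧
          ∀ z' : P.State, P.HasAverageStrain t z' → P.MaxOnMidPlane z' →
            P.energy z ≤ P.energy z') := by
  refine ⟨hP.constitutive.rhoC_pos hw, fun hL hρ t ht =>
    ⟨hP.exists_isLocalizedResponse hw ht, ?_⟩⟩
  rintro z ⟨ā, a, hāt, ha, hu, hp, hα⟩
  have hā := Ioc_subset_Icc_self hāt.mem_Ioc
  have ha := ha.isOptimalProfile hP.constitutive.isDissipation hw hP.ℓ_pos hā
  have hE := hP.energy_eq (hP.halfWidth_le hw hL hā) ht ha hu hp hα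
  refine ⟨hP.hasAverageStrain hu hp, ⟨ā, hā, ?_, z.preciseRep_ae_eq hP.L_pos ha hα⟩,
    hE ▸ ENNReal.ofReal_lt_top, ?_⟩
  · filter_upwards [hα] with x hx
    rw [hx]
    exact ha.mem_Icc _
  · rintro z' ht' ⟨b, hb, hαb, hΓ⟩
    rw [hE]
    exact (ENNReal.ofReal_le_ofReal (hP.redEnergy_le hρ hāt hb)).trans
      (hP.redEnergy_le_energy hw hL z' hb ht' hαb hΓ)

theorem mainTheorem1 (P : CohesivePF.Problem) (hP : P.Standing)
    (hw : IntervalIntegrable (fun a => 1 / √(P.w a)) MeasureTheory.volume 0 1) :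
    0 < CohesivePF.rhoC P.k P.w ∧
    (2 * P.ℓ * CohesivePF.cStar P.w ≤ P.L →
      P.L / P.cohesiveLength ≤ CohesivePF.rhoC P.k P.w →
      ∀ t : ℝ, P.epsE < t →
        (∃ z : P.State, P.IsLocalizedResponse t z) ∧
        ∀ z : P.State, P.IsLocalizedResponse t z →
          P.HasAverageStrain t z ∧ P.MaxOnMidPlane z ∧ P.energy z < ⊤ ∧
          ∀ z' : P.State, P.HasAverageStrain t z' → P.MaxOnMidPlane z' →
            P.energy z ≤ P.energy z') :=
  mainTheorem1_general P hP.weak hw
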